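/- Let $\tau,\eta\in\mathbb{C}$ with $\mathrm{Im}\,\tau>0$, $\mathrm{Im}\,\eta>0$, and let $1,2\eta,\tau$ be incommensurate (linearly independent over $\mathbb{Q}$). Put $p=e^{2\pi i\tau}$, $q=e^{4\pi i\eta}$, $(t;p)_\infty=\prod_{k\ge0}(1-tp^k)$, $$\theta_1(z|\tau)=-\sum_{n\in\mathbb{Z}}e^{\pi i(n+\frac12)^2\tau}e^{2\pi i(n+\frac12)(z+\frac12)},\qquad \theta_2(z|\tau)=\theta_1(z+\tfrac12|\tau),$$ $$\theta_3(z|\tau)=e^{\frac{\pi i\tau}{4}+\pi iz}\theta_2(z+\tfrac{\tau}{2}|\tau),\qquad \theta_4(z|\tau)=\theta_3(z+\tfrac12|\tau),$$ $$\Gamma(z)=\prod_{a,b\ge0}\frac{1-e^{-2\pi iz}p^{a+1}q^{b+1}}{1-e^{2\pi iz}p^aq^b},\qquad \mathrm{R}(\tau)=\frac{e^{-\pi i\tau/4}}{i\,(p;p)_\infty},\qquad c_A=\frac{e^{\pi i\eta}}{\mathrm{R}(\tau)},\qquad c_B=\frac{e^{\pi i\tau/2}}{\mathrm{R}(2\eta)}.$$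 For an entire function $\Phi$ with $\Phi(x+1)=\Phi(x)=\Phi(-x)$, let $[\mathrm{M}(g)\Phi](z)$ be the meromorphic continuation in $g$ of $$\frac{(q;q)_\infty(p;p)_\infty}{2}\int_0^1\frac{\Gamma(z+x-g)\Gamma(z-x-g)\Gamma(-z+x-g)\Gamma(-z-x-g)}{\Gamma(-2g)\Gamma(2x)\Gamma(-2x)}\,\Phi(x)\,dx,\qquad \mathrm{Im}(-g\pm z)>0 .$$ For $k\in\{3,4\}$, define difference operators $$\mathrm{A}_k(g)=e^{\pi i\frac{z^2}{\eta}}\frac{c_A}{\theta_1(2z|\tau)}\Bigl[\theta_k(z+g+\eta|\tfrac\tau2)e^{\eta\partial_z}-\theta_k(z-g-\eta|\tfrac\tau2)e^{-\eta\partial_z}\Bigr]e^{-\pi i\frac{z^2}{\eta}},$$ $$\mathrm{B}_k(g)=e^{2\pi i\frac{z^2}{\tau}}\frac{c_B}{\theta_1(2z|2\eta)}\Bigl[\theta_k(z+g+\tfrac\tau2|\eta)e^{\frac\tau2\partial_z}-\theta_k(z-g-\tfrac\tau2|\eta)e^{-\frac\tau2\partial_z}\Bigr]e^{-2\pi i\frac{z^2}{\tau}},$$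 and, for integers $n,m\ge0$, $$\mathrm{M}^{(k)}(n\eta+m\tfrac\tau2)=\mathrm{A}_k((n-1)\eta+m\tfrac\tau2)\cdots\mathrm{A}_k(m\tfrac\tau2)\,\mathrm{B}_k((m-1)\tfrac\tau2)\cdots\mathrm{B}_k(0)\,\theta_k^{-m}(z|\eta)\,\theta_k^{-n}(z|\tfrac\tau2).$$ Set $$\alpha^{(n)}_k(z)=c_A^n\,\frac{\prod_{j=1}^n\theta_1(2\eta j|\tau)}{\prod_{j=1}^k\theta_1(2\eta j|\tau)\prod_{j=1}^{n-k}\theta_1(2\eta j|\tau)}\cdot\frac{\theta_1(2z+2\eta(n-2k)|\tau)}{\prod_{j=0}^n\theta_1(2z-2\eta(k-j)|\tau)},$$ $$\beta^{(m)}_\ell(z)=c_B^m\,\frac{\prod_{j=1}^m\theta_1(\tau j|2\eta)}{\prod_{j=1}^\ell\theta_1(\tau j|2\eta)\prod_{j=1}^{m-\ell}\theta_1(\tau j|2\eta)}\cdot\frac{\theta_1(2z+\tau(m-2\ell)|2\eta)}{\prod_{j=0}^m\theta_1(2z-\tau(\ell-j)|2\eta)},$$ and let $\mathrm{S}_{n,m}$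 be the finite-difference operator $$\mathrm{S}_{n,m}=(-1)^{nm}e^{-\frac{\pi i\tau}{2}m^2n-\pi i\eta n^2m}\sum_{k=0}^n\sum_{\ell=0}^m(-1)^{k+\ell}\alpha^{(n)}_k(z)\,\beta^{(m)}_\ell(z)\;e^{(n-1)(m-2\ell)\left[\frac{\pi i\tau}{2}(m-2\ell)+2\pi i(z+(n-2k)\eta)\right]}$$ $$\qquad\cdot\;e^{(m-1)(n-2k)\left[\pi i\eta(n-2k)+2\pi i(z+(m-2\ell)\frac\tau2)\right]}\;e^{\left[(n-2k)\eta+(m-2\ell)\frac\tau2\right]\partial_z},$$ where $e^{s\partial_z}f(z)=f(z+s)$. Then, for all integers $n,m\ge0$: (1) for every entire $\Phi$ with $\Phi(x+1)=\Phi(x)=\Phi(-x)$ and every $z$ with $2z\notin\mathbb{Z}+\mathbb{Z}\tau+\mathbb{Z}2\eta$, the function $g\mapsto[\mathrm{M}(g)\Phi](z)$ is continued to a function that is meromorphic in a half-plane $\mathrm{Im}\,g<c$ containing $n\eta+m\frac\tau2$ and analytic at that point, and its value there is $[\mathrm{M}(n\eta+m\tfrac\tau2)\Phi](z)=[\mathrm{S}_{n,m}\Phi](z)$;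 (2) for $k=3,4$, $\mathrm{M}^{(k)}(n\eta+m\frac\tau2)=\mathrm{S}_{n,m}$ as finite-difference operators: $[\mathrm{M}^{(k)}(n\eta+m\tfrac\tau2)f](z)=[\mathrm{S}_{n,m}f](z)$ for every function $f:\mathbb{C}\to\mathbb{C}$ and every $z$ such that none of the numbers $\theta_1(2w|\tau)$, $\theta_1(2w|2\eta)$, $\theta_k(w|\frac\tau2)$, $\theta_k(w|\eta)$ vanishes for $w=z+r\eta+s\frac\tau2$ with integers $|r|\le n$, $|s|\le m$. In particular $\mathrm{M}^{(k)}$ does not depend on $k$. -/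

import Mathlib

noncomputable section

namespace EllipticDouble

open Complex
open scoped Real

/-! ### Theta functions and the elliptic gamma function -/

/-- The Jacobi theta function `θ₁(z|τ)`. -/
def theta1 (z τ : ℂ) : ℂ :=
  -∑' n : ℤ, exp (π * I * ((n : ℂ) + 1 / 2) ^ 2 * τ) *
    exp (2 * π * I * ((n : ℂ) + 1 / 2) * (z + 1 / 2))

/-- The Jacobi theta function `θ₂(z|τ)`. -/
def theta2 (z τ : ℂ) : ℂ := theta1 (z + 1 / 2) τ

/-- The Jacobi theta function `θ₃(z|τ)`. -/
def theta3 (z τ : ℂ) : ℂ := exp (π * I * τ / 4 + π * I * z) * theta2 (z + τ / 2) τ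

/-- The Jacobi theta function `θ₄(z|τ)`. -/
def theta4 (z τ : ℂ) : ℂ := theta3 (z + 1 / 2) τ

/-- `θ_k(z|τ)` for `k = 3, 4`, the two values for which it is used. -/
def thetaK (k : ℕ) (z τ : ℂ) : ℂ := if k = 3 then theta3 z τ else theta4 z τ

/-- The infinite product `(p;p)_∞` with `p = e^{2πiτ}`. -/
def qPoch (τ : ℂ) : ℂ := ∏' k : ℕ, (1 - exp (2 * π * I * τ) ^ (k + 1))

/-- The constant `R(τ) = p^{-1/8} / (i (p;p)_∞)` with `p = e^{2πiτ}`. -/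
def constR (τ : ℂ) : ℂ := exp (-(π * I * τ / 4)) / (I * qPoch τ)

/-- The elliptic gamma function `Γ(z|τ,2η)`, with `p = e^{2πiτ}` and `q = e^{4πiη}`. -/
def ellGamma (τ η z : ℂ) : ℂ :=
  ∏' nm : ℕ × ℕ,
    (1 - exp (-(2 * π * I * z)) * exp (2 * π * I * τ) ^ (nm.1 + 1) *
        exp (4 * π * I * η) ^ (nm.2 + 1)) /
      (1 - exp (2 * π * I * z) * exp (2 * π * I * τ) ^ nm.1 * exp (4 * π * I * η) ^ nm.2)

/-! ### The integral operator `M(g)` -/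

/-- The integral
`(q;q)_∞ (p;p)_∞ / 2 · ∫₀¹ Γ(±z±x-g) / Γ(-2g,±2x) Φ(x) dx`,
which represents `[M(g)Φ](z)` when `Im(-g±z) > 0`. -/
def intertwinerIntegral (τ η g : ℂ) (Φ : ℂ → ℂ) (z : ℂ) : ℂ :=
  qPoch (2 * η) * qPoch τ / 2 *
    ∫ x in (0 : ℝ)..1,
      (ellGamma τ η (z + x - g) * ellGamma τ η (z - x - g) *
          ellGamma τ η (-z + x - g) * ellGamma τ η (-z - x - g)) /
        (ellGamma τ η (-2 * g) * ellGamma τ η (2 * x) * ellGamma τ η (-2 * x)) * Φ x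

/-- `IntertwinerValue τ η g Φ z v` says that `[M(g)Φ](z) = v`, where `[M(g)Φ](z)` is the analytic
continuation in `g` of the integral above: there is a meromorphic function `F` on a half-plane
`Im s < c` containing `g`, equal to the integral wherever `Im(-s±z) > 0` (except at the isolated
zeros of the denominator `Γ(-2s)`), analytic at `g`, with `F g = v`.
As the half-plane is connected, the identity theorem makes `v` unique. -/
def IntertwinerValue (τ η g : ℂ) (Φ : ℂ → ℂ) (z v : ℂ) : Prop :=
  ∃ (c : ℝ) (F : ℂ → ℂ), g.im < c ∧ MeromorphicOn F {s : ℂ | s.im < c} ∧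
    (∀ s : ℂ, s.im < c → 0 < (-s + z).im → 0 < (-s - z).im → ellGamma τ η (-2 * s) ≠ 0 →
      F s = intertwinerIntegral τ η s Φ z) ∧
    AnalyticAt ℂ F g ∧ F g = v

/-! ### The factorized operator -/

/-- The constant `c_A`. -/
def constA (τ η : ℂ) : ℂ := exp (π * I * η) / constR τ

/-- The constant `c_B`. -/
def constB (τ η : ℂ) : ℂ := exp (π * I * (τ / 2)) / constR (2 * η)

/-- The difference operator
`A_k(g) = e^{πiz²/η} (c_A/θ₁(2z|τ)) [θ_k(z+g+η|τ/2) e^{η∂} - θ_k(z-g-η|τ/2) e^{-η∂}] e^{-πiz²/η}`. -/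
def opA (τ η : ℂ) (k : ℕ) (g : ℂ) (f : ℂ → ℂ) (z : ℂ) : ℂ :=
  exp (π * I * z ^ 2 / η) * (constA τ η / theta1 (2 * z) τ) *
    (thetaK k (z + g + η) (τ / 2) * (exp (-(π * I * (z + η) ^ 2 / η)) * f (z + η)) -
      thetaK k (z - g - η) (τ / 2) * (exp (-(π * I * (z - η) ^ 2 / η)) * f (z - η)))

/-- The difference operator
`B_k(g) = e^{2πiz²/τ} (c_B/θ₁(2z|2η)) [θ_k(z+g+τ/2|η) e^{τ∂/2} - θ_k(z-g-τ/2|η) e^{-τ∂/2}]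
e^{-2πiz²/τ}`. -/
def opB (τ η : ℂ) (k : ℕ) (g : ℂ) (f : ℂ → ℂ) (z : ℂ) : ℂ :=
  exp (2 * π * I * z ^ 2 / τ) * (constB τ η / theta1 (2 * z) (2 * η)) *
    (thetaK k (z + g + τ / 2) η * (exp (-(2 * π * I * (z + τ / 2) ^ 2 / τ)) * f (z + τ / 2)) -
      thetaK k (z - g - τ / 2) η * (exp (-(2 * π * I * (z - τ / 2) ^ 2 / τ)) * f (z - τ / 2)))

/-- The product `A_k(g+(n-1)η) ⋯ A_k(g+η) A_k(g)`. -/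
def prodA (τ η : ℂ) (k : ℕ) (g : ℂ) : ℕ → (ℂ → ℂ) → (ℂ → ℂ)
  | 0, f => f
  | n + 1, f => opA τ η k (g + n * η) (prodA τ η k g n f)

/-- The product `B_k(g+(m-1)τ/2) ⋯ B_k(g+τ/2) B_k(g)`. -/
def prodB (τ η : ℂ) (k : ℕ) (g : ℂ) : ℕ → (ℂ → ℂ) → (ℂ → ℂ)
  | 0, f => f
  | m + 1, f => opB τ η k (g + m * (τ / 2)) (prodB τ η k g m f)

/-- The factorized operator `M^{(k)}(nη+mτ/2)`:
`A_k((n-1)η+mτ/2) ⋯ A_k(mτ/2) B_k((m-1)τ/2) ⋯ B_k(0) θ_k(z|η)^{-m} θ_k(z|τ/2)^{-n}`. -/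
def factorizedM (τ η : ℂ) (k n m : ℕ) (f : ℂ → ℂ) : ℂ → ℂ :=
  prodA τ η k (m * (τ / 2)) n
    (prodB τ η k 0 m fun w => f w / (thetaK k w η ^ m * thetaK k w (τ / 2) ^ n))

/-- None of the theta functions by which `factorizedM τ η k n m f z` divides vanishes. The set of
such `z` is the complement of a closed discrete set. -/
def RegularPoint (τ η : ℂ) (k n m : ℕ) (z : ℂ) : Prop :=
  ∀ i j : ℤ, |i| ≤ n → |j| ≤ m →
    theta1 (2 * (z + i * η + j * (τ / 2))) τ ≠ 0 ∧
    theta1 (2 * (z + i * η + j * (τ / 2))) (2 * η) ≠ 0 ∧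
    thetaK k (z + i * η + j * (τ / 2)) (τ / 2) ≠ 0 ∧
    thetaK k (z + i * η + j * (τ / 2)) η ≠ 0

/-! ### The normal ordered form -/

/-- The elliptic binomial coefficient with modulus `τ` and step `h`. -/
def ellBinom (τ h : ℂ) (n l : ℕ) : ℂ :=
  (∏ j ∈ Finset.Icc 1 n, theta1 (h * j) τ) /
    ((∏ j ∈ Finset.Icc 1 l, theta1 (h * j) τ) * ∏ j ∈ Finset.Icc 1 (n - l), theta1 (h * j) τ)

/-- The coefficient `α_l^{(n)}(z)`, for `l ≤ n`. -/
def alphaCoeff (τ η : ℂ) (n l : ℕ) (z : ℂ) : ℂ :=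
  constA τ η ^ n * ellBinom τ (2 * η) n l *
    (theta1 (2 * z + 2 * η * ((n : ℂ) - 2 * l)) τ /
      ∏ j ∈ Finset.range (n + 1), theta1 (2 * z - 2 * η * ((l : ℂ) - j)) τ)

/-- The coefficient `β_l^{(m)}(z)`, for `l ≤ m`. -/
def betaCoeff (τ η : ℂ) (m l : ℕ) (z : ℂ) : ℂ :=
  constB τ η ^ m * ellBinom (2 * η) τ m l *
    (theta1 (2 * z + τ * ((m : ℂ) - 2 * l)) (2 * η) /
      ∏ j ∈ Finset.range (m + 1), theta1 (2 * z - τ * ((l : ℂ) - j)) (2 * η))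

/-- The normal ordered finite-difference operator, all shift operators standing on the right. -/
def normalOrderedM (τ η : ℂ) (n m : ℕ) (f : ℂ → ℂ) (z : ℂ) : ℂ :=
  (-1) ^ (n * m) * exp (-(π * I * τ / 2 * m ^ 2 * n) - π * I * η * n ^ 2 * m) *
    ∑ k ∈ Finset.range (n + 1), (-1) ^ k * alphaCoeff τ η n k z *
      ∑ l ∈ Finset.range (m + 1), (-1) ^ l * betaCoeff τ η m l z *
        exp (((n : ℂ) - 1) * ((m : ℂ) - 2 * l) *
          (π * I * τ / 2 * ((m : ℂ) - 2 * l) + 2 * π * I * (z + ((n : ℂ) - 2 * k) * η))) *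
        exp (((m : ℂ) - 1) * ((n : ℂ) - 2 * k) *
          (π * I * η * ((n : ℂ) - 2 * k) + 2 * π * I * (z + ((m : ℂ) - 2 * l) * (τ / 2)))) *
        f (z + (((n : ℂ) - 2 * k) * η + ((m : ℂ) - 2 * l) * (τ / 2)))

end EllipticDouble

end

noncomputable section

namespace EllipticDouble

open Complex Filter Topology MeasureTheory
open scoped Real

/-! ### Products `∏ (1 - w rᵢ)` -/

/-! Both the continued integral and the factorized product are shown to equal `S_{n,m}`, by
unrelated arguments.

The integral. With `w = e^{2πix}`, the kernel has poles where `t w = 1` or `t / w = 1`, with `t =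
exp(2πi(±z + aτ + 2bη - s))` and `a, b ≥ 0`. For `Im(-s±z) > 0` every `t` lies in the unit disc. On
the way to `g = nη + mτ/2` only finitely many leave it; these are split off, and the rest of the
kernel stays holomorphic on a strip. Partial fractions in `w + 1/w` (`prod_inv_eq_sum`) reduce to
one `t` at a time, and for an even integrand each piece continues in `t` once its contour is raised
(`integral_mul_inv_eq_contourInt`). The prefactor `1/Γ(-2s)` vanishes at `g`, so only terms with a
singular partial fraction coefficient survive, namely those where `t t' = 1` for two poles. By
incommensurability and the condition on `2z` these are exactly the pairs `(+, a, b)`, `(-, m-a,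
n-b)` with `a ≤ m`, `b ≤ n`. The two contour integrals of a pair have inverse parameters, so their
sum is a residue (`contourInt_add_inv`), that is, a value of `Φ` at a shifted point. The limit is
thus a finite-difference operator (`intertwinerValue_sum`). Its coefficients are quotients of
elliptic gamma functions and of their residues at lattice-shifted arguments; the functional equation
of `Γ` and the Jacobi triple product turn them into the `θ₁` quotients of `S_{n,m}`
(`pinchCoeff_eq_nomCoeff`).

The factorization. `A_k(mτ/2 + nη) S_{n,m} = S_{n+1,m} θ_k(·|τ/2)` (`opA_normalOrderedM`): each
shift on the right receives two contributions from the left, which a three-term relation between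
`θ₁(·|τ)` and `θ_k(·|τ/2)` adds up. This gives an induction on `n`. Exchanging `τ` and `2η` turns
`B_k` into `A_k`, so the same induction covers `m`. -/

/-- The product `∏ᵢ (1 - w rᵢ)`. -/
def prodOneSub {ι : Type*} (r : ι → ℂ) (w : ℂ) : ℂ := ∏' i, (1 - w * r i)

section prodOneSub

variable {ι : Type*} {r : ι → ℂ}

theorem hasProd_prodOneSub (hr : Summable fun i => ‖r i‖) (w : ℂ) :
    HasProd (fun i => 1 - w * r i) (prodOneSub r w) := by
  have h : Summable fun i => ‖-(w * r i)‖ := by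
    simpa only [norm_neg, norm_mul] using hr.mul_left ‖w‖
  have := (multipliable_one_add_of_summable h).hasProd
  simp only [← sub_eq_add_neg] at this
  exact this

theorem prodOneSub_eq_zero_iff (hr : Summable fun i => ‖r i‖) (w : ℂ) :
    prodOneSub r w = 0 ↔ ∃ i, w * r i = 1 := by
  constructor
  · intro h
    by_contra! hne
    refine tprod_one_add_ne_zero_of_summable (f := fun i => -(w * r i)) (fun i => ?_) ?_
      (by simpa only [prodOneSub, sub_eq_add_neg] using h)
    · rw [← sub_eq_add_neg]
      exact sub_ne_zero.mpr (hne i).symm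
    · simpa only [norm_neg, norm_mul] using hr.mul_left ‖w‖
  · rintro ⟨i, hi⟩
    exact (hasProd_prodOneSub hr w).unique (hasProd_zero_of_exists_eq_zero ⟨i, by simp [hi]⟩)

theorem differentiable_prodOneSub (hr : Summable fun i => ‖r i‖) :
    Differentiable ℂ (prodOneSub r) := by
  intro w
  have hopen : IsOpen (Metric.ball (0 : ℂ) (‖w‖ + 1)) := Metric.isOpen_ball
  have h := (Summable.hasProdLocallyUniformlyOn_one_add
    (f := fun i (v : ℂ) => -(v * r i)) (u := fun i => (‖w‖ + 1) * ‖r i‖)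
    hopen (hr.mul_left _)
    (Eventually.of_forall fun i v hv => by
      rw [norm_neg, norm_mul]
      have : ‖v‖ < ‖w‖ + 1 := by simpa using hv
      gcongr)
    (fun i => by fun_prop)).differentiableOn
    (Eventually.of_forall fun s => by
      apply DifferentiableOn.fun_finsetProd
      intro i _
      fun_prop) hopen
  have h2 := h.differentiableAt (hopen.mem_nhds (x := w) (by simp))
  simp only [← sub_eq_add_neg] at h2
  exact h2

/-- Replacing `r i` by `0` on `s` turns these factors into `1` without changing the index type, so
the remainder is a product of the same kind. This is how finitely many zeros are taken out of the
double product. -/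
theorem prodOneSub_split [DecidableEq ι] (hr : Summable fun i => ‖r i‖) (s : Finset ι) (w : ℂ) :
    prodOneSub r w =
      (∏ i ∈ s, (1 - w * r i)) * prodOneSub (fun i => if i ∈ s then 0 else r i) w := by
  have hr' : Summable fun i => ‖if i ∈ s then 0 else r i‖ :=
    hr.of_nonneg_of_le (fun _ => norm_nonneg _) fun i => by split_ifs <;> simp
  have h1 : HasProd (fun i => if i ∈ s then 1 - w * r i else 1) (∏ i ∈ s, (1 - w * r i)) := by
    have := hasProd_prod_of_ne_finset_one (s := s)
      (f := fun i => if i ∈ s then 1 - w * r i else 1) (L := .unconditional ι)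
      (fun i hi => by simp [hi])
    rwa [Finset.prod_congr rfl fun i hi => if_pos hi] at this
  refine (hasProd_prodOneSub hr w).unique ?_
  convert h1.mul (hasProd_prodOneSub hr' w) using 2 with i
  split_ifs <;> simp

theorem summable_norm_ite {s : Finset ι} [DecidableEq ι] (hr : Summable fun i => ‖r i‖) :
    Summable fun i => ‖if i ∈ s then 0 else r i‖ :=
  hr.of_nonneg_of_le (fun _ => norm_nonneg _) fun i => by split_ifs <;> simp

/-- Source of the functional equations: the index `0` is split off `ℕ`, or the row `b = 0` off `ℕ ×
ℕ`. -/
theorem prodOneSub_of_isCompl {α β : Type*} {f : α → ι} {g : β → ι}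
    (hr : Summable fun i => ‖r i‖) (hf : f.Injective) (hg : g.Injective)
    (h : IsCompl (Set.range f) (Set.range g)) (w : ℂ) :
    prodOneSub r w = prodOneSub (r ∘ f) w * prodOneSub (r ∘ g) w := by
  have hrf : Summable fun i => ‖(r ∘ f) i‖ := hr.comp_injective hf
  have hrg : Summable fun i => ‖(r ∘ g) i‖ := hr.comp_injective hg
  have h1 : HasProd ((fun i => 1 - w * r i) ∘ f) (prodOneSub (r ∘ f) w) :=
    hasProd_prodOneSub hrf w
  have h2 : HasProd ((fun i => 1 - w * r i) ∘ g) (prodOneSub (r ∘ g) w) :=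
    hasProd_prodOneSub hrg w
  refine (hasProd_prodOneSub hr w).unique ?_
  exact (hf.hasProd_range_iff.2 h1).mul_isCompl h (hg.hasProd_range_iff.2 h2)

theorem prodOneSub_const_mul (c w : ℂ) :
    prodOneSub (fun i => c * r i) w = prodOneSub r (c * w) := by
  simp only [prodOneSub]
  congr 1; ext i; ring

end prodOneSub

/-! ### The products `(w;p)_∞` and `∏ (1 - w p^a q^b)` and their shift relations -/

/-- The product `(w;p)_∞`. -/
def qProd (p w : ℂ) : ℂ := prodOneSub (fun k : ℕ => p ^ k) w

/-- The product `∏_{a,b} (1 - w p^a q^b)`. -/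
def pqProd (p q w : ℂ) : ℂ := prodOneSub (fun j : ℕ × ℕ => p ^ j.1 * q ^ j.2) w

/-- The product `(w;p)_∞ (p/w;p)_∞`. -/
def modTheta (p w : ℂ) : ℂ := qProd p w * qProd p (p / w)

section

variable {p q : ℂ}

theorem summable_norm_pow (hp : ‖p‖ < 1) : Summable fun k : ℕ => ‖p ^ k‖ := by
  simpa only [norm_pow] using summable_geometric_of_lt_one (norm_nonneg p) hp

theorem summable_norm_pow_mul_pow (hp : ‖p‖ < 1) (hq : ‖q‖ < 1) :
    Summable fun j : ℕ × ℕ => ‖p ^ j.1 * q ^ j.2‖ := by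
  simpa only [norm_mul] using (summable_norm_pow hp).mul_of_nonneg (summable_norm_pow hq)
    (fun _ => norm_nonneg _) (fun _ => norm_nonneg _)

theorem qProd_eq (hp : ‖p‖ < 1) (w : ℂ) : qProd p w = (1 - w) * qProd p (p * w) := by
  have h := prodOneSub_of_isCompl (r := fun k : ℕ => p ^ k) (f := fun _ : Unit => (0 : ℕ))
    (g := Nat.succ) (summable_norm_pow hp) (fun _ _ _ => rfl) Nat.succ_injective
    (by
      refine IsCompl.of_eq (Set.eq_empty_of_forall_notMem ?_) (Set.eq_univ_of_forall ?_)
      · rintro x ⟨⟨_, rfl⟩, ⟨j, hj⟩⟩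
        exact Nat.succ_ne_zero j hj
      · rintro (_ | k)
        · exact Or.inl ⟨(), rfl⟩
        · exact Or.inr ⟨k, rfl⟩) w
  rw [qProd, h, qProd, ← prodOneSub_const_mul]
  congr 1
  · simp [prodOneSub]
  · congr 1; ext k; simp [pow_succ']

theorem pqProd_eq_right (hp : ‖p‖ < 1) (hq : ‖q‖ < 1) (w : ℂ) :
    pqProd p q w = qProd p w * pqProd p q (q * w) := by
  have h := prodOneSub_of_isCompl (r := fun j : ℕ × ℕ => p ^ j.1 * q ^ j.2)
    (f := fun k : ℕ => (k, 0)) (g := fun j : ℕ × ℕ => (j.1, j.2 + 1))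
    (summable_norm_pow_mul_pow hp hq) (fun _ _ h => by simpa using h)
    (fun a b h => by simpa [Prod.ext_iff] using h)
    (by
      refine IsCompl.of_eq (Set.eq_empty_of_forall_notMem ?_) (Set.eq_univ_of_forall ?_)
      · rintro x ⟨⟨k, rfl⟩, ⟨j, hj⟩⟩
        simp at hj
      · rintro ⟨a, _ | b⟩
        · exact Or.inl ⟨a, rfl⟩
        · exact Or.inr ⟨(a, b), rfl⟩) w
  rw [pqProd, h, pqProd, ← prodOneSub_const_mul]
  congr 1
  · simp [qProd, Function.comp_def]
  · congr 1; ext k; simp [pow_succ']; ring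

theorem pqProd_comm (hp : ‖p‖ < 1) (hq : ‖q‖ < 1) (w : ℂ) : pqProd p q w = pqProd q p w := by
  have h := (Equiv.prodComm ℕ ℕ).hasProd_iff.2
    (hasProd_prodOneSub (summable_norm_pow_mul_pow hp hq) w)
  refine h.unique ?_
  have h2 : HasProd (fun j : ℕ × ℕ => 1 - w * (q ^ j.1 * p ^ j.2)) (pqProd q p w) :=
    hasProd_prodOneSub (summable_norm_pow_mul_pow hq hp) w
  refine h2.congr_fun fun j => ?_
  simp [mul_comm]

theorem pqProd_eq_left (hp : ‖p‖ < 1) (hq : ‖q‖ < 1) (w : ℂ) :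
    pqProd p q w = qProd q w * pqProd p q (p * w) := by
  rw [pqProd_comm hp hq, pqProd_eq_right hq hp, pqProd_comm hq hp]

theorem qProd_eq_zero_iff (hp : ‖p‖ < 1) (w : ℂ) : qProd p w = 0 ↔ ∃ k : ℕ, w * p ^ k = 1 :=
  prodOneSub_eq_zero_iff (summable_norm_pow hp) w

theorem pqProd_eq_zero_iff (hp : ‖p‖ < 1) (hq : ‖q‖ < 1) (w : ℂ) :
    pqProd p q w = 0 ↔ ∃ j : ℕ × ℕ, w * (p ^ j.1 * q ^ j.2) = 1 :=
  prodOneSub_eq_zero_iff (summable_norm_pow_mul_pow hp hq) w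

theorem qProd_ne_zero (hp : ‖p‖ < 1) {w : ℂ} (hw : ‖w‖ < 1) : qProd p w ≠ 0 := by
  rw [Ne, qProd_eq_zero_iff hp]
  rintro ⟨k, hk⟩
  have h1 : ‖w‖ * ‖p‖ ^ k = 1 := by simpa using congrArg norm hk
  have h2 : ‖p‖ ^ k ≤ 1 := pow_le_one₀ (norm_nonneg _) hp.le
  nlinarith [norm_nonneg w]

theorem pqProd_ne_zero (hp : ‖p‖ < 1) (hq : ‖q‖ < 1) {w : ℂ} (hw : ‖w‖ < 1) :
    pqProd p q w ≠ 0 := by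
  rw [Ne, pqProd_eq_zero_iff hp hq]
  rintro ⟨j, hj⟩
  have h1 : ‖w‖ * (‖p‖ ^ j.1 * ‖q‖ ^ j.2) = 1 := by simpa using congrArg norm hj
  have h2 : ‖p‖ ^ j.1 * ‖q‖ ^ j.2 ≤ 1 :=
    mul_le_one₀ (pow_le_one₀ (norm_nonneg _) hp.le) (by positivity)
      (pow_le_one₀ (norm_nonneg _) hq.le)
  nlinarith [norm_nonneg w]

theorem differentiable_qProd (hp : ‖p‖ < 1) : Differentiable ℂ (qProd p) :=
  differentiable_prodOneSub (summable_norm_pow hp)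

theorem differentiable_pqProd (hp : ‖p‖ < 1) (hq : ‖q‖ < 1) : Differentiable ℂ (pqProd p q) :=
  differentiable_prodOneSub (summable_norm_pow_mul_pow hp hq)

end

/-! ### The elliptic gamma function as a quotient of entire functions -/

theorem norm_exp_two_pi_I_mul (τ : ℂ) : ‖exp (2 * π * I * τ)‖ = Real.exp (-(2 * π * τ.im)) := by
  rw [norm_exp]; congr 1; simp

theorem norm_exp_two_pi_I_mul_lt_one {τ : ℂ} (hτ : 0 < τ.im) : ‖exp (2 * π * I * τ)‖ < 1 := by
  rw [norm_exp_two_pi_I_mul, Real.exp_lt_one_iff]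
  have := Real.pi_pos
  nlinarith [mul_pos this hτ]

theorem norm_exp_four_pi_I_mul_lt_one {η : ℂ} (hη : 0 < η.im) : ‖exp (4 * π * I * η)‖ < 1 := by
  have h := norm_exp_two_pi_I_mul_lt_one (τ := 2 * η) (by simpa using hη)
  rwa [show 2 * (π : ℂ) * I * (2 * η) = 4 * π * I * η by ring] at h

/-- Poles need not be excluded: there one factor of the infinite product is a division by zero,
hence `0`, and the quotient on the right is `0` for the same reason. -/
theorem ellGamma_eq {τ η : ℂ} (hτ : 0 < τ.im) (hη : 0 < η.im) (u : ℂ) :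
    ellGamma τ η u =
      pqProd (exp (2 * π * I * τ)) (exp (4 * π * I * η))
        (exp (2 * π * I * τ) * exp (4 * π * I * η) * exp (-(2 * π * I * u))) /
      pqProd (exp (2 * π * I * τ)) (exp (4 * π * I * η)) (exp (2 * π * I * u)) := by
  have hp := norm_exp_two_pi_I_mul_lt_one hτ
  have hq := norm_exp_four_pi_I_mul_lt_one hη
  rw [ellGamma]
  set p := exp (2 * π * I * τ)
  set q := exp (4 * π * I * η)
  have hs := summable_norm_pow_mul_pow hp hq
  by_cases h0 : pqProd p q (exp (2 * π * I * u)) = 0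
  · rw [h0, div_zero]
    obtain ⟨j, hj⟩ := (pqProd_eq_zero_iff hp hq _).1 h0
    exact tprod_of_exists_eq_zero ⟨j, by rw [mul_assoc _ (p ^ j.1), hj]; simp⟩
  · refine HasProd.tprod_eq ?_
    refine ((hasProd_prodOneSub hs (p * q * exp (-(2 * π * I * u)))).div₀
      (hasProd_prodOneSub hs (exp (2 * π * I * u))) h0).congr_fun fun j => ?_
    congr 1 <;> ring

theorem qPoch_eq (τ : ℂ) : qPoch τ = qProd (exp (2 * π * I * τ)) (exp (2 * π * I * τ)) := by
  rw [qPoch, qProd, prodOneSub]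
  congr 1; ext k; rw [pow_succ']

theorem qPoch_ne_zero {τ : ℂ} (hτ : 0 < τ.im) : qPoch τ ≠ 0 := by
  rw [qPoch_eq]
  exact qProd_ne_zero (norm_exp_two_pi_I_mul_lt_one hτ) (norm_exp_two_pi_I_mul_lt_one hτ)

theorem constR_ne_zero {τ : ℂ} (hτ : 0 < τ.im) : constR τ ≠ 0 :=
  div_ne_zero (exp_ne_zero _) (mul_ne_zero I_ne_zero (qPoch_ne_zero hτ))

/-! ### The Jacobi triple product -/

/-- The finite product `(1 - p)(1 - p²)⋯(1 - pⁿ)`. -/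
def qFact (p : ℂ) (n : ℕ) : ℂ := ∏ i ∈ Finset.range n, (1 - p ^ (i + 1))

/-- The Gaussian binomial coefficient, for `k ≤ n`. -/
def gaussBinom (p : ℂ) (n k : ℕ) : ℂ := qFact p n / (qFact p k * qFact p (n - k))

section

variable {p : ℂ}

theorem one_sub_pow_ne_zero (hp : ‖p‖ < 1) (k : ℕ) : 1 - p ^ (k + 1) ≠ 0 := by
  intro h
  have h1 : ‖p‖ ^ (k + 1) = 1 := by
    rw [← norm_pow, ← sub_eq_zero.mp h, norm_one]
  exact (pow_lt_one₀ (norm_nonneg p) hp k.succ_ne_zero).ne h1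

theorem qFact_ne_zero (hp : ‖p‖ < 1) (n : ℕ) : qFact p n ≠ 0 :=
  Finset.prod_ne_zero_iff.mpr fun i _ => one_sub_pow_ne_zero hp i

theorem qFact_succ (n : ℕ) : qFact p (n + 1) = qFact p n * (1 - p ^ (n + 1)) :=
  Finset.prod_range_succ _ _

theorem gaussBinom_zero_right (hp : ‖p‖ < 1) (n : ℕ) : gaussBinom p n 0 = 1 := by
  have := qFact_ne_zero hp n
  simp only [gaussBinom, Nat.sub_zero]
  rw [show qFact p 0 = 1 from rfl]
  field_simp

theorem gaussBinom_self (hp : ‖p‖ < 1) (n : ℕ) : gaussBinom p n n = 1 := by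
  have := qFact_ne_zero hp n
  simp only [gaussBinom, Nat.sub_self]
  rw [show qFact p 0 = 1 from rfl]
  field_simp

theorem gaussBinom_succ_succ (hp : ‖p‖ < 1) {n k : ℕ} (h : k + 1 ≤ n) :
    gaussBinom p (n + 1) (k + 1) =
      gaussBinom p n (k + 1) + p ^ (n - k) * gaussBinom p n k := by
  obtain ⟨d, rfl⟩ := Nat.exists_eq_add_of_le h
  have e1 : k + 1 + d + 1 - (k + 1) = d + 1 := by omega
  have e2 : k + 1 + d - (k + 1) = d := by omega
  have e3 : k + 1 + d - k = d + 1 := by omega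
  simp only [gaussBinom, e1, e2, e3, qFact_succ]
  have h1 := qFact_ne_zero hp k
  have h2 := qFact_ne_zero hp d
  have h3 := one_sub_pow_ne_zero hp k
  have h4 := one_sub_pow_ne_zero hp d
  field_simp
  ring

/-- The `q`-binomial theorem. -/
theorem prod_one_add_mul_pow (hp : ‖p‖ < 1) (x : ℂ) (n : ℕ) :
    ∏ k ∈ Finset.range n, (1 + x * p ^ k) =
      ∑ k ∈ Finset.range (n + 1), p ^ (k.choose 2) * gaussBinom p n k * x ^ k := by
  induction n with
  | zero => simp [gaussBinom, qFact]
  | succ n ih =>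
    rw [Finset.prod_range_succ, ih, mul_add, mul_one, Finset.sum_range_succ' _ (n + 1),
      Finset.sum_range_succ (fun k => _ ^ ((k + 1).choose 2) * _ * _) n]
    nth_rewrite 1 [Finset.sum_range_succ' _ n]
    rw [Finset.sum_range_succ (fun k => p ^ (k.choose 2) * gaussBinom p n k * x ^ k) n]
    -- Pascal's rule is available only for `k + 1 ≤ n`, so the two extreme coefficients have been
    -- separated from the sum.
    have key : ∀ k ∈ Finset.range n,
        p ^ ((k + 1).choose 2) * gaussBinom p (n + 1) (k + 1) * x ^ (k + 1) =
          p ^ ((k + 1).choose 2) * gaussBinom p n (k + 1) * x ^ (k + 1) +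
          p ^ (k.choose 2) * gaussBinom p n k * x ^ k * (x * p ^ n) := by
      intro k hk
      have hk' : k + 1 ≤ n := Finset.mem_range.mp hk
      rw [gaussBinom_succ_succ hp hk', Nat.choose_succ_succ' k 1, Nat.choose_one_right, pow_add,
        show p ^ n = p ^ k * p ^ (n - k) by rw [← pow_add]; congr 1; omega]
      ring
    rw [Finset.sum_congr rfl key, Finset.sum_add_distrib, add_mul, Finset.sum_mul]
    simp only [gaussBinom_zero_right hp, gaussBinom_self hp, Nat.choose_succ_succ' n 1,
      Nat.choose_one_right, pow_add]
    ring

theorem tendsto_qFact (hp : ‖p‖ < 1) : Tendsto (qFact p) atTop (𝓝 (qProd p p)) := by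
  have := (hasProd_prodOneSub (summable_norm_pow hp) p).tendsto_prod_nat
  simp only [← pow_succ'] at this
  exact this

theorem tendsto_prod_one_sub_mul_pow (hp : ‖p‖ < 1) (w : ℂ) :
    Tendsto (fun n => ∏ k ∈ Finset.range n, (1 - w * p ^ k)) atTop (𝓝 (qProd p w)) :=
  (hasProd_prodOneSub (summable_norm_pow hp) w).tendsto_prod_nat

/-- Both `(p;p)_n` and its inverse converge, hence are bounded. The bound, uniform in `n` and `k`,
provides the dominating series for the triple product. -/
theorem exists_gaussBinom_bound (hp : ‖p‖ < 1) : ∃ C, ∀ n k, ‖gaussBinom p n k‖ ≤ C := by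
  have h1 : Tendsto (fun n => ‖qFact p n‖) atTop (𝓝 ‖qProd p p‖) := (tendsto_qFact hp).norm
  have h2 : Tendsto (fun n => ‖(qFact p n)⁻¹‖) atTop (𝓝 ‖(qProd p p)⁻¹‖) :=
    ((tendsto_qFact hp).inv₀ (qProd_ne_zero hp hp)).norm
  obtain ⟨M, hM⟩ := h1.bddAbove_range
  obtain ⟨D, hD⟩ := h2.bddAbove_range
  have hM' : ∀ n, ‖qFact p n‖ ≤ M := fun n => hM ⟨n, rfl⟩
  have hD' : ∀ n, ‖(qFact p n)⁻¹‖ ≤ D := fun n => hD ⟨n, rfl⟩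
  have hM0 := (norm_nonneg _).trans (hM' 0)
  have hD0 := (norm_nonneg _).trans (hD' 0)
  refine ⟨M * (D * D), fun n k => ?_⟩
  rw [gaussBinom, div_eq_mul_inv, mul_inv, norm_mul, norm_mul]
  have a1 := hM' n
  have a2 := hD' k
  have a3 := hD' (n - k)
  gcongr

end

theorem jacobiTheta₂_term_eq (j : ℤ) (x τ : ℂ) :
    jacobiTheta₂_term j x τ = exp (2 * π * I * j * x + π * I * j ^ 2 * τ) := rfl

theorem neg_exp (x : ℂ) : -exp x = exp (x + π * I) := (exp_antiperiodic x).symm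

theorem prod_exp_linear (A B : ℂ) (n : ℕ) :
    ∏ j ∈ Finset.range n, exp (A + B * j) = exp (A * n + B * (n * (n - 1) / 2)) := by
  induction n with
  | zero => simp
  | succ n ih =>
    rw [Finset.prod_range_succ, ih, ← exp_add]
    congr 1
    push_cast
    ring

/-- The finite form of the triple product identity. -/
theorem finite_triple_product {τ : ℂ} (hτ : 0 < τ.im) (x : ℂ) (N : ℕ) :
    (∏ k ∈ Finset.range N, (1 - exp (2 * π * I * x) * exp (2 * π * I * τ) ^ k)) *
      ∏ k ∈ Finset.range N,
        (1 - exp (2 * π * I * τ) / exp (2 * π * I * x) * exp (2 * π * I * τ) ^ k) =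
    ∑ k ∈ Finset.range (2 * N + 1),
      jacobiTheta₂_term ((k : ℤ) - N) (x + 1 / 2 - τ / 2) τ *
        gaussBinom (exp (2 * π * I * τ)) (2 * N) k := by
  have hp := norm_exp_two_pi_I_mul_lt_one hτ
  have hm1 : exp (π * I) = -1 := exp_pi_mul_I
  have hpow : ∀ k : ℕ, exp (2 * π * I * τ) ^ k = exp (2 * π * I * τ * k) := fun k => by
    rw [← exp_nat_mul]; ring_nf
  have hX : ∀ k : ℕ, exp (2 * π * I * (x + 1 / 2 - N * τ)) * exp (2 * π * I * τ) ^ k =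
      -(exp (2 * π * I * x) * exp (2 * π * I * τ * (k - N))) := fun k => by
    rw [hpow, ← exp_add, ← exp_add, ← neg_one_mul, ← hm1, ← exp_add]; ring_nf
  -- The argument is `-e^{2πix} p^{-N}`: the upper `N` of the `2N` factors form the first product,
  -- and the lower `N`, in reverse order, form the second one up to a monomial.
  have h := prod_one_add_mul_pow hp (exp (2 * π * I * (x + 1 / 2 - N * τ))) (2 * N)
  rw [two_mul N, Finset.prod_range_add, ← Finset.prod_range_reflect] at h
  have h2 : ∏ k ∈ Finset.range N, (1 + exp (2 * π * I * (x + 1 / 2 - N * τ)) *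
      exp (2 * π * I * τ) ^ (N + k)) =
      ∏ k ∈ Finset.range N, (1 - exp (2 * π * I * x) * exp (2 * π * I * τ) ^ k) := by
    refine Finset.prod_congr rfl fun k _ => ?_
    rw [hX, hpow, ← sub_eq_add_neg]
    push_cast
    ring_nf
  have h1 : ∏ k ∈ Finset.range N, (1 + exp (2 * π * I * (x + 1 / 2 - N * τ)) *
      exp (2 * π * I * τ) ^ (N - 1 - k)) =
      exp (2 * π * I * (x + 1 / 2) * N - π * I * τ * (N * (N + 1))) *
      ∏ k ∈ Finset.range N,
        (1 - exp (2 * π * I * τ) / exp (2 * π * I * x) * exp (2 * π * I * τ) ^ k) := by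
    have e : exp (2 * π * I * (x + 1 / 2) * N - π * I * τ * (N * (N + 1))) =
        ∏ k ∈ Finset.range N,
          exp ((2 * π * I * (x + 1 / 2) - 2 * π * I * τ) + (-(2 * π * I * τ)) * k) := by
      rw [prod_exp_linear]; congr 1; ring
    rw [e, ← Finset.prod_mul_distrib]
    refine Finset.prod_congr rfl fun k hk => ?_
    have hk' : k + 1 ≤ N := Finset.mem_range.mp hk
    have e1 : exp (2 * π * I * (x + 1 / 2) - 2 * π * I * τ + -(2 * π * I * τ) * k) *
        (exp (2 * π * I * τ) / exp (2 * π * I * x) * exp (2 * π * I * τ) ^ k) = -1 := by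
      rw [hpow, ← exp_sub, ← exp_add, ← exp_add, ← hm1]; congr 1; ring
    have e2 : exp (2 * π * I * (x + 1 / 2) - 2 * π * I * τ + -(2 * π * I * τ) * k) =
        -(exp (2 * π * I * x) * exp (2 * π * I * τ * ((N - 1 - k : ℕ) - N))) := by
      rw [← exp_add, neg_exp, show N - 1 - k = N - (k + 1) by omega, Nat.cast_sub hk']
      congr 1
      push_cast
      ring
    rw [hX, ← e2, mul_sub (exp (_ + _)), e1, mul_one]
    ring
  rw [h1, h2] at h
  have h3 := congrArg
    (fun y => exp (-(2 * π * I * (x + 1 / 2) * N - π * I * τ * (N * (N + 1)))) * y) h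
  simp only [← mul_assoc, ← exp_add, neg_add_cancel, exp_zero, one_mul] at h3
  rw [mul_comm, h3, Finset.mul_sum, ← two_mul N]
  refine Finset.sum_congr rfl fun k _ => ?_
  have hch : ((k.choose 2 : ℕ) : ℂ) = k * (k - 1) / 2 := Nat.cast_choose_two ℂ k
  rw [mul_right_comm _ (gaussBinom _ _ _), hpow, ← exp_nat_mul, ← mul_assoc, ← exp_add,
    ← mul_assoc, ← exp_add, jacobiTheta₂_term_eq, hch]
  congr 2
  push_cast
  ring

/-- The finite identity passes to the limit `N → ∞` by dominated convergence, since the central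
Gaussian binomials tend to `1 / (p;p)_∞`. -/
theorem triple_product {τ : ℂ} (hτ : 0 < τ.im) (x : ℂ) :
    jacobiTheta₂ (x + 1 / 2 - τ / 2) τ =
      qPoch τ * modTheta (exp (2 * π * I * τ)) (exp (2 * π * I * x)) := by
  have hp := norm_exp_two_pi_I_mul_lt_one hτ
  have hc := qProd_ne_zero hp hp
  obtain ⟨C, hC⟩ := exists_gaussBinom_bound hp
  set T : ℤ → ℂ := fun j => jacobiTheta₂_term j (x + 1 / 2 - τ / 2) τ with hT
  set p := exp (2 * π * I * τ) with hpdef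
  have hTs : Summable T := (summable_jacobiTheta₂_term_iff _ _).2 hτ
  let f : ℕ → ℤ → ℂ := fun N j =>
    if j ∈ Finset.Icc (-(N : ℤ)) N then T j * gaussBinom p (2 * N) (j + N).toNat else 0
  have hf : ∀ N, ∑' j, f N j = (∏ k ∈ Finset.range N, (1 - exp (2 * π * I * x) * p ^ k)) *
      ∏ k ∈ Finset.range N, (1 - p / exp (2 * π * I * x) * p ^ k) := by
    intro N
    rw [finite_triple_product hτ, tsum_eq_sum (s := Finset.Icc (-(N : ℤ)) N)
      (fun j hj => if_neg hj)]
    refine Finset.sum_bij' (fun j _ => (j + N).toNat) (fun k _ => (k : ℤ) - N) ?_ ?_ ?_ ?_ ?_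
    · intro j hj
      simp only [Finset.mem_Icc, Finset.mem_range] at *
      omega
    · intro k hk
      simp only [Finset.mem_Icc, Finset.mem_range] at *
      omega
    · intro j hj
      simp only [Finset.mem_Icc] at *
      omega
    · intro k _
      simp
    · intro j hj
      have hj' := Finset.mem_Icc.mp hj
      simp only [if_pos hj, hT]
      congr 2
      omega
  have hlim : Tendsto (fun N => ∑' j, f N j) atTop (𝓝 (∑' j, T j * (qProd p p)⁻¹)) := by
    refine tendsto_tsum_of_dominated_convergence (bound := fun j => ‖T j‖ * C)
      (hTs.norm.mul_right C) (fun j => ?_) (Eventually.of_forall fun N j => ?_)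
    · have h1 : Tendsto (fun N : ℕ => gaussBinom p (2 * N) (j + N).toNat) atTop
          (𝓝 (qProd p p / (qProd p p * qProd p p))) := by
        have ht := tendsto_qFact hp
        refine (ht.comp ?_).div ((ht.comp ?_).mul (ht.comp ?_)) (mul_ne_zero hc hc)
        · exact tendsto_id.const_mul_atTop' two_pos
        · refine tendsto_atTop.2 fun b => ?_
          filter_upwards [eventually_ge_atTop (b + j.natAbs)] with n hn
          omega
        · refine tendsto_atTop.2 fun b => ?_
          filter_upwards [eventually_ge_atTop (b + j.natAbs)] with n hn
          omega
      rw [div_mul_cancel_left₀ hc] at h1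
      refine (h1.const_mul (T j)).congr' ?_
      filter_upwards [eventually_ge_atTop j.natAbs] with n hn
      exact (if_pos (Finset.mem_Icc.mpr (by omega))).symm
    · simp only [f]
      split_ifs
      · rw [norm_mul]
        gcongr
        exact hC _ _
      · rw [norm_zero]
        exact mul_nonneg (norm_nonneg _) ((norm_nonneg _).trans (hC 0 0))
  have hlim2 := (tendsto_prod_one_sub_mul_pow hp (exp (2 * π * I * x))).mul
    (tendsto_prod_one_sub_mul_pow hp (p / exp (2 * π * I * x)))
  simp only [hf] at hlim
  have h := tendsto_nhds_unique hlim hlim2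
  rw [tsum_mul_right] at h
  rw [qPoch_eq, modTheta, ← h, jacobiTheta₂, mul_left_comm, mul_inv_cancel₀ hc, mul_one]

/-! ### Properties of the theta functions -/

/-- The summation index is moved by one, which produces the argument `x + 1/2 - τ/2` of
`triple_product`. -/
theorem theta1_eq (x τ : ℂ) :
    theta1 x τ = I * exp (π * I * τ / 4 - π * I * x) * jacobiTheta₂ (x + 1 / 2 - τ / 2) τ := by
  have hI : I = exp (π * I / 2) := by rw [mul_div_right_comm, exp_pi_div_two_mul_I]
  rw [theta1, jacobiTheta₂, ← (Equiv.addRight (1 : ℤ)).tsum_eq (fun j => jacobiTheta₂_term j _ τ),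
    ← tsum_neg, ← tsum_mul_left]
  congr 1
  ext n
  rw [jacobiTheta₂_term_eq, Equiv.coe_addRight, ← exp_add, neg_exp]
  nth_rewrite 4 [hI]
  rw [← exp_add, ← exp_add]
  congr 1
  push_cast
  ring

theorem constR_mul_theta1 {τ : ℂ} (hτ : 0 < τ.im) (x : ℂ) :
    constR τ * theta1 x τ =
      exp (-(π * I * x)) * modTheta (exp (2 * π * I * τ)) (exp (2 * π * I * x)) := by
  have h := qPoch_ne_zero hτ
  rw [theta1_eq, triple_product hτ, constR, sub_eq_add_neg, exp_add, exp_neg (π * I * τ / 4)]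
  have := exp_ne_zero (π * I * τ / 4)
  field_simp

theorem exp_two_pi_I_mul_eq_one {x : ℂ} (h : exp (2 * π * I * x) = 1) : ∃ n : ℤ, x = n := by
  obtain ⟨n, hn⟩ := exp_eq_one_iff.1 h
  refine ⟨n, ?_⟩
  have := two_pi_I_ne_zero
  have h2 : 2 * π * I * (x - n) = 0 := by linear_combination hn
  simpa [sub_eq_zero, this] using h2

/-- Read off from the product formula. Only this direction is needed: it turns incommensurability
and the condition on `2z` into nonvanishing of denominators. -/
theorem theta1_eq_zero {τ : ℂ} (hτ : 0 < τ.im) {x : ℂ} (h : theta1 x τ = 0) :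
    ∃ a b : ℤ, x = a + b * τ := by
  have hp := norm_exp_two_pi_I_mul_lt_one hτ
  have h1 := constR_mul_theta1 hτ x
  rw [h, mul_zero, eq_comm, mul_eq_zero, or_iff_right (exp_ne_zero _), modTheta, mul_eq_zero,
    qProd_eq_zero_iff hp, qProd_eq_zero_iff hp] at h1
  rcases h1 with ⟨k, hk⟩ | ⟨k, hk⟩
  · rw [← exp_nat_mul, ← exp_add] at hk
    obtain ⟨n, hn⟩ := exp_two_pi_I_mul_eq_one (x := x + k * τ) (by rw [← hk]; ring_nf)
    exact ⟨n, -k, by push_cast; linear_combination hn⟩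
  · rw [← exp_nat_mul, ← exp_sub, ← exp_add] at hk
    obtain ⟨n, hn⟩ := exp_two_pi_I_mul_eq_one (x := τ - x + k * τ) (by rw [← hk]; ring_nf)
    exact ⟨-n, k + 1, by push_cast; linear_combination -hn⟩

theorem theta1_neg (x τ : ℂ) : theta1 (-x) τ = -theta1 x τ := by
  have h1 : jacobiTheta₂ (-x + 1 / 2 - τ / 2) τ = exp (-(2 * π * I * x + π * I)) *
      jacobiTheta₂ (x + 1 / 2 - τ / 2) τ := by
    rw [← jacobiTheta₂_neg_left, ← jacobiTheta₂_add_left,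
      show -(-x + 1 / 2 - τ / 2) + 1 = (x + 1 / 2 - τ / 2) + τ by ring, jacobiTheta₂_add_left']
    congr 2
    ring
  have h2 : exp (π * I * τ / 4 - π * I * -x) * exp (-(2 * π * I * x + π * I)) =
      -exp (π * I * τ / 4 - π * I * x) := by
    rw [← exp_add, neg_exp, exp_eq_exp_iff_exists_int]
    exact ⟨-1, by push_cast; ring⟩
  rw [theta1_eq, theta1_eq, h1]
  linear_combination I * jacobiTheta₂ (x + 1 / 2 - τ / 2) τ * h2

theorem theta1_zero (τ : ℂ) : theta1 0 τ = 0 := by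
  have h := theta1_neg 0 τ
  rw [neg_zero] at h
  linear_combination h / 2

theorem theta1_add (x τ : ℂ) :
    theta1 (x + τ) τ = exp (π * I - π * I * τ - 2 * π * I * x) * theta1 x τ := by
  rw [theta1_eq, theta1_eq, show x + τ + 1 / 2 - τ / 2 = (x + 1 / 2 - τ / 2) + τ by ring,
    jacobiTheta₂_add_left']
  have h2 : exp (π * I * τ / 4 - π * I * (x + τ)) *
      exp (-π * I * (τ + 2 * (x + 1 / 2 - τ / 2))) =
      exp (π * I - π * I * τ - 2 * π * I * x) * exp (π * I * τ / 4 - π * I * x) := by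
    rw [← exp_add, ← exp_add, exp_eq_exp_iff_exists_int]
    exact ⟨-1, by push_cast; ring⟩
  linear_combination I * jacobiTheta₂ (x + 1 / 2 - τ / 2) τ * h2

/-- Quasi-periodicity under all multiples of the modulus, from the case of the modulus itself. -/
theorem add_int_mul_of_add {F : ℂ → ℂ} {τ e : ℂ}
    (h : ∀ x, F (x + τ) = exp (π * I * e - π * I * τ - 2 * π * I * x) * F x) (a : ℤ) (x : ℂ) :
    F (x + a * τ) = exp (π * I * (e * a - a ^ 2 * τ - 2 * a * x)) * F x := by
  induction a using Int.induction_on with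
  | zero => simp
  | succ i ih =>
    rw [show x + ((i + 1 : ℤ) : ℂ) * τ = x + (i : ℤ) * τ + τ by push_cast; ring, h, ih,
      ← mul_assoc, ← exp_add]
    congr 2
    push_cast
    ring
  | pred i ih =>
    rw [show x + ((-i : ℤ) : ℂ) * τ = x + ((-i - 1 : ℤ) : ℂ) * τ + τ by push_cast; ring, h] at ih
    have h3 := congrArg (fun y => exp (-(π * I * e - π * I * τ - 2 * π * I *
      (x + ((-i - 1 : ℤ) : ℂ) * τ))) * y) ih
    simp only [← mul_assoc, ← exp_add, neg_add_cancel, exp_zero, one_mul] at h3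
    rw [h3]
    congr 2
    push_cast
    ring

theorem theta1_add_int_mul (a : ℤ) (x τ : ℂ) :
    theta1 (x + a * τ) τ = exp (π * I * (1 * a - a ^ 2 * τ - 2 * a * x)) * theta1 x τ :=
  add_int_mul_of_add (F := fun x => theta1 x τ) (e := 1)
    (fun x => by simpa using theta1_add x τ) a x

theorem theta3_eq (z τ : ℂ) : theta3 z τ = jacobiTheta₂ z τ := by
  rw [theta3, theta2, theta1_eq, show z + τ / 2 + 1 / 2 + 1 / 2 - τ / 2 = z + 1 by ring,
    jacobiTheta₂_add_left]
  have h : exp (π * I * τ / 4 + π * I * z) *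
      exp (π * I * τ / 4 - π * I * (z + τ / 2 + 1 / 2)) = -I := by
    rw [← exp_add, ← exp_neg_pi_div_two_mul_I]
    congr 1
    ring
  linear_combination (I * jacobiTheta₂ z τ) * h - jacobiTheta₂ z τ * I_mul_I

theorem theta4_eq (z τ : ℂ) : theta4 z τ = jacobiTheta₂ (z + 1 / 2) τ := theta3_eq _ _

/-- The sign exponent in the quasi-periodicity of `θ₃` and `θ₄`. -/
def thetaSign (k : ℕ) : ℤ := if k = 3 then 0 else 1

theorem thetaK_add (k : ℕ) (z τ : ℂ) : thetaK k (z + τ) τ =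
    exp (π * I * thetaSign k - π * I * τ - 2 * π * I * z) * thetaK k z τ := by
  rw [thetaK, thetaK, thetaSign]
  split_ifs
  · rw [theta3_eq, theta3_eq, jacobiTheta₂_add_left']
    congr 2
    push_cast
    ring
  · rw [theta4_eq, theta4_eq, add_right_comm, jacobiTheta₂_add_left']
    congr 1
    rw [exp_eq_exp_iff_exists_int]
    exact ⟨-1, by push_cast; ring⟩

theorem thetaK_add_int_mul (k : ℕ) (a : ℤ) (z τ : ℂ) : thetaK k (z + a * τ) τ =
    exp (π * I * (thetaSign k * a - a ^ 2 * τ - 2 * a * z)) * thetaK k z τ :=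
  add_int_mul_of_add (F := fun x => thetaK k x τ) (fun x => thetaK_add k x τ) a z

theorem summable_norm_jacobiTheta₂_term {τ : ℂ} (hτ : 0 < τ.im) (x : ℂ) :
    Summable fun n : ℤ => ‖jacobiTheta₂_term n x τ‖ :=
  ((summable_jacobiTheta₂_term_iff x τ).2 hτ).norm

theorem jacobiTheta₂_mul {τ : ℂ} (hτ : 0 < τ.im) (x y : ℂ) :
    jacobiTheta₂ x τ * jacobiTheta₂ y τ =
      ∑' j : ℤ × ℤ, jacobiTheta₂_term j.1 x τ * jacobiTheta₂_term j.2 y τ :=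
  tsum_mul_tsum_of_summable_norm (f := fun n => jacobiTheta₂_term n x τ)
    (g := fun n => jacobiTheta₂_term n y τ)
    (summable_norm_jacobiTheta₂_term hτ x) (summable_norm_jacobiTheta₂_term hτ y)

theorem summable_jacobiTheta₂_mul {τ : ℂ} (hτ : 0 < τ.im) (x y : ℂ) :
    Summable fun j : ℤ × ℤ => jacobiTheta₂_term j.1 x τ * jacobiTheta₂_term j.2 y τ :=
  summable_mul_of_summable_norm (f := fun n => jacobiTheta₂_term n x τ)
    (g := fun n => jacobiTheta₂_term n y τ)
    (summable_norm_jacobiTheta₂_term hτ x) (summable_norm_jacobiTheta₂_term hτ y)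

/-- The substitution `(a, b) ↦ (a + b - 1, a - b)` diagonalizes the exponent of the double series on
the left and halves the modulus. Its image is the set of pairs with odd difference. On the right,
`θ₄` carries the signs `(-1)^{j₁}` and `(-1)^{j₂}`, so the two products cancel on pairs with even
difference and reinforce each other on the others, whence the factor `2`. -/
theorem two_mul_theta1_mul_theta1 {τ : ℂ} (hτ : 0 < τ.im) (x y : ℂ) :
    2 * (theta1 (x + y) τ * theta1 (x - y) τ) =
      theta4 x (τ / 2) * theta3 y (τ / 2) - theta3 x (τ / 2) * theta4 y (τ / 2) := by
  have hτ2 : 0 < (τ / 2).im := by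
    rw [show (2 : ℂ) = ((2 : ℝ) : ℂ) by norm_num, div_ofReal_im]
    positivity
  have hφ : Function.Injective fun j : ℤ × ℤ => (j.1 + j.2 - 1, j.1 - j.2) := by
    rintro ⟨a, b⟩ ⟨c, d⟩ h
    simp only [Prod.mk.injEq] at h ⊢
    omega
  have hL : 2 * (theta1 (x + y) τ * theta1 (x - y) τ) =
      ∑' j : ℤ × ℤ, 2 * -exp (π * I * τ / 2 - 2 * π * I * x) *
        (jacobiTheta₂_term j.1 (x + y + 1 / 2 - τ / 2) τ *
          jacobiTheta₂_term j.2 (x - y + 1 / 2 - τ / 2) τ) := by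
    rw [tsum_mul_left, ← jacobiTheta₂_mul hτ, theta1_eq, theta1_eq]
    have h : exp (π * I * τ / 4 - π * I * (x + y)) * exp (π * I * τ / 4 - π * I * (x - y)) =
        exp (π * I * τ / 2 - 2 * π * I * x) := by
      rw [← exp_add]; ring_nf
    rw [← h]
    linear_combination (2 * exp (π * I * τ / 4 - π * I * (x + y)) *
      exp (π * I * τ / 4 - π * I * (x - y)) * jacobiTheta₂ (x + y + 1 / 2 - τ / 2) τ *
      jacobiTheta₂ (x - y + 1 / 2 - τ / 2) τ) * I_mul_I
  let G : ℤ × ℤ → ℂ := fun j =>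
    jacobiTheta₂_term j.1 (x + 1 / 2) (τ / 2) * jacobiTheta₂_term j.2 y (τ / 2) -
      jacobiTheta₂_term j.1 x (τ / 2) * jacobiTheta₂_term j.2 (y + 1 / 2) (τ / 2)
  have hG : Function.support G ⊆ Set.range fun j : ℤ × ℤ => (j.1 + j.2 - 1, j.1 - j.2) := by
    intro j hj
    by_contra hj2
    refine hj ?_
    have hpar : Even (j.1 - j.2) := by
      by_contra hodd
      obtain ⟨c, hc⟩ := Int.not_even_iff_odd.1 hodd
      exact hj2 ⟨(c + 1 + j.2, c + 1), Prod.ext (by simp only; omega) (by simp only; omega)⟩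
    obtain ⟨c, hc⟩ := hpar
    have hj1 : j.1 = j.2 + c + c := by omega
    simp only [G, jacobiTheta₂_term_eq, ← exp_add]
    rw [sub_eq_zero, exp_eq_exp_iff_exists_int]
    refine ⟨c, ?_⟩
    rw [hj1]
    push_cast
    ring
  rw [hL, theta3_eq, theta4_eq, theta3_eq, theta4_eq, jacobiTheta₂_mul hτ2, jacobiTheta₂_mul hτ2,
    ← (summable_jacobiTheta₂_mul hτ2 _ _).tsum_sub (summable_jacobiTheta₂_mul hτ2 _ _)]
  refine Eq.trans ?_ (hφ.tsum_eq hG)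
  congr 1
  ext ⟨a, b⟩
  simp only [jacobiTheta₂_term_eq, ← exp_add]
  rw [mul_assoc, two_mul, neg_mul, ← exp_add, neg_exp, sub_eq_add_neg (exp _) (exp _),
    neg_exp]
  congr 1 <;> rw [exp_eq_exp_iff_exists_int]
  · exact ⟨1, by push_cast; ring⟩
  · exact ⟨b, by push_cast; ring⟩

/-- The three-term relation between `θ₁(·|τ)` and `θ_k(·|τ/2)`. -/
theorem theta1_thetaK_three_term {τ : ℂ} (hτ : 0 < τ.im) (k : ℕ) (a b c : ℂ) :
    theta1 (a + b) τ * theta1 (a - b) τ * thetaK k c (τ / 2) =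
      theta1 (b + c) τ * theta1 (c - b) τ * thetaK k a (τ / 2) +
      theta1 (c + a) τ * theta1 (a - c) τ * thetaK k b (τ / 2) := by
  -- Each product of two `θ₁` is half a `2 × 2` determinant in the vectors `(θ₃, θ₄)(·|τ/2)`; the
  -- claim is the linear relation between three vectors in a plane.
  have h1 := two_mul_theta1_mul_theta1 hτ a b
  have h2 := two_mul_theta1_mul_theta1 hτ c b
  have h3 := two_mul_theta1_mul_theta1 hτ a c
  rw [add_comm b c, add_comm c a, thetaK, thetaK, thetaK]
  split_ifs
  · linear_combination theta3 c (τ / 2) / 2 * h1 - theta3 a (τ / 2) / 2 * h2 -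
      theta3 b (τ / 2) / 2 * h3
  · linear_combination theta4 c (τ / 2) / 2 * h1 - theta4 a (τ / 2) / 2 * h2 -
      theta4 b (τ / 2) / 2 * h3

/-! ### Normal ordering of the factorized operator -/

/-- Incommensurability of `1, τ, 2η`. -/
def Incommensurable (τ η : ℂ) : Prop :=
  ∀ a b c : ℤ, (a : ℂ) + b * τ + c * (2 * η) = 0 → a = 0 ∧ b = 0 ∧ c = 0

theorem incommensurable_of_linearIndependent {τ η : ℂ}
    (h : LinearIndependent ℚ ![(1 : ℂ), 2 * η, τ]) : Incommensurable τ η := by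
  intro a b c habc
  have h2 := Fintype.linearIndependent_iff.1 h ![(a : ℚ), (c : ℚ), (b : ℚ)] (by
    simp only [Fin.sum_univ_three, Matrix.cons_val, Rat.smul_def]
    push_cast
    linear_combination habc)
  have h0 := h2 0
  have h1 := h2 1
  have h3 := h2 2
  simp only [Matrix.cons_val] at h0 h1 h3
  exact ⟨by exact_mod_cast h0, by exact_mod_cast h3, by exact_mod_cast h1⟩

theorem Incommensurable.swap {τ η : ℂ} (h : Incommensurable τ η) :
    Incommensurable (2 * η) (τ / 2) := by
  intro a b c habc
  obtain ⟨h1, h2, h3⟩ := h a c b (by linear_combination habc)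
  exact ⟨h1, h3, h2⟩

theorem theta1_step_ne_zero {τ η : ℂ} (hτ : 0 < τ.im) (hinc : Incommensurable τ η) {j : ℕ}
    (hj : j ≠ 0) : theta1 (2 * η * j) τ ≠ 0 := by
  intro h
  obtain ⟨a, b, hab⟩ := theta1_eq_zero hτ h
  obtain ⟨-, -, h3⟩ := hinc (-a) (-b) j (by push_cast; linear_combination hab)
  exact hj (by exact_mod_cast h3)

/-- The coefficient of the shift by `(n-2k)η + (m-2l)τ/2` in the normal ordered operator. -/
def nomCoeff (τ η : ℂ) (n m k l : ℕ) (z : ℂ) : ℂ :=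
  (-1) ^ (n * m) * exp (-(π * I * τ / 2 * m ^ 2 * n) - π * I * η * n ^ 2 * m) *
    ((-1) ^ k * alphaCoeff τ η n k z * ((-1) ^ l * betaCoeff τ η m l z *
        exp (((n : ℂ) - 1) * ((m : ℂ) - 2 * l) *
          (π * I * τ / 2 * ((m : ℂ) - 2 * l) + 2 * π * I * (z + ((n : ℂ) - 2 * k) * η))) *
        exp (((m : ℂ) - 1) * ((n : ℂ) - 2 * k) *
          (π * I * η * ((n : ℂ) - 2 * k) + 2 * π * I * (z + ((m : ℂ) - 2 * l) * (τ / 2))))))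

theorem normalOrderedM_eq (τ η : ℂ) (n m : ℕ) (f : ℂ → ℂ) (z : ℂ) :
    normalOrderedM τ η n m f z =
      ∑ k ∈ Finset.range (n + 1), ∑ l ∈ Finset.range (m + 1), nomCoeff τ η n m k l z *
        f (z + (((n : ℂ) - 2 * k) * η + ((m : ℂ) - 2 * l) * (τ / 2))) := by
  rw [normalOrderedM, Finset.mul_sum]
  refine Finset.sum_congr rfl fun k _ => ?_
  rw [Finset.mul_sum, Finset.mul_sum]
  refine Finset.sum_congr rfl fun l _ => ?_
  rw [nomCoeff]
  ring

/-! ### Left multiplication of the normal ordered operator by `A_k` -/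

section step

variable {τ η : ℂ}

theorem ellBinom_mul_left (hτ : 0 < τ.im) (hinc : Incommensurable τ η) {n k : ℕ} (h : k ≤ n) :
    ellBinom τ (2 * η) n k * theta1 (2 * η * ((n : ℂ) + 1)) τ =
      ellBinom τ (2 * η) (n + 1) k * theta1 (2 * η * ((n : ℂ) + 1 - k)) τ := by
  obtain ⟨d, rfl⟩ := Nat.exists_eq_add_of_le h
  have h1 : theta1 (2 * η * ((d + 1 : ℕ) : ℂ)) τ ≠ 0 :=
    theta1_step_ne_zero hτ hinc d.succ_ne_zero
  rw [ellBinom, ellBinom, Nat.add_sub_cancel_left, show k + d + 1 - k = d + 1 by omega,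
    Finset.prod_Icc_succ_top (by omega), Finset.prod_Icc_succ_top (by omega)]
  rw [show 2 * η * (((k + d : ℕ) : ℂ) + 1 - k) = 2 * η * ((d + 1 : ℕ) : ℂ) by push_cast; ring]
  push_cast at h1 ⊢
  field_simp

theorem ellBinom_mul_right (hτ : 0 < τ.im) (hinc : Incommensurable τ η) {n k : ℕ} :
    ellBinom τ (2 * η) n k * theta1 (2 * η * ((n : ℂ) + 1)) τ =
      ellBinom τ (2 * η) (n + 1) (k + 1) * theta1 (2 * η * ((k : ℂ) + 1)) τ := by
  have h1 : theta1 (2 * η * ((k + 1 : ℕ) : ℂ)) τ ≠ 0 :=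
    theta1_step_ne_zero hτ hinc k.succ_ne_zero
  rw [ellBinom, ellBinom, Nat.add_sub_add_right,
    Finset.prod_Icc_succ_top (by omega), Finset.prod_Icc_succ_top (by omega)]
  push_cast at h1 ⊢
  field_simp

/-- The shift `z → z + η` together with `n → n + 1` preserves the numerator `θ₁` and moves the range
of the denominator by one, so one theta factor is left over. The two leftover factors here and in
`alphaCoeff_sub` are those of the three-term relation. -/
theorem alphaCoeff_add (hτ : 0 < τ.im) (hinc : Incommensurable τ η) {n k : ℕ} (h : k ≤ n)
    {z : ℂ} (hz : theta1 (2 * z - 2 * η * k) τ ≠ 0) :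
    alphaCoeff τ η n k (z + η) * theta1 (2 * η * ((n : ℂ) + 1)) τ * constA τ η =
      alphaCoeff τ η (n + 1) k z * theta1 (2 * η * ((n : ℂ) + 1 - k)) τ *
        theta1 (2 * z - 2 * η * k) τ := by
  have hb := ellBinom_mul_left hτ hinc h
  have hp : ∏ j ∈ Finset.range (n + 1), theta1 (2 * (z + η) - 2 * η * ((k : ℂ) - j)) τ =
      ∏ j ∈ Finset.range (n + 1), theta1 (2 * z - 2 * η * ((k : ℂ) - (j + 1 : ℕ))) τ :=
    Finset.prod_congr rfl fun j _ => by congr 1; push_cast; ring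
  rw [alphaCoeff, alphaCoeff, Finset.prod_range_succ' _ (n + 1), hp, Nat.cast_zero, sub_zero,
    show 2 * (z + η) + 2 * η * ((n : ℂ) - 2 * k) = 2 * z + 2 * η * (((n + 1 : ℕ) : ℂ) - 2 * k) by
      push_cast; ring, ← div_div]
  generalize ∏ j ∈ Finset.range (n + 1), theta1 (2 * z - 2 * η * ((k : ℂ) - (j + 1 : ℕ))) τ = P
  rw [mul_right_comm _ (theta1 (2 * η * ((n : ℂ) + 1 - k)) τ), mul_assoc _ (_ / _ / _),
    div_mul_cancel₀ _ hz, pow_succ]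
  linear_combination (constA τ η ^ n * (theta1 (2 * z + 2 * η * (((n + 1 : ℕ) : ℂ) - 2 * k)) τ / P)
    * constA τ η) * hb

theorem alphaCoeff_sub (hτ : 0 < τ.im) (hinc : Incommensurable τ η) {n k : ℕ}
    {z : ℂ} (hz : theta1 (2 * z - 2 * η * ((k : ℂ) - n)) τ ≠ 0) :
    alphaCoeff τ η n k (z - η) * theta1 (2 * η * ((n : ℂ) + 1)) τ * constA τ η =
      alphaCoeff τ η (n + 1) (k + 1) z * theta1 (2 * η * ((k : ℂ) + 1)) τ *
        theta1 (2 * z - 2 * η * ((k : ℂ) - n)) τ := by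
  have hb := ellBinom_mul_right (n := n) (k := k) hτ hinc
  have hp : ∏ j ∈ Finset.range (n + 1), theta1 (2 * (z - η) - 2 * η * ((k : ℂ) - j)) τ =
      ∏ j ∈ Finset.range (n + 1), theta1 (2 * z - 2 * η * (((k + 1 : ℕ) : ℂ) - j)) τ :=
    Finset.prod_congr rfl fun j _ => by congr 1; push_cast; ring
  rw [alphaCoeff, alphaCoeff, Finset.prod_range_succ _ (n + 1), hp,
    show 2 * (z - η) + 2 * η * ((n : ℂ) - 2 * k) =
      2 * z + 2 * η * (((n + 1 : ℕ) : ℂ) - 2 * (k + 1 : ℕ)) by push_cast; ring,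
    show 2 * z - 2 * η * (((k + 1 : ℕ) : ℂ) - (n + 1 : ℕ)) = 2 * z - 2 * η * ((k : ℂ) - n) by
      push_cast; ring, ← div_div]
  generalize ∏ j ∈ Finset.range (n + 1), theta1 (2 * z - 2 * η * (((k + 1 : ℕ) : ℂ) - j)) τ = P
  rw [mul_right_comm _ (theta1 (2 * η * ((k : ℂ) + 1)) τ), mul_assoc _ (_ / _ / _),
    div_mul_cancel₀ _ hz, pow_succ]
  linear_combination (constA τ η ^ n *
    (theta1 (2 * z + 2 * η * (((n + 1 : ℕ) : ℂ) - 2 * (k + 1 : ℕ))) τ / P) * constA τ η) * hb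

/-- The theta functions in `β` have modulus `2η`, and `z → z + η` moves `2z` by exactly one period.
Hence `β` only acquires an exponential: one factor from the numerator against `m + 1` from the
denominator. -/
theorem betaCoeff_add (m l : ℕ) (z : ℂ) :
    betaCoeff τ η m l (z + η) =
      exp (-(π * I * m) + 2 * π * I * m * (2 * z + η) - 2 * π * I * τ * (m - 2 * l) -
        2 * π * I * τ * (l * (m + 1) - m * (m + 1) / 2)) * betaCoeff τ η m l z := by
  have hp : ∏ j ∈ Finset.range (m + 1), theta1 (2 * (z + η) - τ * ((l : ℂ) - j)) (2 * η) =
      exp ((π * I - π * I * (2 * η) - 2 * π * I * (2 * z - τ * l)) * (m + 1 : ℕ) +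
        -(2 * π * I * τ) * ((m + 1 : ℕ) * ((m + 1 : ℕ) - 1) / 2)) *
      ∏ j ∈ Finset.range (m + 1), theta1 (2 * z - τ * ((l : ℂ) - j)) (2 * η) := by
    rw [← prod_exp_linear, ← Finset.prod_mul_distrib]
    refine Finset.prod_congr rfl fun j _ => ?_
    rw [show 2 * (z + η) - τ * ((l : ℂ) - j) = 2 * z - τ * ((l : ℂ) - j) + 2 * η by ring,
      theta1_add]
    congr 2
    ring
  rw [betaCoeff, betaCoeff, hp,
    show 2 * (z + η) + τ * ((m : ℂ) - 2 * l) = 2 * z + τ * ((m : ℂ) - 2 * l) + 2 * η by ring,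
    theta1_add, mul_div_mul_comm, ← exp_sub]
  rw [mul_left_comm (constB τ η ^ m * _)]
  congr 2
  push_cast
  ring

theorem neg_one_pow_eq_exp (n : ℕ) : (-1 : ℂ) ^ n = exp (π * I * n) := by
  rw [← exp_pi_mul_I, ← exp_nat_mul]; ring_nf

/-- The common factor of the two terms in the composition of `A_k` with a normal ordered
operator. -/
def shiftExp (τ η : ℂ) (κ n m k l : ℕ) (z : ℂ) : ℂ :=
  exp (π * I * (thetaSign κ * ((m : ℂ) - 2 * l) - ((m : ℂ) - 2 * l) ^ 2 * (τ / 2) -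
    2 * ((m : ℂ) - 2 * l) * (z + ((n : ℂ) - 2 * k) * η)))

/-- Contribution of `e^{η∂}`. Apart from `α`, everything changes by exponentials: `β` and `θ_κ` by
quasi-periodicity (`mτ/2` is `m` periods of the latter), and the conjugating Gaussian directly. They
assemble into the coefficient for `n + 1` times `shiftExp`. The factor `shiftExp` depends only on
the resulting shift, so the contribution of `e^{-η∂}` in `nomCoeff_sub` can be added to this one. -/
theorem nomCoeff_add (hτ : 0 < τ.im) (hη : η ≠ 0) (hinc : Incommensurable τ η) (κ : ℕ)
    {n k : ℕ} (h : k ≤ n) (m l : ℕ) {z : ℂ} (hz : theta1 (2 * z - 2 * η * k) τ ≠ 0) :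
    exp (π * I * z ^ 2 / η) * constA τ η *
      (thetaK κ (z + (m * (τ / 2) + n * η) + η) (τ / 2) * (exp (-(π * I * (z + η) ^ 2 / η)) *
        nomCoeff τ η n m k l (z + η))) * theta1 (2 * η * ((n : ℂ) + 1)) τ =
    nomCoeff τ η (n + 1) m k l z * shiftExp τ η κ (n + 1) m k l z *
      (theta1 (2 * η * ((n : ℂ) + 1 - k)) τ * theta1 (2 * z - 2 * η * k) τ *
        thetaK κ (z + ((n : ℂ) + 1) * η) (τ / 2)) := by
  have ha := alphaCoeff_add hτ hinc h hz
  have hθ := thetaK_add_int_mul κ m (z + ((n : ℂ) + 1) * η) (τ / 2)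
  have hg : exp (π * I * z ^ 2 / η) * exp (-(π * I * (z + η) ^ 2 / η)) =
      exp (-(2 * π * I * z) - π * I * η) := by
    rw [← exp_add]; congr 1; field_simp; ring
  rw [show z + (m * (τ / 2) + n * η) + η = z + ((n : ℂ) + 1) * η + (m : ℤ) * (τ / 2) by
    push_cast; ring, hθ, nomCoeff, nomCoeff, betaCoeff_add, shiftExp]
  simp only [neg_one_pow_eq_exp]
  generalize alphaCoeff τ η n k (z + η) = a1 at *
  generalize alphaCoeff τ η (n + 1) k z = a2 at *
  generalize betaCoeff τ η m l z = b
  generalize thetaK κ (z + ((n : ℂ) + 1) * η) (τ / 2) = t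
  generalize exp (π * I * k) = s1
  generalize exp (π * I * l) = s2
  generalize (thetaSign κ) = e
  have hE : exp (-(2 * π * I * z) - π * I * η) *
      exp (π * I * (e * (m : ℤ) - (m : ℤ) ^ 2 * (τ / 2) - 2 * (m : ℤ) * (z + ((n : ℂ) + 1) * η))) *
      (exp (π * I * (n * m : ℕ)) * exp (-(π * I * τ / 2 * m ^ 2 * n) - π * I * η * n ^ 2 * m)) *
      exp (-(π * I * m) + 2 * π * I * m * (2 * z + η) - 2 * π * I * τ * (m - 2 * l) -
        2 * π * I * τ * (l * (m + 1) - m * (m + 1) / 2)) *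
      exp (((n : ℂ) - 1) * ((m : ℂ) - 2 * l) *
          (π * I * τ / 2 * ((m : ℂ) - 2 * l) + 2 * π * I * (z + η + ((n : ℂ) - 2 * k) * η))) *
        exp (((m : ℂ) - 1) * ((n : ℂ) - 2 * k) *
          (π * I * η * ((n : ℂ) - 2 * k) + 2 * π * I * (z + η + ((m : ℂ) - 2 * l) * (τ / 2)))) =
      exp (π * I * ((n + 1) * m : ℕ)) *
        exp (-(π * I * τ / 2 * m ^ 2 * (n + 1 : ℕ)) - π * I * η * (n + 1 : ℕ) ^ 2 * m) *
      exp ((((n + 1 : ℕ) : ℂ) - 1) * ((m : ℂ) - 2 * l) *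
          (π * I * τ / 2 * ((m : ℂ) - 2 * l) +
            2 * π * I * (z + (((n + 1 : ℕ) : ℂ) - 2 * k) * η))) *
        exp (((m : ℂ) - 1) * (((n + 1 : ℕ) : ℂ) - 2 * k) *
          (π * I * η * (((n + 1 : ℕ) : ℂ) - 2 * k) +
            2 * π * I * (z + ((m : ℂ) - 2 * l) * (τ / 2)))) *
      exp (π * I * (e * ((m : ℂ) - 2 * l) - ((m : ℂ) - 2 * l) ^ 2 * (τ / 2) -
        2 * ((m : ℂ) - 2 * l) * (z + (((n + 1 : ℕ) : ℂ) - 2 * k) * η))) := by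
    simp only [← exp_add]
    rw [exp_eq_exp_iff_exists_int]
    -- The exponents agree only modulo `2πi`: signs from quasi-periods and from `(-1)^{nm}` differ
    -- by an even multiple of `πi`.
    exact ⟨e * l - m, by push_cast; ring⟩
  rw [← hg] at hE
  have hprod := congrArg₂ (· * ·) ha hE
  linear_combination (t * s1 * s2 * b) * hprod

theorem betaCoeff_sub (m l : ℕ) (z : ℂ) :
    betaCoeff τ η m l (z - η) =
      exp (π * I * m - 2 * π * I * m * (2 * z - η) + 2 * π * I * τ * (m - 2 * l) +
        2 * π * I * τ * (l * (m + 1) - m * (m + 1) / 2)) * betaCoeff τ η m l z := by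
  have h := betaCoeff_add (τ := τ) (η := η) m l (z - η)
  rw [sub_add_cancel] at h
  rw [h, ← mul_assoc, ← exp_add]
  convert (one_mul _).symm
  rw [← exp_zero]
  congr 1
  ring

theorem nomCoeff_sub (hτ : 0 < τ.im) (hη : η ≠ 0) (hinc : Incommensurable τ η) (κ : ℕ)
    (n k m l : ℕ) {z : ℂ} (hz : theta1 (2 * z - 2 * η * ((k : ℂ) - n)) τ ≠ 0) :
    exp (π * I * z ^ 2 / η) * constA τ η *
      (thetaK κ (z - (m * (τ / 2) + n * η) - η) (τ / 2) * (exp (-(π * I * (z - η) ^ 2 / η)) *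
        nomCoeff τ η n m k l (z - η))) * theta1 (2 * η * ((n : ℂ) + 1)) τ =
    -(nomCoeff τ η (n + 1) m (k + 1) l z * shiftExp τ η κ (n + 1) m (k + 1) l z *
      (theta1 (2 * η * ((k : ℂ) + 1)) τ * theta1 (2 * z - 2 * η * ((k : ℂ) - n)) τ *
        thetaK κ (z - ((n : ℂ) + 1) * η) (τ / 2))) := by
  have ha := alphaCoeff_sub hτ hinc hz
  have hθ := thetaK_add_int_mul κ (-m) (z - ((n : ℂ) + 1) * η) (τ / 2)
  have hg : exp (π * I * z ^ 2 / η) * exp (-(π * I * (z - η) ^ 2 / η)) =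
      exp (2 * π * I * z - π * I * η) := by
    rw [← exp_add]; congr 1; field_simp; ring
  rw [show z - (m * (τ / 2) + n * η) - η = z - ((n : ℂ) + 1) * η + (-m : ℤ) * (τ / 2) by
    push_cast; ring, hθ, nomCoeff, nomCoeff, betaCoeff_sub, shiftExp, pow_succ (-1 : ℂ) k]
  simp only [neg_one_pow_eq_exp]
  generalize alphaCoeff τ η n k (z - η) = a1 at *
  generalize alphaCoeff τ η (n + 1) (k + 1) z = a2 at *
  generalize betaCoeff τ η m l z = b
  generalize thetaK κ (z - ((n : ℂ) + 1) * η) (τ / 2) = t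
  generalize exp (π * I * k) = s1
  generalize exp (π * I * l) = s2
  generalize (thetaSign κ) = e
  have hE : exp (2 * π * I * z - π * I * η) *
      exp (π * I * (e * (-m : ℤ) - (-m : ℤ) ^ 2 * (τ / 2) -
        2 * (-m : ℤ) * (z - ((n : ℂ) + 1) * η))) *
      (exp (π * I * (n * m : ℕ)) * exp (-(π * I * τ / 2 * m ^ 2 * n) - π * I * η * n ^ 2 * m)) *
      exp (π * I * m - 2 * π * I * m * (2 * z - η) + 2 * π * I * τ * (m - 2 * l) +
        2 * π * I * τ * (l * (m + 1) - m * (m + 1) / 2)) *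
      exp (((n : ℂ) - 1) * ((m : ℂ) - 2 * l) *
          (π * I * τ / 2 * ((m : ℂ) - 2 * l) + 2 * π * I * (z - η + ((n : ℂ) - 2 * k) * η))) *
        exp (((m : ℂ) - 1) * ((n : ℂ) - 2 * k) *
          (π * I * η * ((n : ℂ) - 2 * k) + 2 * π * I * (z - η + ((m : ℂ) - 2 * l) * (τ / 2)))) =
      exp (π * I * ((n + 1) * m : ℕ)) *
        exp (-(π * I * τ / 2 * m ^ 2 * (n + 1 : ℕ)) - π * I * η * (n + 1 : ℕ) ^ 2 * m) *
      exp ((((n + 1 : ℕ) : ℂ) - 1) * ((m : ℂ) - 2 * l) *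
          (π * I * τ / 2 * ((m : ℂ) - 2 * l) +
            2 * π * I * (z + (((n + 1 : ℕ) : ℂ) - 2 * (k + 1 : ℕ)) * η))) *
        exp (((m : ℂ) - 1) * (((n + 1 : ℕ) : ℂ) - 2 * (k + 1 : ℕ)) *
          (π * I * η * (((n + 1 : ℕ) : ℂ) - 2 * (k + 1 : ℕ)) +
            2 * π * I * (z + ((m : ℂ) - 2 * l) * (τ / 2)))) *
      exp (π * I * (e * ((m : ℂ) - 2 * l) - ((m : ℂ) - 2 * l) ^ 2 * (τ / 2) -
        2 * ((m : ℂ) - 2 * l) * (z + (((n + 1 : ℕ) : ℂ) - 2 * (k + 1 : ℕ)) * η))) := by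
    simp only [← exp_add]
    rw [exp_eq_exp_iff_exists_int]
    exact ⟨e * (l - m), by push_cast; ring⟩
  rw [← hg] at hE
  have hprod := congrArg₂ (· * ·) ha hE
  linear_combination (t * s1 * s2 * b) * hprod

/-- Completes the translation of `θ_κ` by `(m - 2l)τ/2`, so that it is evaluated at the point where
`f` is evaluated and can be absorbed into `f`. -/
theorem shiftExp_mul_thetaK (κ n m k l : ℕ) (z : ℂ) :
    shiftExp τ η κ n m k l z * thetaK κ (z + ((n : ℂ) - 2 * k) * η) (τ / 2) =
      thetaK κ (z + (((n : ℂ) - 2 * k) * η + ((m : ℂ) - 2 * l) * (τ / 2))) (τ / 2) := by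
  have h := thetaK_add_int_mul κ ((m : ℤ) - 2 * l) (z + ((n : ℂ) - 2 * k) * η) (τ / 2)
  push_cast at h
  rw [← add_assoc, h, shiftExp]

/-- Composition of `A_k` with a normal ordered operator. -/
theorem opA_normalOrderedM (hτ : 0 < τ.im) (hη : η ≠ 0) (hinc : Incommensurable τ η)
    (κ n m : ℕ) {z : ℂ} (hz : ∀ i : ℤ, |i| ≤ n + 1 → theta1 (2 * (z + i * η)) τ ≠ 0)
    (f : ℂ → ℂ) :
    opA τ η κ (m * (τ / 2) + n * η) (normalOrderedM τ η n m f) z =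
      normalOrderedM τ η (n + 1) m (fun w => f w * thetaK κ w (τ / 2)) z := by
  have hN : theta1 (2 * η * ((n : ℂ) + 1)) τ ≠ 0 := by
    have := theta1_step_ne_zero hτ hinc n.succ_ne_zero
    push_cast at this
    exact this
  have h0 : theta1 (2 * z) τ ≠ 0 := by simpa using hz 0 (by simp; positivity)
  let X : ℕ → ℕ → ℂ := fun k l =>
    nomCoeff τ η (n + 1) m k l z * shiftExp τ η κ (n + 1) m k l z
  let f' : ℕ → ℕ → ℂ := fun k l =>
    f (z + (((n + 1 : ℕ) : ℂ) - 2 * k) * η + ((m : ℂ) - 2 * l) * (τ / 2))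
  -- `P` and `Q` are the weights of the two contributions to the shift with label `k`: the term `k`
  -- of the operator for `n` goes to label `k` under `e^{η∂}` and to label `k + 1` under `e^{-η∂}`.
  let P : ℕ → ℂ := fun k => theta1 (2 * η * ((n : ℂ) + 1 - k)) τ * theta1 (2 * z - 2 * η * k) τ *
    thetaK κ (z + ((n : ℂ) + 1) * η) (τ / 2)
  let Q : ℕ → ℂ := fun k => theta1 (2 * η * k) τ * theta1 (2 * z - 2 * η * ((k : ℂ) - 1 - n)) τ *
    thetaK κ (z - ((n : ℂ) + 1) * η) (τ / 2)
  have hP : ∀ k ∈ Finset.range (n + 1), ∑ l ∈ Finset.range (m + 1), X k l * P k * f' k l =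
      exp (π * I * z ^ 2 / η) * constA τ η * (thetaK κ (z + (m * (τ / 2) + n * η) + η) (τ / 2) *
        (exp (-(π * I * (z + η) ^ 2 / η)) * ∑ l ∈ Finset.range (m + 1),
          nomCoeff τ η n m k l (z + η) *
          f (z + η + (((n : ℂ) - 2 * k) * η + ((m : ℂ) - 2 * l) * (τ / 2))))) *
      theta1 (2 * η * ((n : ℂ) + 1)) τ := by
    intro k hk
    have hk' : k ≤ n := Nat.lt_succ_iff.1 (Finset.mem_range.1 hk)
    simp only [Finset.mul_sum, Finset.sum_mul]
    refine Finset.sum_congr rfl fun l _ => ?_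
    have hz1 : theta1 (2 * z - 2 * η * k) τ ≠ 0 := by
      have := hz (-k) (by rw [abs_neg, Nat.abs_cast]; exact_mod_cast hk'.trans n.le_succ)
      convert this using 2
      push_cast
      ring
    have h := nomCoeff_add hτ hη hinc κ hk' m l hz1
    have hf : f' k l = f (z + η + (((n : ℂ) - 2 * k) * η + ((m : ℂ) - 2 * l) * (τ / 2))) := by
      simp only [f']
      congr 1
      push_cast
      ring
    rw [hf]
    simp only [X, P]
    rw [← h]
    ring
  have hQ : ∀ k ∈ Finset.range (n + 1),
      ∑ l ∈ Finset.range (m + 1), X (k + 1) l * Q (k + 1) * f' (k + 1) l =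
      -(exp (π * I * z ^ 2 / η) * constA τ η *
        (thetaK κ (z - (m * (τ / 2) + n * η) - η) (τ / 2) *
        (exp (-(π * I * (z - η) ^ 2 / η)) * ∑ l ∈ Finset.range (m + 1),
          nomCoeff τ η n m k l (z - η) *
          f (z - η + (((n : ℂ) - 2 * k) * η + ((m : ℂ) - 2 * l) * (τ / 2))))) *
      theta1 (2 * η * ((n : ℂ) + 1)) τ) := by
    intro k hk
    have hk' : k ≤ n := Nat.lt_succ_iff.1 (Finset.mem_range.1 hk)
    simp only [Finset.mul_sum, Finset.sum_mul]
    rw [← Finset.sum_neg_distrib]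
    refine Finset.sum_congr rfl fun l _ => ?_
    have hz1 : theta1 (2 * z - 2 * η * ((k : ℂ) - n)) τ ≠ 0 := by
      have := hz (n - k) (by rw [abs_le]; omega)
      convert this using 2
      push_cast
      ring
    have h := nomCoeff_sub hτ hη hinc κ n k m l hz1
    have hf : f' (k + 1) l =
        f (z - η + (((n : ℂ) - 2 * k) * η + ((m : ℂ) - 2 * l) * (τ / 2))) := by
      simp only [f']
      congr 1
      push_cast
      ring
    rw [hf]
    simp only [X, Q]
    rw [show 2 * z - 2 * η * (((k + 1 : ℕ) : ℂ) - 1 - n) = 2 * z - 2 * η * ((k : ℂ) - n) by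
      push_cast; ring, show ((k + 1 : ℕ) : ℂ) = k + 1 by push_cast; rfl]
    rw [eq_neg_iff_add_eq_zero] at h ⊢
    linear_combination
      f (z - η + (((n : ℂ) - 2 * k) * η + ((m : ℂ) - 2 * l) * (τ / 2))) * h
  have hPQ : ∀ k l : ℕ, X k l * P k * f' k l + X k l * Q k * f' k l =
      theta1 (2 * z) τ * theta1 (2 * η * ((n : ℂ) + 1)) τ * (nomCoeff τ η (n + 1) m k l z *
        (f (z + ((((n + 1 : ℕ) : ℂ) - 2 * k) * η + ((m : ℂ) - 2 * l) * (τ / 2))) *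
        thetaK κ (z + ((((n + 1 : ℕ) : ℂ) - 2 * k) * η + ((m : ℂ) - 2 * l) * (τ / 2)))
          (τ / 2))) := by
    intro k l
    -- The points are `z ± (n+1)η`, where the two terms of `A_κ` evaluate `θ_κ` up to periods, and
    -- the shifted point, where the result needs it.
    have h := theta1_thetaK_three_term hτ κ (z + ((n : ℂ) + 1) * η) (z - ((n : ℂ) + 1) * η)
      (z + (((n + 1 : ℕ) : ℂ) - 2 * k) * η)
    rw [show z + ((n : ℂ) + 1) * η + (z - ((n : ℂ) + 1) * η) = 2 * z by ring,
      show z + ((n : ℂ) + 1) * η - (z - ((n : ℂ) + 1) * η) = 2 * η * ((n : ℂ) + 1) by ring,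
      show z - ((n : ℂ) + 1) * η + (z + (((n + 1 : ℕ) : ℂ) - 2 * k) * η) = 2 * z - 2 * η * k by
        push_cast; ring,
      show z + (((n + 1 : ℕ) : ℂ) - 2 * k) * η - (z - ((n : ℂ) + 1) * η) =
        2 * η * ((n : ℂ) + 1 - k) by push_cast; ring,
      show z + (((n + 1 : ℕ) : ℂ) - 2 * k) * η + (z + ((n : ℂ) + 1) * η) =
        2 * z - 2 * η * ((k : ℂ) - 1 - n) by push_cast; ring,
      show z + ((n : ℂ) + 1) * η - (z + (((n + 1 : ℕ) : ℂ) - 2 * k) * η) = 2 * η * k by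
        push_cast; ring] at h
    rw [← shiftExp_mul_thetaK, ← add_assoc]
    simp only [X, P, Q, f']
    linear_combination -(nomCoeff τ η (n + 1) m k l z * shiftExp τ η κ (n + 1) m k l z *
      f (z + (((n + 1 : ℕ) : ℂ) - 2 * k) * η + ((m : ℂ) - 2 * l) * (τ / 2))) * h
  -- The missing boundary weights vanish by `θ₁(0) = 0`, so both sums extend to the range `0, …, n +
  -- 1`.
  have hPN : P (n + 1) = 0 := by
    simp [P, theta1_zero]
  have hQ0 : Q 0 = 0 := by
    simp [Q, theta1_zero]
  have hS1 : ∑ k ∈ Finset.range (n + 1), ∑ l ∈ Finset.range (m + 1), X k l * P k * f' k l =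
      ∑ k ∈ Finset.range (n + 1 + 1), ∑ l ∈ Finset.range (m + 1), X k l * P k * f' k l := by
    rw [Finset.sum_range_succ _ (n + 1), hPN]
    simp
  have hS2 : ∑ k ∈ Finset.range (n + 1), ∑ l ∈ Finset.range (m + 1),
        X (k + 1) l * Q (k + 1) * f' (k + 1) l =
      ∑ k ∈ Finset.range (n + 1 + 1), ∑ l ∈ Finset.range (m + 1), X k l * Q k * f' k l := by
    rw [Finset.sum_range_succ' _ (n + 1), hQ0]
    simp
  have hsum : ∑ k ∈ Finset.range (n + 1 + 1), ∑ l ∈ Finset.range (m + 1),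
        (X k l * P k * f' k l + X k l * Q k * f' k l) =
      theta1 (2 * z) τ * theta1 (2 * η * ((n : ℂ) + 1)) τ *
        normalOrderedM τ η (n + 1) m (fun w => f w * thetaK κ w (τ / 2)) z := by
    rw [normalOrderedM_eq]
    simp only [Finset.mul_sum, hPQ]
  simp only [Finset.sum_add_distrib] at hsum
  rw [← hS1, ← hS2, Finset.sum_congr rfl hP, Finset.sum_congr rfl hQ] at hsum
  simp only [Finset.sum_neg_distrib, ← Finset.sum_mul, ← Finset.mul_sum] at hsum
  rw [opA, normalOrderedM_eq τ η n m f (z + η), normalOrderedM_eq τ η n m f (z - η)]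
  refine mul_left_cancel₀ (mul_ne_zero h0 hN) ?_
  rw [← hsum]
  field_simp
  ring

end step

/-! ### The symmetry exchanging `τ` with `2η` and `n` with `m`, and the induction -/

theorem prodB_eq (τ η : ℂ) (κ : ℕ) (g : ℂ) (m : ℕ) (f : ℂ → ℂ) :
    prodB τ η κ g m f = prodA (2 * η) (τ / 2) κ g m f := by
  induction m with
  | zero => rfl
  | succ m ih =>
    funext z
    rw [prodB, prodA, ih, opA, opB, constA, constB, mul_div_cancel_left₀ η two_ne_zero]
    have h : ∀ x : ℂ, 2 * π * I * x ^ 2 / τ = π * I * x ^ 2 / (τ / 2) := fun x => by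
      rw [div_div_eq_mul_div]; ring
    rw [h, h, h]

theorem nomCoeff_swap (τ η : ℂ) (n m k l : ℕ) (z : ℂ) :
    nomCoeff (2 * η) (τ / 2) m n l k z = nomCoeff τ η n m k l z := by
  have h : 2 * (τ / 2) = τ := by ring
  have h1 : alphaCoeff (2 * η) (τ / 2) m l z = betaCoeff τ η m l z := by
    rw [alphaCoeff, betaCoeff, constA, constB, h]
  have h2 : betaCoeff (2 * η) (τ / 2) n k z = alphaCoeff τ η n k z := by
    rw [alphaCoeff, betaCoeff, constA, constB, h, mul_div_cancel_left₀ η two_ne_zero]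
  rw [nomCoeff, nomCoeff, h1, h2, mul_comm m n]
  ring_nf

theorem normalOrderedM_swap (τ η : ℂ) (n m : ℕ) (f : ℂ → ℂ) (z : ℂ) :
    normalOrderedM (2 * η) (τ / 2) m n f z = normalOrderedM τ η n m f z := by
  rw [normalOrderedM_eq, normalOrderedM_eq, Finset.sum_comm]
  simp only [nomCoeff_swap, mul_div_cancel_left₀ η two_ne_zero, add_comm (_ * (τ / 2))]

theorem RegularPoint.shift {τ η : ℂ} {κ n m : ℕ} {z : ℂ} (h : RegularPoint τ η κ (n + 1) m z)
    {s : ℤ} (hs : |s| ≤ 1) : RegularPoint τ η κ n m (z + s * η) := by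
  intro i j hi hj
  have := h (s + i) j (by push_cast; linarith [abs_add_le s i]) hj
  push_cast at this
  simpa only [add_mul, ← add_assoc] using this

/-- The base case `n = 0` is a hypothesis because it is obtained from this same statement: after the
exchange of `τ` and `2η`, the `m` operators `B_κ` are operators `A_κ` acting on the trivial case. In
the induction step one factor `θ_κ(·|τ/2)⁻¹` is moved into `f`, where it cancels the theta function
produced by `opA_normalOrderedM`. -/
theorem factorizedM_succ_of {τ η : ℂ} (hτ : 0 < τ.im) (hη : 0 < η.im)
    (hinc : Incommensurable τ η) (κ m : ℕ)
    (h0 : ∀ (f : ℂ → ℂ) (z : ℂ), RegularPoint τ η κ 0 m z →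
      factorizedM τ η κ 0 m f z = normalOrderedM τ η 0 m f z) (n : ℕ) :
    ∀ (f : ℂ → ℂ) (z : ℂ), RegularPoint τ η κ n m z →
      factorizedM τ η κ n m f z = normalOrderedM τ η n m f z := by
  have hη0 : η ≠ 0 := by rintro rfl; simp at hη
  induction n with
  | zero => exact h0
  | succ n ih =>
    intro f z hz
    have h1 : (fun w => f w / (thetaK κ w η ^ m * thetaK κ w (τ / 2) ^ (n + 1))) =
        fun w => (f w / thetaK κ w (τ / 2)) / (thetaK κ w η ^ m * thetaK κ w (τ / 2) ^ n) := by
      funext w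
      rw [div_div]
      congr 1
      ring
    have e1 := ih (fun w => f w / thetaK κ w (τ / 2)) (z + η)
      (by simpa using hz.shift (s := 1) (by simp))
    have e2 := ih (fun w => f w / thetaK κ w (τ / 2)) (z - η)
      (by simpa [← sub_eq_add_neg] using hz.shift (s := -1) (by simp))
    have h2 := opA_normalOrderedM hτ hη0 hinc κ n m (z := z)
      (fun i hi => by simpa using (hz i 0 (by simpa using hi) (by simp)).1)
      (fun w => f w / thetaK κ w (τ / 2))
    rw [factorizedM, h1, prodA]
    rw [opA] at h2 ⊢
    rw [factorizedM] at e1 e2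
    rw [e1, e2, h2, normalOrderedM_eq, normalOrderedM_eq]
    refine Finset.sum_congr rfl fun k hk => Finset.sum_congr rfl fun l hl => ?_
    have hk' := Finset.mem_range.1 hk
    have hl' := Finset.mem_range.1 hl
    have h3 := (hz ((n + 1 : ℕ) - 2 * k) (m - 2 * l) (by rw [abs_le]; omega)
      (by rw [abs_le]; omega)).2.2.1
    push_cast at h3
    rw [div_mul_cancel₀]
    push_cast
    rwa [← add_assoc]

theorem normalOrderedM_zero_zero {τ η : ℂ} (f : ℂ → ℂ) {z : ℂ} (h1 : theta1 (2 * z) τ ≠ 0)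
    (h2 : theta1 (2 * z) (2 * η) ≠ 0) : normalOrderedM τ η 0 0 f z = f z := by
  simp [normalOrderedM, alphaCoeff, betaCoeff, ellBinom, h1, h2]

/-- The factorized operator equals the normal ordered one. -/
theorem factorizedM_eq_normalOrderedM {τ η : ℂ} (hτ : 0 < τ.im) (hη : 0 < η.im)
    (hinc : Incommensurable τ η) (κ n m : ℕ) (f : ℂ → ℂ) (z : ℂ)
    (hz : RegularPoint τ η κ n m z) :
    factorizedM τ η κ n m f z = normalOrderedM τ η n m f z := by
  have h00 : ∀ (τ' η' : ℂ) (f : ℂ → ℂ) (z : ℂ), RegularPoint τ' η' κ 0 0 z →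
      factorizedM τ' η' κ 0 0 f z = normalOrderedM τ' η' 0 0 f z := by
    intro τ' η' f z hz
    have h := hz 0 0 (by simp) (by simp)
    simp only [Int.cast_zero, zero_mul, add_zero] at h
    rw [normalOrderedM_zero_zero f h.1 h.2.1]
    simp [factorizedM, prodA, prodB]
  refine factorizedM_succ_of hτ hη hinc κ m (fun f z hz => ?_) n f z hz
  have h2 : 2 * (τ / 2) = τ := by ring
  have h3 : 2 * η / 2 = η := mul_div_cancel_left₀ η two_ne_zero
  have hB := factorizedM_succ_of (τ := 2 * η) (η := τ / 2) (by simpa using hη)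
    (by rw [show (2 : ℂ) = ((2 : ℝ) : ℂ) by norm_num, div_ofReal_im]; positivity)
    hinc.swap κ 0 (h00 _ _) m f z (by
      intro i j hi hj
      have h := hz j i hj hi
      rw [h2, h3, add_right_comm]
      exact ⟨h.2.1, h.1, h.2.2.2, h.2.2.1⟩)
  rw [normalOrderedM_swap] at hB
  rw [← hB, factorizedM, factorizedM, prodA, prodB, prodB_eq, h3]
  congr 1
  · simp
  · funext w
    congr 1
    ring

/-! ### Integrals of periodic functions over a period -/

theorem integral_period_shift {G : ℂ → ℂ} {a b : ℝ}
    (hG : DifferentiableOn ℂ G {x | x.im ∈ Set.uIcc a b}) (hper : ∀ x, G (x + 1) = G x) :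
    ∫ x in (0 : ℝ)..1, G (x + a * I) = ∫ x in (0 : ℝ)..1, G (x + b * I) := by
  have h := integral_boundary_rect_eq_zero_of_differentiableOn G (a * I) (1 + b * I)
    (hG.mono fun x hx => by
      have := hx.2
      simpa using this)
  have h2 : ∀ y : ℝ, G ((1 : ℂ) + y * I) = G ((0 : ℂ) + y * I) := fun y => by
    rw [zero_add, add_comm, hper]
  simp only [mul_re, ofReal_re, I_re, mul_zero, ofReal_im, I_im, mul_one, sub_self, add_re, one_re,
    add_zero, mul_im, zero_add, add_im, one_im, ofReal_one, ofReal_zero] at h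
  rw [← sub_eq_zero, ← h]
  have h3 : ∀ y : ℝ, G ((1 : ℂ) + y * I) = G (y * I) := fun y => by
    rw [h2, zero_add]
  simp only [h3]
  ring

theorem integral_period_neg {G : ℂ → ℂ} (hper : ∀ x, G (x + 1) = G x) (c : ℂ) :
    ∫ x in (0 : ℝ)..1, G (-x + c) = ∫ x in (0 : ℝ)..1, G (x + c) := by
  have h1 : Function.Periodic (fun x : ℝ => G (x + c)) 1 := fun x => by
    simp only [ofReal_add, ofReal_one]
    rw [← hper (x + c)]
    ring_nf
  have h2 := intervalIntegral.integral_comp_neg (a := 0) (b := 1) (fun x : ℝ => G (x + c))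
  simp only [ofReal_neg, neg_zero] at h2
  rw [h2]
  have h3 := h1.intervalIntegral_add_eq (-1) 0
  simpa using h3

/-- As `‖c‖ < 1`, the values of `1 - c e^{2πisx}` stay in the right half-plane, so the principal
logarithm gives a periodic primitive. -/
theorem integral_log_deriv_zero {c : ℂ} (hc : ‖c‖ < 1) (s : ℤ) (hs : s ≠ 0) :
    ∫ x in (0 : ℝ)..1, c * exp (2 * π * I * s * x) / (1 - c * exp (2 * π * I * s * x)) = 0 := by
  have hn : ∀ x : ℝ, ‖c * exp (2 * π * I * s * x)‖ < 1 := fun x => by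
    have : 2 * π * I * s * x = ((2 * π * s * x : ℝ) : ℂ) * I := by push_cast; ring
    rw [norm_mul, this, norm_exp_ofReal_mul_I, mul_one]
    exact hc
  have hslit : ∀ x : ℝ, 1 - c * exp (2 * π * I * s * x) ∈ slitPlane := fun x => by
    refine Or.inl ?_
    rw [sub_re, one_re, sub_pos]
    exact (re_le_norm _).trans_lt (hn x)
  have hs' : (2 * π * I * s : ℂ) ≠ 0 := mul_ne_zero two_pi_I_ne_zero (by exact_mod_cast hs)
  have hd : ∀ x ∈ Set.uIcc (0 : ℝ) 1, HasDerivAt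
      (fun x : ℝ => -(log (1 - c * exp (2 * π * I * s * x))) / (2 * π * I * s))
      (c * exp (2 * π * I * s * x) / (1 - c * exp (2 * π * I * s * x))) x := by
    intro x _
    have h1 : HasDerivAt (fun y : ℂ => 1 - c * exp (2 * π * I * s * y))
        (-(c * (exp (2 * π * I * s * x) * (2 * π * I * s)))) (x : ℂ) := by
      have := ((((hasDerivAt_id (x : ℂ)).const_mul (2 * π * I * s)).cexp).const_mul c).const_sub 1
      simpa using this
    have h2 := ((h1.clog (hslit x)).neg.div_const (2 * π * I * s)).comp_ofReal
    refine h2.congr_deriv ?_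
    field_simp
  rw [intervalIntegral.integral_eq_sub_of_hasDerivAt hd]
  · have : exp (2 * π * I * s * (1 : ℝ)) = 1 := by
      rw [exp_eq_one_iff]
      exact ⟨s, by push_cast; ring⟩
    rw [this]
    simp
  · apply Continuous.intervalIntegrable
    refine Continuous.div (by fun_prop) (by fun_prop) fun x => ?_
    exact slitPlane_ne_zero (hslit x)

theorem norm_exp_two_pi_I_mul_add (x : ℝ) (y : ℝ) :
    ‖exp (2 * π * I * (x + y * I))‖ = Real.exp (-(2 * π * y)) := by
  rw [norm_exp_two_pi_I_mul]
  simp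

/-- The mean of `1 / (1 - u)` over a circle about `0` is `1` inside the unit disc and, by
`integral_inv_one_sub_of_gt`, `0` outside. This jump is the only residue that has to be computed. -/
theorem integral_inv_one_sub_of_lt {t : ℂ} {y : ℝ} (h : ‖t‖ * Real.exp (-(2 * π * y)) < 1) :
    ∫ x in (0 : ℝ)..1, (1 - t * exp (2 * π * I * (x + y * I)))⁻¹ = 1 := by
  have hc : ‖t * exp (2 * π * I * (y * I))‖ < 1 := by
    have := norm_exp_two_pi_I_mul_add 0 y
    rw [ofReal_zero, zero_add] at this
    rwa [norm_mul, this]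
  have h0 := integral_log_deriv_zero hc 1 one_ne_zero
  have hne : ∀ x : ℝ, 1 - t * exp (2 * π * I * (x + y * I)) ≠ 0 := fun x h1 => by
    have h2 : ‖t * exp (2 * π * I * (x + y * I))‖ = 1 := by
      rw [← sub_eq_zero.1 h1, norm_one]
    rw [norm_mul, norm_exp_two_pi_I_mul_add] at h2
    exact h.ne h2
  have e : ∀ x : ℝ, t * exp (2 * π * I * (y * I)) * exp (2 * π * I * (1 : ℤ) * x) =
      t * exp (2 * π * I * (x + y * I)) := fun x => by
    rw [mul_assoc, ← exp_add]; congr 2; push_cast; ring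
  simp only [e] at h0
  have h1 : ∀ x : ℝ, (1 - t * exp (2 * π * I * (x + y * I)))⁻¹ = 1 +
      t * exp (2 * π * I * (x + y * I)) / (1 - t * exp (2 * π * I * (x + y * I))) := fun x => by
    rw [one_add_div (hne x), sub_add_cancel, one_div]
  simp only [h1]
  rw [intervalIntegral.integral_add (by simp), h0]
  · simp
  · apply Continuous.intervalIntegrable
    exact Continuous.div (by fun_prop) (by fun_prop) hne

theorem integral_inv_one_sub_of_gt {t : ℂ} {y : ℝ} (h : 1 < ‖t‖ * Real.exp (-(2 * π * y))) :
    ∫ x in (0 : ℝ)..1, (1 - t * exp (2 * π * I * (x + y * I)))⁻¹ = 0 := by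
  have ht : t ≠ 0 := by rintro rfl; simp at h; linarith
  have hc : ‖t⁻¹ * exp (-(2 * π * I * (y * I)))‖ < 1 := by
    have := norm_exp_two_pi_I_mul_add 0 y
    rw [ofReal_zero, zero_add] at this
    rw [exp_neg, ← mul_inv, norm_inv, norm_mul, this]
    exact inv_lt_one_of_one_lt₀ h
  have h0 := integral_log_deriv_zero hc (-1) (by norm_num)
  have e : ∀ x : ℝ, t⁻¹ * exp (-(2 * π * I * (y * I))) * exp (2 * π * I * (-1 : ℤ) * x) =
      (t * exp (2 * π * I * (x + y * I)))⁻¹ := fun x => by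
    rw [mul_assoc, ← exp_add, mul_inv, ← exp_neg]; congr 2; push_cast; ring
  simp only [e] at h0
  have hne : ∀ x : ℝ, 1 - t * exp (2 * π * I * (x + y * I)) ≠ 0 := fun x h1 => by
    have h2 : ‖t * exp (2 * π * I * (x + y * I))‖ = 1 := by
      rw [← sub_eq_zero.1 h1, norm_one]
    rw [norm_mul, norm_exp_two_pi_I_mul_add] at h2
    exact h.ne' h2
  have h1 : ∀ x : ℝ, (1 - t * exp (2 * π * I * (x + y * I)))⁻¹ =
      -((t * exp (2 * π * I * (x + y * I)))⁻¹ / (1 - (t * exp (2 * π * I * (x + y * I)))⁻¹)) :=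
    fun x => by
      have h2 := hne x
      have h3 : t * exp (2 * π * I * (x + y * I)) ≠ 0 := mul_ne_zero ht (exp_ne_zero _)
      have h4 : 1 - (t * exp (2 * π * I * (x + y * I)))⁻¹ ≠ 0 := by
        intro h5
        apply h2
        have : (t * exp (2 * π * I * (x + y * I)))⁻¹ = 1 := (sub_eq_zero.1 h5).symm
        rw [inv_eq_one.1 this, sub_self]
      generalize t * exp (2 * π * I * (x + y * I)) = u at *
      have h6 : u - 1 ≠ 0 := fun h => h2 (by linear_combination -h)
      rw [eq_comm, inv_eq_one_div, inv_eq_one_div, div_div, mul_sub, mul_one_div_cancel h3, mul_one,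
        ← neg_sub u 1]
      field_simp
  simp only [h1, intervalIntegral.integral_neg, h0, neg_zero]

theorem exp_two_pi_I_add_one (x : ℂ) : exp (2 * π * I * (x + 1)) = exp (2 * π * I * x) := by
  rw [exp_eq_exp_iff_exists_int]
  exact ⟨1, by push_cast; ring⟩

theorem exp_two_pi_I_neg (x : ℂ) : exp (2 * π * I * -x) = (exp (2 * π * I * x))⁻¹ := by
  rw [← exp_neg, mul_neg]

/-! ### One pair of poles: raising the contour and taking the residue -/

/-- The integral of `Q(x) (2 / (1 - t e^{2πix}) - 1)` over a period at height `Y`. -/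
def contourInt (Q : ℂ → ℂ) (Y : ℝ) (t : ℂ) : ℂ :=
  ∫ x in (0 : ℝ)..1, Q (x + Y * I) * (2 * (1 - t * exp (2 * π * I * (x + Y * I)))⁻¹ - 1)

section

variable {Q : ℂ → ℂ} {Y : ℝ}

theorem one_sub_mul_exp_ne_zero {t x : ℂ} (h : ‖t‖ * Real.exp (-(2 * π * x.im)) ≠ 1) :
    1 - t * exp (2 * π * I * x) ≠ 0 := fun h1 => h <| by
  rw [← norm_exp_two_pi_I_mul, ← norm_mul, ← sub_eq_zero.1 h1, norm_one]

theorem norm_eq_of_mul_exp_eq_one {t x : ℂ} (ht : t * exp (2 * π * I * x) = 1) :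
    ‖t‖ = Real.exp (2 * π * x.im) := by
  have h1 : ‖t‖ * Real.exp (-(2 * π * x.im)) = 1 := by
    rw [← norm_exp_two_pi_I_mul, ← norm_mul, ht, norm_one]
  rw [Real.exp_neg] at h1
  have := Real.exp_pos (2 * π * x.im)
  field_simp at h1
  exact h1

theorem continuous_comp_add_mul_I (hQ : ∀ x : ℂ, |x.im| ≤ Y → DifferentiableAt ℂ Q x) {y : ℝ}
    (hy : |y| ≤ Y) : Continuous fun x : ℝ => Q (x + y * I) :=
  continuous_iff_continuousAt.2 fun x =>
    ContinuousAt.comp (f := fun x : ℝ => (x : ℂ) + y * I)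
      (hQ _ (by simpa using hy)).continuousAt (by fun_prop)

/-- Partial fractions give `(1 - t²)⁻¹ (1/(1 - tw) + 1/(1 - t/w) - 1)`, and evenness of `Q` makes
the first two terms contribute equally. The zeros of `1 - t e^{2πix}` lie below the real axis when
`‖t‖ < 1`, so the contour can be raised to height `Y`. The right-hand side has no singularity from
the contour as long as `‖t‖ < e^{2πY}`, which is the continuation in `t`. -/
theorem integral_mul_inv_eq_contourInt (hY : 0 ≤ Y)
    (hQ : ∀ x : ℂ, |x.im| ≤ Y → DifferentiableAt ℂ Q x) (hper : ∀ x, Q (x + 1) = Q x)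
    (heven : ∀ x, Q (-x) = Q x) {t : ℂ} (ht : ‖t‖ < 1) :
    ∫ x in (0 : ℝ)..1,
        Q x * ((1 - t * exp (2 * π * I * x)) * (1 - t / exp (2 * π * I * x)))⁻¹ =
      (1 - t ^ 2)⁻¹ * contourInt Q Y t := by
  have hlt : ∀ y : ℝ, 0 ≤ y → ‖t‖ * Real.exp (-(2 * π * y)) < 1 := fun y hy => by
    have h1 : Real.exp (-(2 * π * y)) ≤ 1 := Real.exp_le_one_iff.2 (by
      have := mul_nonneg Real.two_pi_pos.le hy
      linarith)
    nlinarith [norm_nonneg t, Real.exp_pos (-(2 * π * y))]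
  have hne : ∀ x : ℂ, 0 ≤ x.im → 1 - t * exp (2 * π * I * x) ≠ 0 := fun x hx =>
    one_sub_mul_exp_ne_zero (hlt _ hx).ne
  let G : ℂ → ℂ := fun x => Q x * (2 * (1 - t * exp (2 * π * I * x))⁻¹ - 1)
  have hGd : DifferentiableOn ℂ G {x | x.im ∈ Set.uIcc 0 Y} := by
    intro x hx
    rw [Set.uIcc_of_le hY] at hx
    have h1 := hQ x (by rw [abs_of_nonneg hx.1]; exact hx.2)
    have h2 := hne x hx.1
    refine DifferentiableAt.differentiableWithinAt ?_
    have h3 : DifferentiableAt ℂ (fun x : ℂ => 1 - t * exp (2 * π * I * x)) x := by fun_prop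
    exact h1.mul (((h3.inv h2).const_mul 2).sub_const 1)
  have hGper : ∀ x, G (x + 1) = G x := fun x => by
    simp only [G, hper, exp_two_pi_I_add_one]
  have hshift := integral_period_shift hGd hGper
  have hneg := integral_period_neg (G := fun x => Q x * (1 - t * exp (2 * π * I * x))⁻¹)
    (fun x => by simp only [hper, exp_two_pi_I_add_one]) 0
  simp only [add_zero, heven, exp_two_pi_I_neg, ← div_eq_mul_inv t] at hneg
  have hQc : Continuous fun x : ℝ => Q x := by
    simpa using continuous_comp_add_mul_I hQ (y := 0) (by simpa using hY)
  have hne2 : ∀ x : ℝ, 1 - t / exp (2 * π * I * x) ≠ 0 := fun x => by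
    have := hne (-x) (by simp)
    rwa [exp_two_pi_I_neg] at this
  have hne1 : ∀ x : ℝ, 1 - t * exp (2 * π * I * x) ≠ 0 := fun x => hne x (by simp)
  have hc1 : Continuous fun x : ℝ => Q x * (1 - t * exp (2 * π * I * x))⁻¹ :=
    hQc.mul (Continuous.inv₀ (by fun_prop) hne1)
  have hc2 : Continuous fun x : ℝ => Q x * (1 - t / exp (2 * π * I * x))⁻¹ :=
    hQc.mul (Continuous.inv₀ (by
      refine continuous_const.sub (Continuous.div continuous_const (by fun_prop) ?_)
      exact fun x => exp_ne_zero _) hne2)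
  have ht2 : 1 - t ^ 2 ≠ 0 := fun h => by
    have h1 : ‖t‖ ^ 2 = 1 := by rw [← norm_pow, ← sub_eq_zero.1 h, norm_one]
    exact (pow_lt_one₀ (norm_nonneg t) ht two_ne_zero).ne h1
  have hpt : ∀ x : ℝ, Q x * ((1 - t * exp (2 * π * I * x)) * (1 - t / exp (2 * π * I * x)))⁻¹ =
      (1 - t ^ 2)⁻¹ * (Q x * (1 - t * exp (2 * π * I * x))⁻¹ +
        Q x * (1 - t / exp (2 * π * I * x))⁻¹ - Q x) := fun x => by
    have h1 := hne1 x
    have h2 := hne2 x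
    have h3 := exp_ne_zero (2 * π * I * x)
    generalize exp (2 * π * I * x) = w at *
    have h4 : w - t ≠ 0 := fun h => h2 (by rw [← sub_eq_zero.1 h, div_self h3, sub_self])
    field_simp
    ring
  have hcont : contourInt Q Y t = ∫ x in (0 : ℝ)..1, G x := by
    rw [contourInt]
    simpa using hshift.symm
  simp only [hpt]
  rw [intervalIntegral.integral_const_mul, hcont,
    intervalIntegral.integral_sub
      ((hc1.intervalIntegrable _ _).add (hc2.intervalIntegrable _ _))
      (hQc.intervalIntegrable _ _),
    intervalIntegral.integral_add (hc1.intervalIntegrable _ _) (hc2.intervalIntegrable _ _), hneg]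
  have hG2 : ∀ x : ℝ, G x = 2 * (Q x * (1 - t * exp (2 * π * I * x))⁻¹) - Q x := fun x => by
    simp only [G]
    ring
  simp only [hG2]
  rw [intervalIntegral.integral_sub ((hc1.const_mul 2).intervalIntegrable _ _)
      (hQc.intervalIntegrable _ _), intervalIntegral.integral_const_mul]
  ring

/-- The residue theorem for a simple pole, on a period strip. -/
theorem integral_sub_integral_eq_residue (hY : 0 ≤ Y)
    (hQ : ∀ x : ℂ, |x.im| ≤ Y → DifferentiableAt ℂ Q x) (hper : ∀ x, Q (x + 1) = Q x)
    {t x₀ : ℂ} (hx₀ : |x₀.im| < Y) (ht : t * exp (2 * π * I * x₀) = 1) :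
    (∫ x in (0 : ℝ)..1, Q (x + Y * I) * (1 - t * exp (2 * π * I * (x + Y * I)))⁻¹) -
      ∫ x in (0 : ℝ)..1, Q (x + (-Y : ℝ) * I) *
        (1 - t * exp (2 * π * I * (x + (-Y : ℝ) * I)))⁻¹ = Q x₀ := by
  have ht0 : t ≠ 0 := left_ne_zero_of_mul_eq_one ht
  have hx := abs_lt.1 hx₀
  have hnt : ‖t‖ = Real.exp (2 * π * x₀.im) := norm_eq_of_mul_exp_eq_one ht
  let e : ℂ → ℂ := fun x => 1 - t * exp (2 * π * I * x)
  -- Subtracting `Q x₀` makes the pole removable. `G` is `H` with the value at `x₀` filled in, and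
  -- as a quotient of `dslope`s it is holomorphic on the rectangle of width `1` centred at `x₀.re`,
  -- in which `e` has no other zero.
  let H : ℂ → ℂ := fun x => (Q x - Q x₀) * (e x)⁻¹
  let G : ℂ → ℂ := fun x => dslope Q x₀ x / dslope e x₀ x
  have hde : Differentiable ℂ e := by fun_prop
  have he0 : e x₀ = 0 := by simp [e, ht]
  have he : ∀ x, e x = 0 → ∃ n : ℤ, x = x₀ + n := by
    intro x hx
    have h1 : exp (2 * π * I * (x - x₀)) = 1 := by
      rw [mul_sub, exp_sub, div_eq_one_iff_eq (exp_ne_zero _)]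
      refine mul_left_cancel₀ ht0 ?_
      rw [ht]
      exact (sub_eq_zero.1 hx).symm
    obtain ⟨n, hn⟩ := exp_two_pi_I_mul_eq_one h1
    exact ⟨n, by rw [← hn]; ring⟩
  have hGH : ∀ x, x ≠ x₀ → G x = H x := by
    intro x hx
    have h1 : x - x₀ ≠ 0 := sub_ne_zero.2 hx
    simp only [G, H, dslope_of_ne _ hx, slope_def_field, he0, sub_zero]
    rw [div_div_div_cancel_right₀ h1, div_eq_mul_inv]
  have hHper : ∀ x, H (x + 1) = H x := fun x => by
    simp only [H, e, hper, exp_two_pi_I_add_one]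
  have hs : {x : ℂ | |x.im| ≤ Y} ∈ 𝓝 x₀ := by
    filter_upwards [(isOpen_lt (continuous_abs.comp continuous_im) continuous_const).mem_nhds hx₀]
      with x hx using le_of_lt hx
  have hdQ : DifferentiableOn ℂ (dslope Q x₀) {x : ℂ | |x.im| ≤ Y} :=
    (differentiableOn_dslope hs).2 fun x hx => (hQ x hx).differentiableWithinAt
  have hdE : DifferentiableOn ℂ (dslope e x₀) Set.univ :=
    (differentiableOn_dslope univ_mem).2 hde.differentiableOn
  have hE0 : ∀ x : ℂ, |x.re - x₀.re| ≤ 1 / 2 → dslope e x₀ x ≠ 0 := by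
    intro x hx
    rcases eq_or_ne x x₀ with rfl | hne
    · rw [dslope_same]
      have h1 : HasDerivAt e (-(t * (exp (2 * π * I * x) * (2 * π * I)))) x := by
        have := (((hasDerivAt_id x).const_mul (2 * π * I)).cexp.const_mul t).const_sub 1
        simpa using this
      rw [h1.deriv, ← mul_assoc, ht, one_mul]
      exact neg_ne_zero.2 two_pi_I_ne_zero
    · rw [dslope_of_ne _ hne, slope_def_field, he0, sub_zero]
      refine div_ne_zero (fun h => ?_) (sub_ne_zero.2 hne)
      obtain ⟨n, rfl⟩ := he x h
      have h2 : |(n : ℝ)| ≤ 1 / 2 := by simpa using hx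
      have h3 : |(n : ℝ)| < 1 := by linarith
      have h4 : n = 0 := Int.abs_lt_one_iff.1 (by exact_mod_cast h3)
      exact hne (by simp [h4])
  have hrect := integral_boundary_rect_eq_zero_of_differentiableOn G
    (((x₀.re - 1 / 2 : ℝ) : ℂ) + (-Y : ℝ) * I) (((x₀.re + 1 / 2 : ℝ) : ℂ) + (Y : ℝ) * I) (by
      intro x hx
      obtain ⟨h1, h2⟩ := hx
      simp only [add_re, ofReal_re, mul_re, I_re, mul_zero, ofReal_im, I_im, mul_one, sub_self,
        add_zero, add_im, mul_im, zero_add, Set.mem_preimage] at h1 h2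
      rw [Set.uIcc_of_le (by linarith), Set.mem_Icc] at h1 h2
      have h3 : x ∈ {x : ℂ | |x.im| ≤ Y} := abs_le.2 h2
      refine DifferentiableWithinAt.div ((hdQ x h3).mono fun y hy => ?_)
        ((hdE x trivial).mono (Set.subset_univ _))
        (hE0 x (abs_le.2 ⟨by linarith, by linarith⟩))
      have h4 := hy.2
      simp only [ofReal_re, I_re, mul_zero, ofReal_im, I_im, mul_one, add_zero, add_im, mul_im,
        zero_add, Set.mem_preimage] at h4
      rw [Set.uIcc_of_le (by linarith), Set.mem_Icc] at h4
      exact abs_le.2 h4)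
  simp only [add_re, ofReal_re, mul_re, I_re, mul_zero, ofReal_im, I_im, mul_one, sub_self,
    add_zero, add_im, mul_im, zero_add] at hrect
  have hvert : ∀ y : ℝ, G (((x₀.re + 1 / 2 : ℝ) : ℂ) + y * I) =
      G (((x₀.re - 1 / 2 : ℝ) : ℂ) + y * I) := by
    intro y
    rw [hGH _ fun h => by have := congrArg re h; simp at this,
      hGH _ fun h => by have := congrArg re h; simp at this,
      ← hHper (((x₀.re - 1 / 2 : ℝ) : ℂ) + _)]
    congr 1
    push_cast
    ring
  have hhor : ∀ y : ℝ, |y| = Y → ∀ x : ℝ, G (x + y * I) = H (x + y * I) := by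
    intro y hy x
    refine hGH _ fun h => ?_
    have h1 := congrArg im h
    simp only [add_im, ofReal_im, mul_im, ofReal_re, I_im, I_re, mul_one, mul_zero, add_zero,
      zero_add] at h1
    rw [← h1] at hx₀
    exact hx₀.ne hy
  have hYY : |Y| = Y := abs_of_nonneg hY
  have hYY' : |(-Y)| = Y := by rw [abs_neg, hYY]
  simp only [hvert, hhor Y hYY, hhor (-Y) hYY', add_sub_cancel_right] at hrect
  have hperiod : ∀ y : ℝ, ∫ x in (x₀.re - 1 / 2)..(x₀.re + 1 / 2), H (x + y * I) =
      ∫ x in (0 : ℝ)..1, H (x + y * I) := by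
    intro y
    have h1 : Function.Periodic (fun x : ℝ => H (x + y * I)) 1 := fun x => by
      simp only [ofReal_add, ofReal_one]
      rw [← hHper (x + y * I)]
      ring_nf
    have h2 := h1.intervalIntegral_add_eq (x₀.re - 1 / 2) 0
    rw [zero_add, show x₀.re - 1 / 2 + 1 = x₀.re + 1 / 2 by ring] at h2
    exact h2
  rw [hperiod, hperiod] at hrect
  have hlt : ‖t‖ * Real.exp (-(2 * π * Y)) < 1 := by
    rw [hnt, ← Real.exp_add, Real.exp_lt_one_iff]
    nlinarith [Real.two_pi_pos]
  have hgt : 1 < ‖t‖ * Real.exp (-(2 * π * -Y)) := by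
    rw [hnt, ← Real.exp_add, Real.one_lt_exp_iff]
    nlinarith [Real.two_pi_pos]
  have hne : ∀ y : ℝ, ‖t‖ * Real.exp (-(2 * π * y)) ≠ 1 → ∀ x : ℝ,
      1 - t * exp (2 * π * I * (x + y * I)) ≠ 0 := fun y hy x =>
    one_sub_mul_exp_ne_zero (by simpa using hy)
  have hsplit : ∀ y : ℝ, |y| = Y → ‖t‖ * Real.exp (-(2 * π * y)) ≠ 1 →
      ∫ x in (0 : ℝ)..1, H (x + y * I) =
      (∫ x in (0 : ℝ)..1, Q (x + y * I) * (1 - t * exp (2 * π * I * (x + y * I)))⁻¹) -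
        Q x₀ * ∫ x in (0 : ℝ)..1, (1 - t * exp (2 * π * I * (x + y * I)))⁻¹ := by
    intro y hy hy'
    have hc1 : Continuous fun x : ℝ => (1 - t * exp (2 * π * I * (x + y * I)))⁻¹ :=
      Continuous.inv₀ (by fun_prop) (hne y hy')
    have hc2 : Continuous fun x : ℝ => Q (x + y * I) *
      (1 - t * exp (2 * π * I * (x + y * I)))⁻¹ := (continuous_comp_add_mul_I hQ hy.le).mul hc1
    rw [← intervalIntegral.integral_const_mul, ← intervalIntegral.integral_sub
      (hc2.intervalIntegrable _ _) ((hc1.const_mul _).intervalIntegrable _ _)]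
    refine intervalIntegral.integral_congr fun x _ => ?_
    simp only [H, e]
    ring
  rw [hsplit Y hYY hlt.ne, hsplit (-Y) hYY' hgt.ne', integral_inv_one_sub_of_lt hlt,
    integral_inv_one_sub_of_gt hgt] at hrect
  linear_combination -hrect

/-- The reflection `x ↦ -x` turns the integral for `t⁻¹` into minus the integral for `t` at height
`-Y`. The sum is therefore a difference between two heights, with one pole per period in between. -/
theorem contourInt_add_inv (hY : 0 ≤ Y)
    (hQ : ∀ x : ℂ, |x.im| ≤ Y → DifferentiableAt ℂ Q x) (hper : ∀ x, Q (x + 1) = Q x)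
    (heven : ∀ x, Q (-x) = Q x) {t x₀ : ℂ} (hx₀ : |x₀.im| < Y)
    (ht : t * exp (2 * π * I * x₀) = 1) :
    contourInt Q Y t + contourInt Q Y t⁻¹ = 2 * Q x₀ := by
  have ht0 : t ≠ 0 := left_ne_zero_of_mul_eq_one ht
  have hnt : ‖t‖ = Real.exp (2 * π * x₀.im) := norm_eq_of_mul_exp_eq_one ht
  have hx := abs_lt.1 hx₀
  have hne : ∀ (y : ℝ), |y| = Y → ∀ x : ℝ, 1 - t * exp (2 * π * I * (x + y * I)) ≠ 0 := by
    intro y hy x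
    refine one_sub_mul_exp_ne_zero ?_
    rw [hnt, ← Real.exp_add]
    simp only [add_im, ofReal_im, mul_im, ofReal_re, I_im, I_re, mul_one, mul_zero, add_zero,
      zero_add, Ne, Real.exp_eq_one_iff]
    intro h
    have h3 : x₀.im = y := by
      have := Real.two_pi_pos
      have h4 : 2 * π * (x₀.im - y) = 0 := by linear_combination h
      rcases mul_eq_zero.1 h4 with h5 | h5 <;> linarith
    rw [← h3] at hy
    exact hx₀.ne hy
  have hYY : |Y| = Y := abs_of_nonneg hY
  have hres := integral_sub_integral_eq_residue hY hQ hper hx₀ ht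
  have hQc : ∀ y : ℝ, |y| ≤ Y → Continuous fun x : ℝ => Q (x + y * I) := fun y hy =>
    continuous_comp_add_mul_I hQ hy
  have hc : ∀ y : ℝ, |y| = Y → Continuous fun x : ℝ =>
      Q (x + y * I) * (1 - t * exp (2 * π * I * (x + y * I)))⁻¹ := fun y hy =>
    (hQc y hy.le).mul (Continuous.inv₀ (by fun_prop) (hne y hy))
  have hQs := integral_period_shift (a := -Y) (b := Y) (G := Q) (fun x hx =>
    (hQ x (by
      rw [Set.mem_ofPred_eq, Set.uIcc_of_le (by linarith)] at hx
      exact abs_le.2 hx)).differentiableWithinAt) hper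
  have e1 : contourInt Q Y t = 2 * (∫ x in (0 : ℝ)..1,
      Q (x + Y * I) * (1 - t * exp (2 * π * I * (x + Y * I)))⁻¹) -
      ∫ x in (0 : ℝ)..1, Q (x + Y * I) := by
    rw [contourInt, ← intervalIntegral.integral_const_mul, ← intervalIntegral.integral_sub
      (((hc Y hYY).const_mul 2).intervalIntegrable _ _) ((hQc Y hYY.le).intervalIntegrable _ _)]
    refine intervalIntegral.integral_congr fun x _ => ?_
    ring
  have e2 : contourInt Q Y t⁻¹ = (∫ x in (0 : ℝ)..1, Q (x + (-Y : ℝ) * I)) - 2 *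
      ∫ x in (0 : ℝ)..1, Q (x + (-Y : ℝ) * I) *
        (1 - t * exp (2 * π * I * (x + (-Y : ℝ) * I)))⁻¹ := by
    have h := integral_period_neg
      (G := fun x => Q x * (2 * (1 - t⁻¹ * exp (2 * π * I * x))⁻¹ - 1))
      (fun x => by simp only [hper, exp_two_pi_I_add_one]) (Y * I)
    rw [contourInt, ← h, ← intervalIntegral.integral_const_mul, ← intervalIntegral.integral_sub
      ((hQc (-Y) (by rw [abs_neg, hYY])).intervalIntegrable _ _)
      (((hc (-Y) (by rw [abs_neg, hYY])).const_mul 2).intervalIntegrable _ _)]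
    refine intervalIntegral.integral_congr fun x _ => ?_
    have h1 := hne (-Y) (by rw [abs_neg, hYY]) x
    have h2 : -(x : ℂ) + Y * I = -(x + (-Y : ℝ) * I) := by push_cast; ring
    rw [h2, heven, exp_two_pi_I_neg, ← mul_inv]
    have h3 : t * exp (2 * π * I * (x + (-Y : ℝ) * I)) ≠ 0 := mul_ne_zero ht0 (exp_ne_zero _)
    generalize t * exp (2 * π * I * (x + (-Y : ℝ) * I)) = u at *
    have h4 : u - 1 ≠ 0 := fun h => h1 (by linear_combination -h)
    have h5 : 1 - u⁻¹ = (u - 1) / u := by field_simp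
    rw [h5, inv_div, ← neg_sub u 1, inv_neg]
    field_simp
    ring
  rw [e1, e2, ← hQs]
  linear_combination 2 * hres

end

/-- Partial fractions for products of the factors `(1 - t w)(1 - t / w)`. -/
theorem prod_inv_eq_sum {ι : Type*} [DecidableEq ι] {K : Finset ι} (hK : K.Nonempty) {t : ι → ℂ}
    {w : ℂ} (hw : w ≠ 0) (ht : ∀ i ∈ K, t i ≠ 0)
    (hsep : ∀ i ∈ K, ∀ j ∈ K, i ≠ j → (1 - t i * t j) * (1 - t i / t j) ≠ 0)
    (hne : ∀ i ∈ K, (1 - t i * w) * (1 - t i / w) ≠ 0) :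
    (∏ i ∈ K, ((1 - t i * w) * (1 - t i / w)))⁻¹ =
      ∑ j ∈ K, (∏ i ∈ K.erase j, ((1 - t i * t j) * (1 - t i / t j)))⁻¹ *
        ((1 - t j * w) * (1 - t j / w))⁻¹ := by
  -- In the variable `w + w⁻¹` each factor is linear with root `d i`; the identity is Lagrange
  -- interpolation of the constant `1` at the nodes `d i`.
  let d : ι → ℂ := fun i => t i + (t i)⁻¹
  have h1 : ∀ i ∈ K, ∀ v : ℂ, v ≠ 0 → (1 - t i * v) * (1 - t i / v) = t i * (d i - (v + v⁻¹)) := by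
    intro i hi v hv
    have := ht i hi
    simp only [d]
    field_simp
    ring
  have hinj : Set.InjOn d K := by
    intro i hi j hj hij
    by_contra hne'
    refine hsep i hi j hj hne' ?_
    rw [h1 i hi _ (ht j hj), hij]
    simp [d]
  have hsum := congrArg (Polynomial.eval (w + w⁻¹)) (Lagrange.sum_basis hinj hK)
  rw [Polynomial.eval_finsetSum, Polynomial.eval_one] at hsum
  have hsum2 := congrArg (fun y => (∏ i ∈ K, ((1 - t i * w) * (1 - t i / w)))⁻¹ * y) hsum
  simp only [mul_one, Finset.mul_sum] at hsum2
  rw [← hsum2]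
  refine Finset.sum_congr rfl fun j hj => ?_
  rw [← Finset.mul_prod_erase K _ hj, mul_inv, mul_comm (∏ i ∈ K.erase j, _)⁻¹, mul_assoc]
  congr 1
  rw [Lagrange.basis, Polynomial.eval_prod, ← Finset.prod_inv_distrib, ← Finset.prod_inv_distrib,
    ← Finset.prod_mul_distrib]
  refine Finset.prod_congr rfl fun i hi => ?_
  obtain ⟨hij, hi'⟩ := Finset.mem_erase.1 hi
  have hn := hne i hi'
  have hs := hsep i hi' j hj hij
  rw [h1 i hi' _ hw] at hn ⊢
  rw [h1 i hi' _ (ht j hj)] at hs ⊢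
  rw [Lagrange.basisDivisor]
  simp only [Polynomial.eval_mul, Polynomial.eval_C, Polynomial.eval_sub, Polynomial.eval_X]
  have a1 := right_ne_zero_of_mul hn
  have a2 := right_ne_zero_of_mul hs
  have a3 := ht i hi'
  have a4 : d i - d j ≠ 0 := a2
  have a5 : d j - d i ≠ 0 := fun h => a4 (by linear_combination -h)
  change _ = (t i * (d i - d j))⁻¹
  generalize w + w⁻¹ = v at *
  rw [← neg_sub (d i) (d j), inv_neg, ← neg_sub (d i) v]
  field_simp

/-- Holomorphic dependence of an integral on a parameter. -/
theorem analyticOnNhd_integral {f : ℂ × ℂ → ℂ} {U : Set ℂ} (hU : IsOpen U) {Y : ℝ}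
    (hf : ∀ s ∈ U, ∀ x : ℝ, AnalyticAt ℂ f (s, x + Y * I)) :
    AnalyticOnNhd ℂ (fun s => ∫ x in (0 : ℝ)..1, f (s, x + Y * I)) U := by
  refine DifferentiableOn.analyticOnNhd (fun s₀ hs₀ => ?_) hU
  let g : ℂ × ℝ → ℂ × ℂ := fun y => (y.1, y.2 + Y * I)
  have hg : Continuous g := by fun_prop
  have hcont : ∀ y : ℂ × ℝ, y.1 ∈ U →
      ContinuousAt (fun y : ℂ × ℝ => fderiv ℂ f (g y) (1, 0)) y := fun y hy => by
    have h1 : ContinuousAt (fderiv ℂ f) (g y) := (hf y.1 hy y.2).fderiv.continuousAt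
    exact (h1.comp hg.continuousAt).clm_apply continuousAt_const
  obtain ⟨R, hR, hball⟩ := Metric.nhds_basis_closedBall.mem_iff.1 (hU.mem_nhds hs₀)
  have hcompact : IsCompact (Metric.closedBall s₀ R ×ˢ Set.uIcc (0 : ℝ) 1) :=
    (isCompact_closedBall s₀ R).prod isCompact_uIcc
  obtain ⟨M, hM⟩ := hcompact.exists_bound_of_continuousOn
    (f := fun y : ℂ × ℝ => fderiv ℂ f (g y) (1, 0))
    fun y hy => (hcont y (hball hy.1)).continuousWithinAt
  have hfc : ∀ s ∈ U, Continuous fun x : ℝ => f (s, x + Y * I) := fun s hs =>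
    continuous_iff_continuousAt.2 fun x => by
      have h1 : ContinuousAt f (s, x + Y * I) := (hf s hs x).continuousAt
      exact ContinuousAt.comp (f := fun x : ℝ => (s, (x : ℂ) + Y * I)) h1 (by fun_prop)
  have key := intervalIntegral.hasDerivAt_integral_of_dominated_loc_of_deriv_le
    (μ := volume) (a := 0) (b := 1) (F := fun s (x : ℝ) => f (s, x + Y * I))
    (F' := fun s (x : ℝ) => fderiv ℂ f (g (s, x)) (1, 0)) (x₀ := s₀) (bound := fun _ => M)
    (Metric.closedBall_mem_nhds s₀ hR)
    (by
      filter_upwards [hU.mem_nhds hs₀] with s hs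
      exact (hfc s hs).aestronglyMeasurable)
    ((hfc s₀ hs₀).intervalIntegrable _ _)
    (by
      have : Continuous fun x : ℝ => fderiv ℂ f (g (s₀, x)) (1, 0) :=
        continuous_iff_continuousAt.2 fun x =>
          ContinuousAt.comp (f := fun x : ℝ => (s₀, x)) (hcont (s₀, x) hs₀) (by fun_prop)
      exact this.aestronglyMeasurable)
    (ae_of_all _ fun x hx s hs => hM (s, x) ⟨hs, Set.uIoc_subset_uIcc hx⟩)
    (by simp)
    (ae_of_all _ fun x hx s hs => by
      have h1 : HasFDerivAt f (fderiv ℂ f (g (s, x))) (g (s, x)) :=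
        (hf s (hball hs) x).differentiableAt.hasFDerivAt
      have h2 : HasDerivAt (fun s : ℂ => (s, (x : ℂ) + Y * I)) (1, 0) s :=
        (hasDerivAt_id s).prodMk (hasDerivAt_const s _)
      exact HasFDerivAt.comp_hasDerivAt s h1 h2)
  exact key.2.differentiableAt.differentiableWithinAt

/-! ### Continuation of an integral whose contour is pinched by finitely many pairs of poles -/

section Continuation

variable {ι : Type*}

/-- The product of the factors `(1 - tᵢ tₖ)(1 - tᵢ / tₖ)` over `i ∈ K`. -/
def sepProd (K : Finset ι) (t : ι → ℂ) (k : ι) : ℂ :=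
  ∏ i ∈ K, ((1 - t i * t k) * (1 - t i / t k))

variable {Q : ℂ × ℂ → ℂ} {Y : ℝ} {K : Finset ι} {t : ι → ℂ → ℂ} {U : Set ℂ}

theorem differentiable_sepFactor (ht : ∀ i ∈ K, Differentiable ℂ (t i))
    (ht0 : ∀ i ∈ K, ∀ s, t i s ≠ 0) {i k : ι} (hi : i ∈ K) (hk : k ∈ K) :
    Differentiable ℂ fun s => (1 - t i s * t k s) * (1 - t i s / t k s) := by
  have h1 := ht i hi
  have h2 := ht k hk
  exact ((differentiable_const _).sub (h1.mul h2)).mul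
    ((differentiable_const _).sub (h1.div h2 (ht0 k hk)))

theorem analyticOnNhd_contourInt (hU : IsOpen U) (hY : 0 ≤ Y)
    (hQ : ∀ s ∈ U, ∀ x : ℂ, |x.im| ≤ Y → AnalyticAt ℂ Q (s, x)) {u : ℂ → ℂ}
    (hu : Differentiable ℂ u) (hlt : ∀ s ∈ U, ‖u s‖ * Real.exp (-(2 * π * Y)) < 1) :
    AnalyticOnNhd ℂ (fun s => contourInt (fun x => Q (s, x)) Y (u s)) U := by
  refine analyticOnNhd_integral
    (f := fun y => Q y * (2 * (1 - u y.1 * exp (2 * π * I * y.2))⁻¹ - 1)) hU fun s hs x => ?_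
  have h1 : AnalyticAt ℂ Q (s, x + Y * I) := hQ s hs _ (by simp [abs_of_nonneg hY])
  have h2 : AnalyticAt ℂ (fun y : ℂ × ℂ => u y.1) (s, x + Y * I) :=
    (hu.analyticAt s).fun_comp (f := fun y : ℂ × ℂ => y.1) analyticAt_fst
  have h3 : AnalyticAt ℂ (fun y : ℂ × ℂ => 1 - u y.1 * exp (2 * π * I * y.2)) (s, x + Y * I) := by
    refine analyticAt_const.sub (h2.mul ?_)
    exact (analyticAt_const.mul analyticAt_snd).cexp'
  have h4 : 1 - u s * exp (2 * π * I * (x + Y * I)) ≠ 0 :=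
    one_sub_mul_exp_ne_zero (by simpa using (hlt s hs).ne)
  exact h1.mul ((analyticAt_const.mul (h3.inv h4)).sub analyticAt_const)

theorem differentiable_sepProd (ht : ∀ i ∈ K, Differentiable ℂ (t i))
    (ht0 : ∀ i ∈ K, ∀ s, t i s ≠ 0) {K' : Finset ι} (hK' : K' ⊆ K) {k : ι} (hk : k ∈ K) :
    Differentiable ℂ fun s => sepProd K' (fun i => t i s) k := by
  unfold sepProd
  exact Differentiable.fun_finsetProd fun i hi => differentiable_sepFactor ht ht0 (hK' hi) hk

variable [DecidableEq ι]

/-- The contribution of one pole pair to the continued integral. -/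
def poleTerm (Q : ℂ × ℂ → ℂ) (Y : ℝ) (K : Finset ι) (t : ι → ℂ → ℂ) (k : ι) (s : ℂ) : ℂ :=
  (sepProd (K.erase k) (fun i => t i s) k)⁻¹ *
    ((1 - t k s ^ 2)⁻¹ * contourInt (fun x => Q (s, x)) Y (t k s))

theorem meromorphicOn_poleTerm (hU : IsOpen U) (hY : 0 ≤ Y)
    (hQ : ∀ s ∈ U, ∀ x : ℂ, |x.im| ≤ Y → AnalyticAt ℂ Q (s, x))
    (ht : ∀ i ∈ K, Differentiable ℂ (t i)) (ht0 : ∀ i ∈ K, ∀ s, t i s ≠ 0)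
    (hlt : ∀ i ∈ K, ∀ s ∈ U, ‖t i s‖ * Real.exp (-(2 * π * Y)) < 1) {k : ι} (hk : k ∈ K) :
    MeromorphicOn (poleTerm Q Y K t k) U := by
  intro s hs
  have h1 := ((differentiable_sepProd ht ht0 (K.erase_subset k) hk).analyticAt s).meromorphicAt.inv
  have h2 : AnalyticAt ℂ (fun s => 1 - t k s ^ 2) s :=
    analyticAt_const.sub (((ht k hk).analyticAt s).pow 2)
  exact h1.mul (h2.meromorphicAt.inv.mul
    (analyticOnNhd_contourInt hU hY hQ (ht k hk) (hlt k hk) s hs).meromorphicAt)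

/-- With all `t i s` in the unit disc, partial fractions isolate one pair of poles at a time and
each contour is raised separately. The left-hand side remains meromorphic beyond this region. -/
theorem sum_poleTerm_eq_integral (hY : 0 ≤ Y) (hK : K.Nonempty)
    {s : ℂ} (hQ : ∀ x : ℂ, |x.im| ≤ Y → DifferentiableAt ℂ (fun x => Q (s, x)) x)
    (hper : ∀ x, Q (s, x + 1) = Q (s, x)) (heven : ∀ x, Q (s, -x) = Q (s, x))
    (ht0 : ∀ i ∈ K, t i s ≠ 0) (hlt : ∀ i ∈ K, ‖t i s‖ < 1)
    (hinj : ∀ i ∈ K, ∀ j ∈ K, i ≠ j → t i s ≠ t j s) :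
    ∑ k ∈ K, poleTerm Q Y K t k s =
      ∫ x in (0 : ℝ)..1, Q (s, x) *
        (∏ i ∈ K, ((1 - t i s * exp (2 * π * I * x)) * (1 - t i s / exp (2 * π * I * x))))⁻¹ := by
  have hw : ∀ x : ℝ, ‖exp (2 * π * I * x)‖ = 1 := fun x => by
    rw [norm_exp_two_pi_I_mul]; simp
  have hne1 : ∀ u v : ℂ, ‖u‖ < 1 → ‖v‖ ≤ 1 → 1 - u * v ≠ 0 := fun u v hu hv h => by
    have h1 : ‖u‖ * ‖v‖ = 1 := by rw [← norm_mul, ← sub_eq_zero.1 h, norm_one]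
    nlinarith [norm_nonneg u, norm_nonneg v]
  have hfac : ∀ i ∈ K, ∀ x : ℝ,
      (1 - t i s * exp (2 * π * I * x)) * (1 - t i s / exp (2 * π * I * x)) ≠ 0 := by
    intro i hi x
    refine mul_ne_zero (hne1 _ _ (hlt i hi) (hw x).le) ?_
    rw [div_eq_mul_inv]
    exact hne1 _ _ (hlt i hi) (by rw [norm_inv, hw, inv_one])
  have hpf : ∀ x : ℝ, Q (s, x) *
      (∏ i ∈ K, ((1 - t i s * exp (2 * π * I * x)) * (1 - t i s / exp (2 * π * I * x))))⁻¹ =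
      ∑ k ∈ K, (sepProd (K.erase k) (fun i => t i s) k)⁻¹ * (Q (s, x) *
        ((1 - t k s * exp (2 * π * I * x)) * (1 - t k s / exp (2 * π * I * x)))⁻¹) := by
    intro x
    rw [prod_inv_eq_sum hK (exp_ne_zero _) ht0 ?_ fun i hi => hfac i hi x, Finset.mul_sum]
    · refine Finset.sum_congr rfl fun k _ => ?_
      rw [sepProd]
      ring
    · intro i hi j hj hij
      refine mul_ne_zero (hne1 _ _ (hlt i hi) (hlt j hj).le) (fun h => hinj i hi j hj hij ?_)
      exact (div_eq_one_iff_eq (ht0 j hj)).1 (sub_eq_zero.1 h).symm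
  simp only [hpf]
  rw [intervalIntegral.integral_finsetSum]
  · refine Finset.sum_congr rfl fun k hk => ?_
    rw [intervalIntegral.integral_const_mul, poleTerm,
      integral_mul_inv_eq_contourInt (Q := fun x => Q (s, x)) hY hQ hper heven (hlt k hk)]
  · intro k hk
    refine (Continuous.const_mul ?_ _).intervalIntegrable _ _
    have h1 : Continuous fun x : ℝ => Q (s, x) := by
      simpa using continuous_comp_add_mul_I (Q := fun x => Q (s, x)) hQ (y := 0) (by simpa using hY)
    refine h1.mul (Continuous.inv₀ ?_ fun x => hfac k hk x)
    refine Continuous.mul (by fun_prop) (continuous_const.sub ?_)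
    exact Continuous.div continuous_const (by fun_prop) fun x => exp_ne_zero _

/-- The limit of the contribution of a pole pair whose partner `σ k` pinches the contour. -/
def pinchTerm (Q : ℂ × ℂ → ℂ) (Y : ℝ) (K : Finset ι) (σ : ι → ι) (t : ι → ℂ → ℂ) (k : ι)
    (g : ℂ) : ℂ :=
  (sepProd ((K.erase k).erase (σ k)) (fun i => t i g) k)⁻¹ *
    ((1 - (t k g)⁻¹ ^ 2)⁻¹ *
      ((1 - t k g ^ 2)⁻¹ * contourInt (fun x => Q (g, x)) Y (t k g)))

/-- Terms with `k ∉ B` stay finite at `g` and are killed by the zero of `D`. For `k ∈ B` the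
denominator contains `1 - t (σ k) s * t k s`, which also vanishes at `g` and cancels against the
same factor of `D`. By `hinj` and `hsep` nothing else in the denominators vanishes. -/
theorem tendsto_sum_poleTerm (hU : IsOpen U) (hY : 0 ≤ Y)
    (hQ : ∀ s ∈ U, ∀ x : ℂ, |x.im| ≤ Y → AnalyticAt ℂ Q (s, x))
    (ht : ∀ i ∈ K, Differentiable ℂ (t i)) (ht0 : ∀ i ∈ K, ∀ s, t i s ≠ 0)
    (hlt : ∀ i ∈ K, ∀ s ∈ U, ‖t i s‖ * Real.exp (-(2 * π * Y)) < 1)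
    {g : ℂ} (hg : g ∈ U) {D Dhat : ℂ → ℂ} (hD : ContinuousAt D g) (hD0 : D g = 0)
    (hDhat : ContinuousAt Dhat g)
    {B : Finset ι} (hB : B ⊆ K) {σ : ι → ι} (hσB : ∀ k ∈ B, σ k ∈ B) (hσk : ∀ k ∈ B, σ k ≠ k)
    (hDB : ∀ k ∈ B, ∀ s, D s = Dhat s * (1 - t (σ k) s * t k s))
    (hpun : ∀ k ∈ B, ∀ᶠ s in 𝓝[≠] g, 1 - t (σ k) s * t k s ≠ 0)
    (hone : ∀ k ∈ B, t (σ k) g * t k g = 1)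
    (hinj : ∀ i ∈ K, ∀ j ∈ K, i ≠ j → t i g ≠ t j g)
    (hsep : ∀ i ∈ K, ∀ j ∈ K, t i g * t j g = 1 → j ∈ B ∧ i = σ j) :
    Tendsto (fun s => D s * ∑ k ∈ K, poleTerm Q Y K t k s) (𝓝[≠] g)
      (𝓝 (Dhat g * ∑ k ∈ B, pinchTerm Q Y K σ t k g)) := by
  have hsq : ∀ k ∈ K, 1 - t k g ^ 2 ≠ 0 := by
    intro k hk h
    -- `t k g ^ 2 = 1` would make `k` its own partner.
    obtain ⟨h1, h2⟩ := hsep k hk k hk (by linear_combination -h)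
    exact hσk k h1 h2.symm
  have hratio : ∀ i ∈ K, ∀ j ∈ K, i ≠ j → 1 - t i g / t j g ≠ 0 := by
    intro i hi j hj hij h
    exact hinj i hi j hj hij ((div_eq_one_iff_eq (ht0 j hj g)).1 (sub_eq_zero.1 h).symm)
  have hrest : ∀ k ∈ K, ContinuousAt (fun s => (1 - t k s ^ 2)⁻¹ *
      contourInt (fun x => Q (s, x)) Y (t k s)) g := by
    intro k hk
    have h1 := (analyticOnNhd_contourInt hU hY hQ (ht k hk) (hlt k hk) g hg).continuousAt
    have h2 : ContinuousAt (t k) g := (ht k hk).continuous.continuousAt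
    exact ((continuousAt_const.sub (h2.pow 2)).inv₀ (hsq k hk)).mul h1
  have hlim0 : ∀ k ∈ K \ B, Tendsto (fun s => D s * poleTerm Q Y K t k s) (𝓝[≠] g) (𝓝 0) := by
    intro k hk
    obtain ⟨hkK, hkB⟩ := Finset.mem_sdiff.1 hk
    have h1 : ContinuousAt (fun s => sepProd (K.erase k) (fun i => t i s) k) g :=
      (differentiable_sepProd ht ht0 (K.erase_subset k) hkK).continuous.continuousAt
    have h2 : sepProd (K.erase k) (fun i => t i g) k ≠ 0 := by
      refine Finset.prod_ne_zero_iff.2 fun i hi => ?_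
      obtain ⟨hik, hiK⟩ := Finset.mem_erase.1 hi
      refine mul_ne_zero (fun h => hkB ?_) (hratio i hiK k hkK hik)
      exact (hsep i hiK k hkK (sub_eq_zero.1 h).symm).1
    have h3 : ContinuousAt (fun s => D s * poleTerm Q Y K t k s) g :=
      hD.mul ((h1.inv₀ h2).mul (hrest k hkK))
    have h4 := h3.tendsto
    rw [hD0, zero_mul] at h4
    exact h4.mono_left nhdsWithin_le_nhds
  have hlim1 : ∀ k ∈ B, Tendsto (fun s => D s * poleTerm Q Y K t k s) (𝓝[≠] g)
      (𝓝 (Dhat g * pinchTerm Q Y K σ t k g)) := by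
    intro k hkB
    have hkK := hB hkB
    have hσK : σ k ∈ K.erase k := Finset.mem_erase.2 ⟨hσk k hkB, hB (hσB k hkB)⟩
    have hsub : (K.erase k).erase (σ k) ⊆ K :=
      (Finset.erase_subset _ _).trans (Finset.erase_subset _ _)
    have h1 : ContinuousAt (fun s => sepProd ((K.erase k).erase (σ k)) (fun i => t i s) k) g :=
      (differentiable_sepProd ht ht0 hsub hkK).continuous.continuousAt
    have h2 : sepProd ((K.erase k).erase (σ k)) (fun i => t i g) k ≠ 0 := by
      refine Finset.prod_ne_zero_iff.2 fun i hi => ?_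
      obtain ⟨hiσ, hi'⟩ := Finset.mem_erase.1 hi
      obtain ⟨hik, hiK⟩ := Finset.mem_erase.1 hi'
      refine mul_ne_zero (fun h => hiσ ?_) (hratio i hiK k hkK hik)
      exact (hsep i hiK k hkK (sub_eq_zero.1 h).symm).2
    have h3 : ContinuousAt (fun s => 1 - t (σ k) s / t k s) g := by
      have a1 : ContinuousAt (t (σ k)) g := (ht _ (hB (hσB k hkB))).continuous.continuousAt
      have a2 : ContinuousAt (t k) g := (ht k hkK).continuous.continuousAt
      exact continuousAt_const.sub (a1.div a2 (ht0 k hkK g))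
    have h4 : 1 - t (σ k) g / t k g ≠ 0 := hratio _ (hB (hσB k hkB)) k hkK (hσk k hkB)
    have h5 : ContinuousAt (fun s => Dhat s *
        ((sepProd ((K.erase k).erase (σ k)) (fun i => t i s) k)⁻¹ *
          ((1 - t (σ k) s / t k s)⁻¹ * ((1 - t k s ^ 2)⁻¹ *
            contourInt (fun x => Q (s, x)) Y (t k s))))) g :=
      hDhat.mul ((h1.inv₀ h2).mul ((h3.inv₀ h4).mul (hrest k hkK)))
    have h6 := h5.tendsto.mono_left (nhdsWithin_le_nhds (s := {g}ᶜ))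
    have h7 : t (σ k) g / t k g = (t k g)⁻¹ ^ 2 := by
      have := ht0 k hkK g
      have h8 := hone k hkB
      field_simp
      linear_combination h8
    rw [h7] at h6
    refine h6.congr' ?_
    filter_upwards [hpun k hkB] with s hs
    rw [poleTerm, hDB k hkB s, sepProd, sepProd, ← Finset.mul_prod_erase _ _ hσK]
    simp only [mul_inv]
    rw [show ∀ a b c d e f : ℂ, a * b * (c * d * e * f) = a * (e * (d * f)) * (b * c) by
      intros; ring, mul_inv_cancel₀ hs, mul_one]
  have h := (tendsto_finsetSum _ hlim0).add (tendsto_finsetSum _ hlim1)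
  simp only [Finset.sum_sdiff hB, Finset.sum_const_zero, zero_add] at h
  simpa only [Finset.mul_sum] using h

/-- Partners have inverse parameters, and the coefficient in front of the contour integral is
invariant under this inversion. Only the sum of the two contour integrals enters, which is a point
value: here the integral operator becomes a difference operator. -/
theorem pinchTerm_add_pinchTerm (hY : 0 ≤ Y) {g : ℂ}
    (hQ : ∀ x : ℂ, |x.im| ≤ Y → DifferentiableAt ℂ (fun x => Q (g, x)) x)
    (hper : ∀ x, Q (g, x + 1) = Q (g, x)) (heven : ∀ x, Q (g, -x) = Q (g, x)) {σ : ι → ι} {k : ι}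
    (hσ : σ (σ k) = k) (hone : t (σ k) g * t k g = 1) {x₀ : ℂ} (hx₀ : |x₀.im| < Y)
    (hx : t k g * exp (2 * π * I * x₀) = 1) :
    pinchTerm Q Y K σ t k g + pinchTerm Q Y K σ t (σ k) g =
      2 * Q (g, x₀) * (sepProd ((K.erase k).erase (σ k)) (fun i => t i g) k *
        ((1 - (t k g)⁻¹ ^ 2) * (1 - t k g ^ 2)))⁻¹ := by
  have hinv : t (σ k) g = (t k g)⁻¹ := eq_inv_of_mul_eq_one_left hone
  have hsymm : sepProd ((K.erase (σ k)).erase k) (fun i => t i g) (σ k) =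
      sepProd ((K.erase k).erase (σ k)) (fun i => t i g) k := by
    rw [Finset.erase_right_comm, sepProd, sepProd]
    refine Finset.prod_congr rfl fun i _ => ?_
    rw [hinv, div_inv_eq_mul, ← div_eq_mul_inv, mul_comm]
  have h := contourInt_add_inv (Q := fun x => Q (g, x)) hY hQ hper heven hx₀ hx
  rw [pinchTerm, pinchTerm, hσ, hsymm, hinv, inv_inv, mul_inv, mul_inv]
  linear_combination (sepProd ((K.erase k).erase (σ k)) (fun i => t i g) k)⁻¹ *
    (1 - (t k g)⁻¹ ^ 2)⁻¹ * (1 - t k g ^ 2)⁻¹ * h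

end Continuation

/-! ### The kernel of the integral operator -/

/-- The lattice point `aτ + b(2η)`. -/
def latPoint (τ η : ℂ) (j : ℕ × ℕ) : ℂ := j.1 * τ + j.2 * (2 * η)

/-- The number `p^a q^b`. -/
def latExp (τ η : ℂ) (j : ℕ × ℕ) : ℂ := exp (2 * π * I * latPoint τ η j)

/-- The product of `1 - w p^a q^b` over the pairs `(a, b) ∉ J`. -/
def tailProd (τ η : ℂ) (J : Finset (ℕ × ℕ)) (w : ℂ) : ℂ :=
  prodOneSub (fun j => if j ∈ J then 0 else latExp τ η j) w

/-- The double product `∏ (1 - w p^a q^b)`. -/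
def fullProd (τ η w : ℂ) : ℂ := pqProd (exp (2 * π * I * τ)) (exp (4 * π * I * η)) w

/-- The elliptic gamma function without the poles with label in `J`. -/
def gammaTail (τ η : ℂ) (J : Finset (ℕ × ℕ)) (y : ℂ) : ℂ :=
  fullProd τ η (exp (2 * π * I * (τ + 2 * η - y))) / tailProd τ η J (exp (2 * π * I * y))

/-- The function `1 / (Γ(y) Γ(-y))`. -/
def thetaFactor (τ η y : ℂ) : ℂ :=
  -(constR τ * theta1 y τ * (constR (2 * η) * theta1 y (2 * η)))

section

variable {τ η : ℂ}

theorem latExp_eq (j : ℕ × ℕ) :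
    latExp τ η j = exp (2 * π * I * τ) ^ j.1 * exp (4 * π * I * η) ^ j.2 := by
  rw [latExp, latPoint, ← exp_nat_mul, ← exp_nat_mul, ← exp_add]
  congr 1; ring

theorem fullProd_eq (w : ℂ) : fullProd τ η w = prodOneSub (latExp τ η) w := by
  rw [fullProd, pqProd]
  congr 1; ext j; rw [latExp_eq]

theorem summable_norm_latExp (hτ : 0 < τ.im) (hη : 0 < η.im) :
    Summable fun j => ‖latExp τ η j‖ := by
  simp only [latExp_eq]
  exact summable_norm_pow_mul_pow (norm_exp_two_pi_I_mul_lt_one hτ)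
    (norm_exp_four_pi_I_mul_lt_one hη)

theorem fullProd_split (hτ : 0 < τ.im) (hη : 0 < η.im) (J : Finset (ℕ × ℕ)) (w : ℂ) :
    fullProd τ η w = (∏ j ∈ J, (1 - w * latExp τ η j)) * tailProd τ η J w := by
  rw [fullProd_eq]
  exact prodOneSub_split (summable_norm_latExp hτ hη) J w

theorem differentiable_fullProd (hτ : 0 < τ.im) (hη : 0 < η.im) :
    Differentiable ℂ (fullProd τ η) :=
  differentiable_pqProd (norm_exp_two_pi_I_mul_lt_one hτ) (norm_exp_four_pi_I_mul_lt_one hη)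

theorem differentiable_tailProd (hτ : 0 < τ.im) (hη : 0 < η.im) (J : Finset (ℕ × ℕ)) :
    Differentiable ℂ (tailProd τ η J) :=
  differentiable_prodOneSub (summable_norm_ite (summable_norm_latExp hτ hη))

theorem fullProd_ne_zero (hτ : 0 < τ.im) (hη : 0 < η.im) {w : ℂ} (hw : ‖w‖ < 1) :
    fullProd τ η w ≠ 0 :=
  pqProd_ne_zero (norm_exp_two_pi_I_mul_lt_one hτ) (norm_exp_four_pi_I_mul_lt_one hη) hw

theorem fullProd_ne_zero_of_im_pos (hτ : 0 < τ.im) (hη : 0 < η.im) {y : ℂ} (hy : 0 < y.im) :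
    fullProd τ η (exp (2 * π * I * y)) ≠ 0 :=
  fullProd_ne_zero hτ hη (norm_exp_two_pi_I_mul_lt_one hy)

theorem tailProd_ne_zero (hτ : 0 < τ.im) (hη : 0 < η.im) {J : Finset (ℕ × ℕ)} {w : ℂ}
    (hw : ∀ j ∉ J, ‖w‖ * ‖latExp τ η j‖ < 1) : tailProd τ η J w ≠ 0 := by
  intro h
  obtain ⟨j, hj⟩ :=
    (prodOneSub_eq_zero_iff (summable_norm_ite (summable_norm_latExp hτ hη)) w).1 h
  by_cases hJ : j ∈ J
  · simp [hJ] at hj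
  · rw [if_neg hJ] at hj
    have h1 := hw j hJ
    rw [← norm_mul, hj, norm_one] at h1
    exact lt_irrefl _ h1

theorem ellGamma_eq_fullProd (hτ : 0 < τ.im) (hη : 0 < η.im) (y : ℂ) :
    ellGamma τ η y =
      fullProd τ η (exp (2 * π * I * (τ + 2 * η - y))) / fullProd τ η (exp (2 * π * I * y)) := by
  rw [ellGamma_eq hτ hη, fullProd, fullProd, ← exp_add, ← exp_add]
  congr 3; ring_nf

theorem ellGamma_eq_gammaTail (hτ : 0 < τ.im) (hη : 0 < η.im) (J : Finset (ℕ × ℕ)) (y : ℂ) :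
    ellGamma τ η y =
      gammaTail τ η J y * (∏ j ∈ J, (1 - exp (2 * π * I * y) * latExp τ η j))⁻¹ := by
  rw [ellGamma_eq_fullProd hτ hη, fullProd_split hτ hη J (exp (2 * π * I * y)), gammaTail,
    ← div_eq_mul_inv, div_div, mul_comm (tailProd _ _ _ _)]

theorem modTheta_inv {p : ℂ} (hp : ‖p‖ < 1) {w : ℂ} (hw : w ≠ 0) :
    modTheta p w⁻¹ = -w⁻¹ * modTheta p w := by
  rw [modTheta, modTheta, qProd_eq hp w⁻¹, qProd_eq hp w, div_inv_eq_mul, div_eq_mul_inv]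
  field_simp
  ring

theorem thetaFactor_eq (hτ : 0 < τ.im) (hη : 0 < η.im) (y : ℂ) :
    thetaFactor τ η y = -(exp (2 * π * I * y))⁻¹ *
      (modTheta (exp (2 * π * I * τ)) (exp (2 * π * I * y)) *
        modTheta (exp (4 * π * I * η)) (exp (2 * π * I * y))) := by
  rw [thetaFactor, constR_mul_theta1 hτ, constR_mul_theta1 (by simpa using hη : 0 < (2 * η).im),
    show 2 * (π : ℂ) * I * (2 * η) = 4 * π * I * η by ring,
    show (exp (2 * π * I * y))⁻¹ = exp (-(π * I * y)) * exp (-(π * I * y)) by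
      rw [← exp_neg, ← exp_add]; congr 1; ring]
  ring

theorem differentiable_thetaFactor (hτ : 0 < τ.im) (hη : 0 < η.im) :
    Differentiable ℂ (thetaFactor τ η) := by
  have hp := differentiable_qProd (norm_exp_two_pi_I_mul_lt_one hτ)
  have hq := differentiable_qProd (norm_exp_four_pi_I_mul_lt_one hη)
  have h1 : Differentiable ℂ fun y : ℂ => exp (2 * π * I * y) := by fun_prop
  have h0 : ∀ y : ℂ, exp (2 * π * I * y) ≠ 0 := fun y => exp_ne_zero _
  have h2 : ∀ c : ℂ, Differentiable ℂ fun y : ℂ => c / exp (2 * π * I * y) := fun c =>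
    (differentiable_const c).div h1 h0
  rw [funext (thetaFactor_eq hτ hη)]
  unfold modTheta
  exact (h1.inv h0).neg.mul (((hp.comp h1).mul (hp.comp (h2 _))).mul
    ((hq.comp h1).mul (hq.comp (h2 _))))

theorem thetaFactor_neg (y : ℂ) : thetaFactor τ η (-y) = thetaFactor τ η y := by
  rw [thetaFactor, thetaFactor, theta1_neg, theta1_neg]
  ring

theorem thetaFactor_add_one (hτ : 0 < τ.im) (hη : 0 < η.im) (y : ℂ) :
    thetaFactor τ η (y + 1) = thetaFactor τ η y := by
  rw [thetaFactor_eq hτ hη, thetaFactor_eq hτ hη, exp_two_pi_I_add_one]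

/-- The shift relations cancel the double products down to one theta product in `p` and one in `q`.
Poles of `Γ(±y)` are allowed: the value `0` given to `Γ` there makes the left-hand side `0`, and the
theta product vanishes too. This matters at `y = 2x` on the contour. -/
theorem inv_ellGamma_mul_ellGamma_neg (hτ : 0 < τ.im) (hη : 0 < η.im) {y : ℂ}
    (h1 : fullProd τ η (exp (2 * π * I * (τ + 2 * η + y))) ≠ 0)
    (h2 : fullProd τ η (exp (2 * π * I * (τ + 2 * η - y))) ≠ 0) :
    (ellGamma τ η y * ellGamma τ η (-y))⁻¹ = thetaFactor τ η y := by
  have hp := norm_exp_two_pi_I_mul_lt_one hτ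
  have hq := norm_exp_four_pi_I_mul_lt_one hη
  have hv0 : exp (2 * π * I * y) ≠ 0 := exp_ne_zero _
  rw [fullProd, show exp (2 * π * I * (τ + 2 * η + y)) = exp (2 * π * I * τ) *
    exp (4 * π * I * η) * exp (2 * π * I * y) by simp only [← exp_add]; congr 1; ring] at h1
  rw [fullProd, show exp (2 * π * I * (τ + 2 * η - y)) = exp (2 * π * I * τ) *
    exp (4 * π * I * η) * (exp (2 * π * I * y))⁻¹ by
      rw [← exp_neg]; simp only [← exp_add]; congr 1; ring] at h2
  rw [thetaFactor_eq hτ hη, ellGamma_eq hτ hη, ellGamma_eq hτ hη, mul_neg, neg_neg, exp_neg]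
  set p := exp (2 * π * I * τ)
  set q := exp (4 * π * I * η)
  set v := exp (2 * π * I * y)
  have e1 : pqProd p q v = qProd p v * (qProd q (q * v) * pqProd p q (p * q * v)) := by
    rw [pqProd_eq_right hp hq v, pqProd_eq_left hp hq (q * v), mul_assoc p q v]
  have e2 : pqProd p q v⁻¹ = qProd q v⁻¹ * (qProd p (p * v⁻¹) * pqProd p q (p * q * v⁻¹)) := by
    rw [pqProd_eq_left hp hq v⁻¹, pqProd_eq_right hp hq (p * v⁻¹)]
    ring_nf
  have e3 := modTheta_inv hq hv0
  have e4 : modTheta q v⁻¹ = qProd q v⁻¹ * qProd q (q * v) := by rw [modTheta, div_inv_eq_mul]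
  rw [show ∀ a b : ℂ, -v⁻¹ * (a * b) = a * (-v⁻¹ * b) by intros; ring, ← e3, e4, modTheta, e1, e2,
    div_eq_mul_inv p v]
  generalize pqProd p q (p * q * v⁻¹) = c at *
  generalize pqProd p q (p * q * v) = d at *
  field_simp

end

/-! ### The continuation -/

/-- The exponents of the poles: `±z + aτ + b(2η)`. -/
def poleShift (τ η z : ℂ) (κ : Bool × ℕ × ℕ) : ℂ :=
  (if κ.1 then z else -z) + latPoint τ η κ.2

/-- The poles, as functions of the spectral parameter. -/
def poleVar (τ η z : ℂ) (κ : Bool × ℕ × ℕ) (s : ℂ) : ℂ :=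
  exp (2 * π * I * (poleShift τ η z κ - s))

/-- The partner with which a pole pinches the contour. -/
def polePartner (n m : ℕ) (κ : Bool × ℕ × ℕ) : Bool × ℕ × ℕ := (!κ.1, m - κ.2.1, n - κ.2.2)

/-- The labels of the pinching poles. -/
def pinchBox (n m : ℕ) : Finset (ℕ × ℕ) := Finset.range (m + 1) ×ˢ Finset.range (n + 1)

/-- The regular part of the integrand. -/
def kernelQ (τ η z : ℂ) (J : Finset (ℕ × ℕ)) (Φ : ℂ → ℂ) (y : ℂ × ℂ) : ℂ :=
  thetaFactor τ η (2 * y.2) *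
    (gammaTail τ η J (z + y.2 - y.1) * gammaTail τ η J (z - y.2 - y.1) *
      gammaTail τ η J (-z + y.2 - y.1) * gammaTail τ η J (-z - y.2 - y.1)) * Φ y.2

/-- The prefactor of the integral, which contains `1 / Γ(-2s)`. -/
def prefactor (τ η s : ℂ) : ℂ :=
  qPoch (2 * η) * qPoch τ / 2 *
    (fullProd τ η (exp (2 * π * I * (-2 * s))) /
      fullProd τ η (exp (2 * π * I * (τ + 2 * η - -2 * s))))

/-- The prefactor without the factor that vanishes at `nη + mτ/2`. -/
def prefactorHat (τ η : ℂ) (n m : ℕ) (s : ℂ) : ℂ :=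
  qPoch (2 * η) * qPoch τ / 2 *
    (tailProd τ η {(m, n)} (exp (2 * π * I * (-2 * s))) /
      fullProd τ η (exp (2 * π * I * (τ + 2 * η - -2 * s))))

section

variable {τ η z : ℂ} {J : Finset (ℕ × ℕ)} {Φ : ℂ → ℂ}

theorem latPoint_im_nonneg (hτ : 0 < τ.im) (hη : 0 < η.im) (j : ℕ × ℕ) :
    0 ≤ (latPoint τ η j).im := by
  have : (latPoint τ η j).im = j.1 * τ.im + j.2 * (2 * η.im) := by simp [latPoint]
  rw [this]
  positivity

theorem exp_mul_latExp (y : ℂ) (j : ℕ × ℕ) :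
    exp (2 * π * I * y) * latExp τ η j = exp (2 * π * I * (y + latPoint τ η j)) := by
  rw [latExp, ← exp_add, ← mul_add]

theorem poleVar_mul_exp (κ : Bool × ℕ × ℕ) (s x : ℂ) :
    poleVar τ η z κ s * exp (2 * π * I * x) =
      exp (2 * π * I * ((if κ.1 then z else -z) + x - s)) * latExp τ η κ.2 := by
  rw [exp_mul_latExp, poleVar, poleShift, ← exp_add]
  congr 1; ring

theorem poleVar_div_exp (κ : Bool × ℕ × ℕ) (s x : ℂ) :
    poleVar τ η z κ s / exp (2 * π * I * x) =
      exp (2 * π * I * ((if κ.1 then z else -z) - x - s)) * latExp τ η κ.2 := by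
  rw [exp_mul_latExp, poleVar, poleShift, ← exp_sub]
  congr 1; ring

theorem poleVar_mul_poleVar (κ κ' : Bool × ℕ × ℕ) (s : ℂ) :
    poleVar τ η z κ s * poleVar τ η z κ' s =
      exp (2 * π * I * (poleShift τ η z κ + poleShift τ η z κ' - 2 * s)) := by
  rw [poleVar, poleVar, ← exp_add]
  congr 1; ring

/-- Labels with equal signs of `z` are separated by incommensurability; opposite signs would put
`2z` into the lattice. -/
theorem poleShift_injective (hinc : Incommensurable τ η)
    (hz : ∀ a b c : ℤ, 2 * z ≠ a + b * τ + c * (2 * η)) {κ κ' : Bool × ℕ × ℕ} {a : ℤ}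
    (h : poleShift τ η z κ = poleShift τ η z κ' + a) : κ = κ' := by
  obtain ⟨e, i, j⟩ := κ
  obtain ⟨e', i', j'⟩ := κ'
  have key : (i : ℂ) * τ + j * (2 * η) = i' * τ + j' * (2 * η) + a → i = i' ∧ j = j' := by
    intro h1
    obtain ⟨-, h2, h3⟩ := hinc (-a) (i - i') (j - j') (by push_cast; linear_combination h1)
    omega
  cases e <;> cases e' <;> simp only [poleShift, latPoint, if_true, Bool.false_eq_true, if_false] at h
  · obtain ⟨rfl, rfl⟩ := key (by linear_combination h); rfl
  · exact absurd (by push_cast; linear_combination -h) (hz (-a) (i - i') (j - j'))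
  · exact absurd (by push_cast; linear_combination h) (hz a (i' - i) (j' - j))
  · obtain ⟨rfl, rfl⟩ := key (by linear_combination h); rfl

theorem poleVar_injective (hinc : Incommensurable τ η)
    (hz : ∀ a b c : ℤ, 2 * z ≠ a + b * τ + c * (2 * η)) {κ κ' : Bool × ℕ × ℕ} {s : ℂ}
    (h : poleVar τ η z κ s = poleVar τ η z κ' s) : κ = κ' := by
  rw [poleVar, poleVar, exp_eq_exp_iff_exists_int] at h
  obtain ⟨a, ha⟩ := h
  refine poleShift_injective hinc hz (a := a) ?_
  have : (2 * π * I : ℂ) * (poleShift τ η z κ - (poleShift τ η z κ' + a)) = 0 := by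
    linear_combination ha
  exact sub_eq_zero.1 ((mul_eq_zero.1 this).resolve_left two_pi_I_ne_zero)

/-- Poles with the same sign of `z` cannot pinch, since `2z` is not in the lattice. With opposite
signs the lattice indices must add up to `(m, n)`, which leaves finitely many pairs. -/
theorem eq_polePartner_of_mul_eq_one (hinc : Incommensurable τ η)
    (hz : ∀ a b c : ℤ, 2 * z ≠ a + b * τ + c * (2 * η)) {n m : ℕ} {κ κ' : Bool × ℕ × ℕ}
    (h : poleVar τ η z κ (n * η + m * (τ / 2)) * poleVar τ η z κ' (n * η + m * (τ / 2)) = 1) :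
    κ'.2 ∈ pinchBox n m ∧ κ = polePartner n m κ' := by
  rw [poleVar_mul_poleVar] at h
  obtain ⟨a, ha⟩ := exp_two_pi_I_mul_eq_one h
  obtain ⟨e, i, j⟩ := κ
  obtain ⟨e', i', j'⟩ := κ'
  have key : (i : ℂ) * τ + j * (2 * η) + (i' * τ + j' * (2 * η)) - (m * τ + n * (2 * η)) = a →
      (i' < m + 1 ∧ j' < n + 1) ∧ i = m - i' ∧ j = n - j' := by
    intro h1
    obtain ⟨-, h2, h3⟩ := hinc (-a) (i + i' - m) (j + j' - n) (by
      push_cast; linear_combination h1)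
    omega
  simp only [pinchBox, polePartner, Finset.mem_product, Finset.mem_range, Prod.mk.injEq]
  cases e <;> cases e' <;>
    simp only [poleShift, latPoint, if_true, Bool.false_eq_true, if_false] at ha
  · exact absurd (by push_cast; linear_combination -ha) (hz (-a) (i + i' - m) (j + j' - n))
  · exact ⟨(key (by linear_combination ha)).1, by simp, (key (by linear_combination ha)).2⟩
  · exact ⟨(key (by linear_combination ha)).1, by simp, (key (by linear_combination ha)).2⟩
  · exact absurd (by push_cast; linear_combination ha) (hz a (m - i - i') (n - j - j'))

theorem poleShift_polePartner_add {n m : ℕ} {κ : Bool × ℕ × ℕ} (hκ : κ.2 ∈ pinchBox n m) :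
    poleShift τ η z (polePartner n m κ) + poleShift τ η z κ = m * τ + n * (2 * η) := by
  obtain ⟨e, i, j⟩ := κ
  simp only [pinchBox, Finset.mem_product, Finset.mem_range] at hκ
  have h1 : ((m - i : ℕ) : ℂ) = m - i := by rw [Nat.cast_sub (by omega)]
  have h2 : ((n - j : ℕ) : ℂ) = n - j := by rw [Nat.cast_sub (by omega)]
  cases e <;> simp only [polePartner, poleShift, latPoint, h1, h2, Bool.not_true, Bool.not_false,
    if_true, Bool.false_eq_true, if_false] <;> ring

theorem poleVar_polePartner_mul {n m : ℕ} {κ : Bool × ℕ × ℕ} (hκ : κ.2 ∈ pinchBox n m) (s : ℂ) :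
    poleVar τ η z (polePartner n m κ) s * poleVar τ η z κ s =
      exp (2 * π * I * (-2 * s)) * latExp τ η (m, n) := by
  rw [poleVar_mul_poleVar, poleShift_polePartner_add hκ, exp_mul_latExp, latPoint]
  congr 1; ring

theorem polePartner_polePartner {n m : ℕ} {κ : Bool × ℕ × ℕ} (hκ : κ.2 ∈ pinchBox n m) :
    polePartner n m (polePartner n m κ) = κ := by
  obtain ⟨e, i, j⟩ := κ
  simp only [pinchBox, Finset.mem_product, Finset.mem_range] at hκ
  simp only [polePartner, Bool.not_not, Prod.mk.injEq, true_and]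
  omega

theorem polePartner_mem {n m : ℕ} (κ : Bool × ℕ × ℕ) :
    (polePartner n m κ).2 ∈ pinchBox n m := by
  simp only [pinchBox, polePartner, Finset.mem_product, Finset.mem_range]
  omega

/-- The product of partners equals `e^{-4πis} p^m q^n` for every pair, so the single zero of
`1/Γ(-2s)` at `nη + mτ/2` compensates all pinchings at once. -/
theorem prefactor_eq (hτ : 0 < τ.im) (hη : 0 < η.im) {n m : ℕ} {κ : Bool × ℕ × ℕ}
    (hκ : κ.2 ∈ pinchBox n m) (s : ℂ) :
    prefactor τ η s = prefactorHat τ η n m s *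
      (1 - poleVar τ η z (polePartner n m κ) s * poleVar τ η z κ s) := by
  rw [poleVar_polePartner_mul hκ, prefactor, prefactorHat,
    fullProd_split hτ hη {(m, n)} (exp (2 * π * I * (-2 * s))), Finset.prod_singleton]
  ring

theorem intertwinerIntegral_eq (hτ : 0 < τ.im) (hη : 0 < η.im) (s : ℂ) :
    intertwinerIntegral τ η s Φ z = prefactor τ η s *
      ∫ x in (0 : ℝ)..1, kernelQ τ η z J Φ (s, x) *
        (∏ κ ∈ (Finset.univ : Finset Bool) ×ˢ J, ((1 - poleVar τ η z κ s * exp (2 * π * I * x)) *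
          (1 - poleVar τ η z κ s / exp (2 * π * I * x))))⁻¹ := by
  rw [intertwinerIntegral, prefactor, mul_assoc, ← inv_div (fullProd _ _ _),
    ← ellGamma_eq_fullProd hτ hη]
  refine congrArg _ ?_
  rw [← intervalIntegral.integral_const_mul]
  refine intervalIntegral.integral_congr fun x _ => ?_
  have h := inv_ellGamma_mul_ellGamma_neg hτ hη (y := 2 * x)
    (fullProd_ne_zero_of_im_pos hτ hη (by simp; linarith))
    (fullProd_ne_zero_of_im_pos hτ hη (by simp; linarith))
  simp only [kernelQ, ← h, poleVar_mul_exp, poleVar_div_exp, Finset.prod_product,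
    Fintype.prod_bool, Finset.prod_mul_distrib, if_true, Bool.false_eq_true, if_false,
    ellGamma_eq_gammaTail hτ hη J (_ - s), neg_mul]
  simp only [mul_inv, div_eq_mul_inv]
  ring

end

/-! ### The value of the continuation -/

/-- The quotient `P(p^{a+1} q^{b+1}) / P̂(p^{-a} q^{-b})`, where `P̂` lacks the factor that
vanishes. -/
def gridRes (τ η : ℂ) (j : ℕ × ℕ) : ℂ :=
  fullProd τ η (exp (2 * π * I * (τ + 2 * η + latPoint τ η j))) /
    tailProd τ η {j} (exp (2 * π * I * -latPoint τ η j))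

/-- The coefficient with which a pair of pinching poles contributes. -/
def pinchCoeff (τ η : ℂ) (n m : ℕ) (j : ℕ × ℕ) (z : ℂ) : ℂ :=
  qPoch (2 * η) * qPoch τ *
    (gridRes τ η j * gridRes τ η (m - j.1, n - j.2) / gridRes τ η (m, n)) *
    thetaFactor τ η (2 * (n * η + m * (τ / 2) - z - latPoint τ η j)) *
    (ellGamma τ η (2 * z - latPoint τ η (m - j.1, n - j.2)) *
      ellGamma τ η (-(2 * z) - latPoint τ η j))

section

variable {τ η z : ℂ} {J : Finset (ℕ × ℕ)} {Φ : ℂ → ℂ}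

theorem tailProd_singleton (hτ : 0 < τ.im) (hη : 0 < η.im) {j : ℕ × ℕ} (hj : j ∈ J) (w : ℂ) :
    tailProd τ η {j} w = (∏ i ∈ J.erase j, (1 - w * latExp τ η i)) * tailProd τ η J w := by
  rw [tailProd, prodOneSub_split (summable_norm_ite (summable_norm_latExp hτ hη)) J, tailProd]
  congr 1
  · rw [← Finset.mul_prod_erase _ _ hj]
    simp only [Finset.mem_singleton, if_true, mul_zero, sub_zero, one_mul]
    refine Finset.prod_congr rfl fun i hi => ?_
    rw [if_neg (Finset.ne_of_mem_erase hi)]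
  · congr 1; ext i
    by_cases hi : i ∈ J
    · simp [hi]
    · have : i ≠ j := fun h => hi (h ▸ hj)
      simp [hi, this]

theorem gammaTail_mul_eq_gridRes (hτ : 0 < τ.im) (hη : 0 < η.im) {j : ℕ × ℕ} (hj : j ∈ J) {y : ℂ}
    (hy : y = -latPoint τ η j) :
    gammaTail τ η J y * (∏ i ∈ J.erase j, (1 - exp (2 * π * I * y) * latExp τ η i))⁻¹ =
      gridRes τ η j := by
  rw [gammaTail, gridRes, hy, tailProd_singleton hτ hη hj, ← div_eq_mul_inv, div_div,
    mul_comm (tailProd _ _ _ _), sub_neg_eq_add]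

/-- The factors `1 - t l / t k` and `1 - t k ^ 2` fill the gaps of `sepProd`. The result contains
every pole factor except, in each product, the one that vanishes at the pinching point, as required
to complete the truncated gamma functions. -/
theorem sepProd_mul {ι : Type*} [DecidableEq ι] {K : Finset ι} {t : ι → ℂ} {k l : ι} (hk : k ∈ K)
    (hl : l ∈ K) (hkl : l ≠ k) :
    sepProd ((K.erase k).erase l) t k * ((1 - t l / t k) * (1 - t k ^ 2)) =
      (∏ i ∈ K.erase l, (1 - t i * t k)) * ∏ i ∈ K.erase k, (1 - t i / t k) := by
  rw [sepProd, Finset.prod_mul_distrib,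
    ← Finset.mul_prod_erase (K.erase k) _ (Finset.mem_erase.2 ⟨hkl, hl⟩),
    ← Finset.mul_prod_erase (K.erase l) _ (Finset.mem_erase.2 ⟨hkl.symm, hk⟩),
    Finset.erase_right_comm]
  ring

theorem prod_erase_univ_product {ι : Type*} [DecidableEq ι] (J : Finset ι) (e : Bool) (j : ι)
    (f : Bool × ι → ℂ) :
    ∏ i ∈ ((Finset.univ : Finset Bool) ×ˢ J).erase (e, j), f i =
      (∏ i ∈ J.erase j, f (e, i)) * ∏ i ∈ J, f (!e, i) := by
  have h : ((Finset.univ : Finset Bool) ×ˢ J).erase (e, j) =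
      ({e} ×ˢ J.erase j) ∪ ({!e} ×ˢ J) := by
    ext ⟨d, i⟩
    cases d <;> cases e <;> simp
  rw [h, Finset.prod_union, Finset.prod_product, Finset.prod_product, Finset.prod_singleton,
    Finset.prod_singleton]
  rw [Finset.disjoint_left]
  rintro ⟨d, i⟩
  cases d <;> cases e <;> simp

/-- The finite products complete the four functions `gammaTail` at `x₀`. Two of them sit at a pole
of `Γ` and give `gridRes`; the other two become values of `Γ`. The auxiliary set `J` thereby
disappears, and the `2` from the pair cancels the `1/2` of the prefactor. -/
theorem prefactorHat_mul_eq_pinchCoeff (hτ : 0 < τ.im) (hη : 0 < η.im) {n m : ℕ} {j : ℕ × ℕ}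
    (hbox : pinchBox n m ⊆ J) (hj : j ∈ pinchBox n m) :
    let g := n * η + m * (τ / 2)
    let K := (Finset.univ : Finset Bool) ×ˢ J
    let κ := (true, j)
    let x₀ := g - z - latPoint τ η j
    prefactorHat τ η n m g * (2 * kernelQ τ η z J Φ (g, x₀) *
      (sepProd ((K.erase κ).erase (polePartner n m κ)) (fun i => poleVar τ η z i g) κ *
        ((1 - (poleVar τ η z κ g)⁻¹ ^ 2) * (1 - poleVar τ η z κ g ^ 2)))⁻¹) =
      pinchCoeff τ η n m j z * Φ x₀ := by
  intro g K κ x₀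
  have hj' : (m - j.1, n - j.2) ∈ J := hbox (polePartner_mem (n := n) (m := m) κ)
  have hκ : κ ∈ K := Finset.mem_product.2 ⟨Finset.mem_univ _, hbox hj⟩
  have hκ' : polePartner n m κ ∈ K := Finset.mem_product.2 ⟨Finset.mem_univ _, hj'⟩
  have hne : polePartner n m κ ≠ κ := fun h => by simpa [polePartner, κ] using congrArg Prod.fst h
  have h2g : 2 * g = latPoint τ η (m, n) := by simp only [g, latPoint]; ring
  have hone : poleVar τ η z (polePartner n m κ) g * poleVar τ η z κ g = 1 := by
    rw [poleVar_polePartner_mul hj, exp_mul_latExp, ← h2g]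
    simp
  have hκ0 : poleVar τ η z κ g ≠ 0 := exp_ne_zero _
  have hκx : poleVar τ η z κ g = exp (2 * π * I * -x₀) := by
    rw [poleVar, poleShift]
    simp only [κ, if_true, x₀]
    congr 1; ring
  have hdiv : (poleVar τ η z κ g)⁻¹ ^ 2 = poleVar τ η z (polePartner n m κ) g / poleVar τ η z κ g := by
    field_simp
    linear_combination -hone
  have hpair : latPoint τ η (m - j.1, n - j.2) = 2 * g - latPoint τ η j := by
    have := poleShift_polePartner_add (τ := τ) (η := η) (z := z) (κ := κ) hj
    simp only [poleShift, polePartner, κ, Bool.not_true, if_true, Bool.false_eq_true, if_false] at this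
    rw [h2g, latPoint, latPoint, latPoint] at *
    linear_combination this
  rw [hdiv, sepProd_mul hκ hκ' hne, hκx]
  have e1 : ∀ i, poleVar τ η z i g * exp (2 * π * I * -x₀) =
      exp (2 * π * I * ((if i.1 then z else -z) - x₀ - g)) * latExp τ η i.2 := fun i => by
    rw [poleVar_mul_exp]; ring_nf
  have e2 : ∀ i, poleVar τ η z i g / exp (2 * π * I * -x₀) =
      exp (2 * π * I * ((if i.1 then z else -z) + x₀ - g)) * latExp τ η i.2 := fun i => by
    rw [poleVar_div_exp]; ring_nf
  simp only [e1, e2]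
  rw [show polePartner n m κ = (false, (m - j.1, n - j.2)) from rfl, prod_erase_univ_product,
    prod_erase_univ_product]
  simp only [Bool.not_true, Bool.not_false, if_true, Bool.false_eq_true, if_false]
  have k1 := gammaTail_mul_eq_gridRes hτ hη (hbox hj) (y := z + x₀ - g) (by simp only [x₀]; ring)
  have k2 := gammaTail_mul_eq_gridRes hτ hη hj' (y := -z - x₀ - g) (by
    rw [hpair]; simp only [x₀]; ring)
  have k3 := ellGamma_eq_gammaTail hτ hη J (z - x₀ - g)
  have k4 := ellGamma_eq_gammaTail hτ hη J (-z + x₀ - g)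
  have k5 : prefactorHat τ η n m g = qPoch (2 * η) * qPoch τ / 2 * (gridRes τ η (m, n))⁻¹ := by
    rw [prefactorHat, gridRes, inv_div, ← h2g]
    congr 6 <;> ring
  rw [pinchCoeff, kernelQ, k5, ← k1, ← k2,
    show 2 * (n * η + m * (τ / 2) - z - latPoint τ η j) = 2 * x₀ from rfl,
    show 2 * z - latPoint τ η (m - j.1, n - j.2) = z - x₀ - g by rw [hpair]; simp only [x₀]; ring,
    show -(2 * z) - latPoint τ η j = -z + x₀ - g by simp only [x₀]; ring, k3, k4]
  simp only [mul_inv, div_eq_mul_inv]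
  ring

theorem kernelQ_add_one (hτ : 0 < τ.im) (hη : 0 < η.im) (hΦ : ∀ x, Φ (x + 1) = Φ x) (s x : ℂ) :
    kernelQ τ η z J Φ (s, x + 1) = kernelQ τ η z J Φ (s, x) := by
  have h1 : ∀ y, gammaTail τ η J (y + 1) = gammaTail τ η J y := fun y => by
    rw [gammaTail, gammaTail, exp_two_pi_I_add_one, ← exp_two_pi_I_add_one (τ + 2 * η - (y + 1))]
    ring_nf
  have h2 : ∀ y, gammaTail τ η J (y - 1) = gammaTail τ η J y := fun y => by
    rw [← h1 (y - 1), sub_add_cancel]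
  simp only [kernelQ]
  rw [hΦ, show 2 * (x + 1) = 2 * x + 1 + 1 by ring, thetaFactor_add_one hτ hη,
    thetaFactor_add_one hτ hη, show z + (x + 1) - s = z + x - s + 1 by ring,
    show z - (x + 1) - s = z - x - s - 1 by ring, show -z + (x + 1) - s = -z + x - s + 1 by ring,
    show -z - (x + 1) - s = -z - x - s - 1 by ring, h1, h1, h2, h2]

theorem kernelQ_neg (hΦ : ∀ x, Φ (-x) = Φ x) (s x : ℂ) :
    kernelQ τ η z J Φ (s, -x) = kernelQ τ η z J Φ (s, x) := by
  simp only [kernelQ]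
  rw [hΦ, mul_neg, thetaFactor_neg, sub_neg_eq_add, sub_neg_eq_add, ← sub_eq_add_neg,
    ← sub_eq_add_neg]
  ring

theorem analyticAt_kernelQ (hτ : 0 < τ.im) (hη : 0 < η.im) (hΦ : Differentiable ℂ Φ) {c Y : ℝ}
    (hJ : ∀ j ∉ J, Real.exp (2 * π * (c + |z.im| + Y)) * ‖latExp τ η j‖ < 1) {s x : ℂ}
    (hs : s.im < c) (hx : |x.im| ≤ Y) : AnalyticAt ℂ (kernelQ τ η z J Φ) (s, x) := by
  have hx := abs_le.1 hx
  have hz1 := neg_abs_le z.im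
  have hz2 := le_abs_self z.im
  have hG : ∀ (y : ℂ), -(c + |z.im| + Y) ≤ y.im → AnalyticAt ℂ (gammaTail τ η J) y := by
    intro y hy
    have h0 : tailProd τ η J (exp (2 * π * I * y)) ≠ 0 := by
      refine tailProd_ne_zero hτ hη fun j hj => ?_
      refine lt_of_le_of_lt ?_ (hJ j hj)
      rw [norm_exp_two_pi_I_mul]
      gcongr
      nlinarith [Real.pi_pos]
    unfold gammaTail
    have d1 : Differentiable ℂ fun y : ℂ => fullProd τ η (exp (2 * π * I * (τ + 2 * η - y))) :=
      (differentiable_fullProd hτ hη).comp (by fun_prop)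
    have d2 : Differentiable ℂ fun y : ℂ => tailProd τ η J (exp (2 * π * I * y)) :=
      (differentiable_tailProd hτ hη J).comp (by fun_prop)
    exact (d1.analyticAt y).fun_div (d2.analyticAt y) h0
  have c1 : AnalyticAt ℂ (fun y : ℂ × ℂ => y.1) (s, x) := analyticAt_fst
  have c2 : AnalyticAt ℂ (fun y : ℂ × ℂ => y.2) (s, x) := analyticAt_snd
  have t1 : AnalyticAt ℂ (fun y : ℂ × ℂ => thetaFactor τ η (2 * y.2)) (s, x) :=
    ((differentiable_thetaFactor hτ hη).analyticAt (2 * x)).fun_comp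
      (f := fun y : ℂ × ℂ => 2 * y.2) (analyticAt_const.mul c2)
  have t2 : AnalyticAt ℂ (fun y : ℂ × ℂ => Φ y.2) (s, x) :=
    (hΦ.analyticAt x).fun_comp (f := fun y : ℂ × ℂ => y.2) c2
  have g1 : AnalyticAt ℂ (fun y : ℂ × ℂ => gammaTail τ η J (z + y.2 - y.1)) (s, x) :=
    (hG (z + x - s) (by simp only [add_im, sub_im]; linarith)).fun_comp
      (f := fun y : ℂ × ℂ => z + y.2 - y.1) ((analyticAt_const.add c2).sub c1)
  have g2 : AnalyticAt ℂ (fun y : ℂ × ℂ => gammaTail τ η J (z - y.2 - y.1)) (s, x) :=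
    (hG (z - x - s) (by simp only [sub_im]; linarith)).fun_comp
      (f := fun y : ℂ × ℂ => z - y.2 - y.1) ((analyticAt_const.sub c2).sub c1)
  have g3 : AnalyticAt ℂ (fun y : ℂ × ℂ => gammaTail τ η J (-z + y.2 - y.1)) (s, x) :=
    (hG (-z + x - s) (by simp only [add_im, sub_im, neg_im]; linarith)).fun_comp
      (f := fun y : ℂ × ℂ => -z + y.2 - y.1) ((analyticAt_const.add c2).sub c1)
  have g4 : AnalyticAt ℂ (fun y : ℂ × ℂ => gammaTail τ η J (-z - y.2 - y.1)) (s, x) :=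
    (hG (-z - x - s) (by simp only [sub_im, neg_im]; linarith)).fun_comp
      (f := fun y : ℂ × ℂ => -z - y.2 - y.1) ((analyticAt_const.sub c2).sub c1)
  unfold kernelQ
  exact (t1.mul (((g1.mul g2).mul g3).mul g4)).mul t2

theorem exists_finset_latExp_lt (hτ : 0 < τ.im) (hη : 0 < η.im) (B : Finset (ℕ × ℕ)) {M : ℝ}
    (hM : 0 < M) : ∃ J : Finset (ℕ × ℕ), B ⊆ J ∧ ∀ j ∉ J, M * ‖latExp τ η j‖ < 1 := by
  have h := (summable_norm_latExp hτ hη).tendsto_cofinite_zero.eventually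
    (gt_mem_nhds (inv_pos.2 hM))
  have hfin : {j | ¬ ‖latExp τ η j‖ < M⁻¹}.Finite := h
  refine ⟨B ∪ hfin.toFinset, Finset.subset_union_left, fun j hj => ?_⟩
  have h1 : ‖latExp τ η j‖ < M⁻¹ := by
    by_contra hc
    exact hj (Finset.mem_union_right _ (hfin.mem_toFinset.2 hc))
  calc M * ‖latExp τ η j‖ < M * M⁻¹ := by gcongr
    _ = 1 := mul_inv_cancel₀ hM.ne'

theorem norm_poleVar_le (hτ : 0 < τ.im) (hη : 0 < η.im) (κ : Bool × ℕ × ℕ) (s : ℂ) :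
    ‖poleVar τ η z κ s‖ ≤ Real.exp (2 * π * (|z.im| + s.im)) := by
  rw [poleVar, norm_exp_two_pi_I_mul]
  have h1 := latPoint_im_nonneg hτ hη κ.2
  have h2 : -|z.im| ≤ (if κ.1 then z else -z).im := by
    split_ifs
    · exact neg_abs_le _
    · rw [neg_im]; linarith [le_abs_self z.im]
  have h3 : -(|z.im| + s.im) ≤ (poleShift τ η z κ - s).im := by
    rw [poleShift, sub_im, add_im]
    linarith
  gcongr
  nlinarith [Real.pi_pos]

theorem norm_poleVar_lt_one (hτ : 0 < τ.im) (hη : 0 < η.im) {s : ℂ} (h1 : 0 < (-s + z).im)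
    (h2 : 0 < (-s - z).im) (κ : Bool × ℕ × ℕ) : ‖poleVar τ η z κ s‖ < 1 := by
  rw [poleVar, norm_exp_two_pi_I_mul, Real.exp_lt_one_iff]
  have h3 := latPoint_im_nonneg hτ hη κ.2
  have h4 : 0 < (poleShift τ η z κ - s).im := by
    simp only [add_im, neg_im, sub_im] at h1 h2
    rw [poleShift, sub_im, add_im]
    split_ifs
    · linarith
    · rw [neg_im]; linarith
  nlinarith [mul_pos Real.pi_pos h4]

theorem eventually_one_sub_poleVar_mul_ne_zero {n m : ℕ} {κ : Bool × ℕ × ℕ}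
    (hκ : κ.2 ∈ pinchBox n m) :
    ∀ᶠ s in 𝓝[≠] (n * η + m * (τ / 2)),
      1 - poleVar τ η z (polePartner n m κ) s * poleVar τ η z κ s ≠ 0 := by
  have hb : Metric.ball (n * η + m * (τ / 2)) (1 / 2) ∈ 𝓝[≠] (n * η + m * (τ / 2)) :=
    mem_nhdsWithin_of_mem_nhds (Metric.ball_mem_nhds _ (by norm_num))
  filter_upwards [hb, self_mem_nhdsWithin] with s hs hne h
  rw [poleVar_polePartner_mul hκ, exp_mul_latExp] at h
  obtain ⟨a, ha⟩ := exp_two_pi_I_mul_eq_one (sub_eq_zero.1 h).symm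
  rw [latPoint] at ha
  have h1 : 2 * (s - (n * η + m * (τ / 2))) = -a := by linear_combination -ha
  rw [Metric.mem_ball, dist_eq] at hs
  have h2 : ‖(2 : ℂ) * (s - (n * η + m * (τ / 2)))‖ < 1 := by
    rw [norm_mul, Complex.norm_two]; linarith
  rw [h1, norm_neg, norm_intCast] at h2
  have h3 : a = 0 := by
    have : |a| < 1 := by exact_mod_cast h2
    exact Int.abs_lt_one_iff.1 this
  rw [h3, Int.cast_zero, neg_zero] at h1
  exact hne (sub_eq_zero.1 ((mul_eq_zero.1 h1).resolve_left two_ne_zero))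

theorem abs_im_pole_le (hτ : 0 < τ.im) (hη : 0 < η.im) {n m : ℕ} {j : ℕ × ℕ}
    (hj : j ∈ pinchBox n m) :
    |(n * η + m * (τ / 2) - z - latPoint τ η j).im| ≤ (n * η + m * (τ / 2)).im + |z.im| := by
  simp only [pinchBox, Finset.mem_product, Finset.mem_range] at hj
  have h1 := latPoint_im_nonneg hτ hη j
  have h2 := latPoint_im_nonneg hτ hη (m - j.1, n - j.2)
  have h3 : latPoint τ η (m - j.1, n - j.2) =
      2 * (n * η + m * (τ / 2)) - latPoint τ η j := by
    simp only [latPoint]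
    rw [Nat.cast_sub (by omega), Nat.cast_sub (by omega)]
    ring
  rw [h3, sub_im, mul_im] at h2
  simp only [re_ofNat, im_ofNat, zero_mul, add_zero] at h2
  rw [sub_im, sub_im, abs_le]
  constructor <;> linarith [neg_abs_le z.im, le_abs_self z.im]

theorem intertwinerValue_sum (hτ : 0 < τ.im) (hη : 0 < η.im) (hinc : Incommensurable τ η)
    (hΦ : Differentiable ℂ Φ) (hper : ∀ x, Φ (x + 1) = Φ x) (heven : ∀ x, Φ (-x) = Φ x)
    (hz : ∀ a b c : ℤ, 2 * z ≠ a + b * τ + c * (2 * η)) (n m : ℕ) :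
    IntertwinerValue τ η (n * η + m * (τ / 2)) Φ z
      (∑ j ∈ pinchBox n m, pinchCoeff τ η n m j z *
        Φ (n * η + m * (τ / 2) - z - latPoint τ η j)) := by
  have hpole := fun j (hj : j ∈ pinchBox n m) => abs_im_pole_le (z := z) hτ hη hj
  set g : ℂ := n * η + m * (τ / 2) with hgdef
  have hg0 : 0 ≤ g.im := by
    have : g.im = n * η.im + m * (τ.im / 2) := by simp [hgdef]
    rw [this]; positivity
  -- The height `Y` is such that no pole `t i s` reaches it while `Im s < c`; `J` then collects all
  -- labels whose poles could enter the strip `|Im x| ≤ Y`.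
  set c : ℝ := g.im + 1
  set Y : ℝ := c + |z.im|
  have hY : 0 ≤ Y := by positivity
  obtain ⟨J, hbox, hJ⟩ := exists_finset_latExp_lt hτ hη (pinchBox n m)
    (Real.exp_pos (2 * π * (c + |z.im| + Y)))
  set K := (Finset.univ : Finset Bool) ×ˢ J
  set B := (Finset.univ : Finset Bool) ×ˢ pinchBox n m with hBdef
  have hBbox : ∀ {κ}, κ ∈ B ↔ κ.2 ∈ pinchBox n m := by simp [hBdef, Finset.mem_product]
  let Q := kernelQ τ η z J Φ
  let t := poleVar τ η z
  have hU : IsOpen {s : ℂ | s.im < c} := isOpen_lt continuous_im continuous_const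
  have hgU : g ∈ {s : ℂ | s.im < c} := by simp [c]
  have hQ : ∀ s ∈ {s : ℂ | s.im < c}, ∀ x : ℂ, |x.im| ≤ Y → AnalyticAt ℂ Q (s, x) :=
    fun s hs x hx => analyticAt_kernelQ hτ hη hΦ hJ hs hx
  have hQd : ∀ s ∈ {s : ℂ | s.im < c}, ∀ x : ℂ, |x.im| ≤ Y →
      DifferentiableAt ℂ (fun x => Q (s, x)) x := fun s hs x hx =>
    ((hQ s hs x hx).fun_comp (f := fun x => (s, x))
      (AnalyticAt.prod analyticAt_const analyticAt_id)).differentiableAt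
  have ht : ∀ i, Differentiable ℂ (t i) := fun i => by
    simp only [t]; unfold poleVar; fun_prop
  have ht0 : ∀ i s, t i s ≠ 0 := fun i s => exp_ne_zero _
  have hlt : ∀ i ∈ K, ∀ s ∈ {s : ℂ | s.im < c}, ‖t i s‖ * Real.exp (-(2 * π * Y)) < 1 := by
    intro i _ s hs
    have hs' : s.im < c := hs
    refine lt_of_le_of_lt (mul_le_mul_of_nonneg_right (norm_poleVar_le hτ hη i s)
      (Real.exp_pos _).le) ?_
    rw [← Real.exp_add, Real.exp_lt_one_iff]
    have : |z.im| + s.im < Y := by simp only [Y]; linarith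
    nlinarith [mul_lt_mul_of_pos_left this Real.pi_pos]
  have hden : Differentiable ℂ fun s => fullProd τ η (exp (2 * π * I * (τ + 2 * η - -2 * s))) :=
    (differentiable_fullProd hτ hη).comp (by fun_prop)
  have hnum : Differentiable ℂ fun s => fullProd τ η (exp (2 * π * I * (-2 * s))) :=
    (differentiable_fullProd hτ hη).comp (by fun_prop)
  have hnum' : Differentiable ℂ fun s => tailProd τ η {(m, n)} (exp (2 * π * I * (-2 * s))) :=
    (differentiable_tailProd hτ hη _).comp (by fun_prop)
  have hden0 : fullProd τ η (exp (2 * π * I * (τ + 2 * η - -2 * g))) ≠ 0 := by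
    refine fullProd_ne_zero_of_im_pos hτ hη ?_
    rw [show τ + 2 * η - -2 * g = τ + (η + η) + (g + g) by ring]
    simp only [add_im]
    linarith
  have hD : ContinuousAt (prefactor τ η) g :=
    continuousAt_const.mul (hnum.continuous.continuousAt.div hden.continuous.continuousAt hden0)
  have hDhat : ContinuousAt (prefactorHat τ η n m) g :=
    continuousAt_const.mul (hnum'.continuous.continuousAt.div hden.continuous.continuousAt hden0)
  have hone : ∀ k ∈ B, t (polePartner n m k) g * t k g = 1 := fun k hk => by
    simp only [t]
    rw [poleVar_polePartner_mul (hBbox.1 hk), exp_mul_latExp, hgdef, latPoint]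
    rw [show -2 * (n * η + m * (τ / 2)) + (m * τ + n * (2 * η)) = 0 by ring]
    simp
  have hD0 : prefactor τ η g = 0 := by
    have h1 : (true, (0, 0)) ∈ B := hBbox.2 (by simp [pinchBox])
    rw [prefactor_eq (z := z) hτ hη (hBbox.1 h1)]
    have := hone _ h1
    simp only [t] at this
    rw [this, sub_self, mul_zero]
  have hlim := tendsto_sum_poleTerm (K := K) (B := B) (σ := polePartner n m) (t := t) hU hY hQ
    (fun i _ => ht i) (fun i _ => ht0 i) hlt hgU hD hD0 hDhat
    (Finset.product_subset_product_right hbox)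
    (fun k _ => hBbox.2 (polePartner_mem k))
    (fun k _ h => by simpa [polePartner] using congrArg Prod.fst h)
    (fun k hk s => prefactor_eq hτ hη (hBbox.1 hk) s)
    (fun k hk => eventually_one_sub_poleVar_mul_ne_zero (hBbox.1 hk)) hone
    (fun i _ j _ hij h => hij (poleVar_injective hinc hz h))
    (fun i _ j _ h => (eq_polePartner_of_mul_eq_one hinc hz h).imp_left hBbox.2)
  have hsum : prefactorHat τ η n m g * ∑ k ∈ B, pinchTerm Q Y K (polePartner n m) t k g =
      ∑ j ∈ pinchBox n m, pinchCoeff τ η n m j z * Φ (g - z - latPoint τ η j) := by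
    -- Reindexing by the partner map lets each pinching pair appear as one summand.
    have hinv : ∑ j ∈ pinchBox n m, pinchTerm Q Y K (polePartner n m) t (false, j) g =
        ∑ j ∈ pinchBox n m, pinchTerm Q Y K (polePartner n m) t (polePartner n m (true, j)) g := by
      refine Finset.sum_nbij' (fun j => (m - j.1, n - j.2)) (fun j => (m - j.1, n - j.2))
        (fun j _ => polePartner_mem (true, j)) (fun j _ => polePartner_mem (true, j))
        (fun j hj => congrArg Prod.snd (polePartner_polePartner (κ := (true, j)) hj))
        (fun j hj => congrArg Prod.snd (polePartner_polePartner (κ := (true, j)) hj))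
        fun j hj => ?_
      congr 1
      exact (polePartner_polePartner (κ := (false, j)) hj).symm
    rw [hBdef, Finset.sum_product, Fintype.sum_bool, hinv, ← Finset.sum_add_distrib,
      Finset.mul_sum]
    refine Finset.sum_congr rfl fun j hj => ?_
    rw [← prefactorHat_mul_eq_pinchCoeff hτ hη hbox hj]
    refine congrArg _ ?_
    refine pinchTerm_add_pinchTerm hY (hQd g hgU) (kernelQ_add_one hτ hη hper g)
      (kernelQ_neg heven g) (polePartner_polePartner hj) (hone _ (hBbox.2 hj)) ?_ ?_
    · refine (hpole j hj).trans_lt ?_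
      simp only [Y, c]; linarith
    · simp only [t]
      rw [poleVar, poleShift, ← exp_add, if_pos rfl]
      rw [← exp_zero]
      congr 1
      simp only [hgdef]
      ring
  rw [hsum] at hlim
  set v := ∑ j ∈ pinchBox n m, pinchCoeff τ η n m j z * Φ (g - z - latPoint τ η j)
  let F₀ : ℂ → ℂ := fun s => prefactor τ η s * ∑ k ∈ K, poleTerm Q Y K t k s
  have hmero : MeromorphicOn F₀ {s : ℂ | s.im < c} := by
    intro s hs
    have h1 : MeromorphicAt (prefactor τ η) s :=
      (analyticAt_const.meromorphicAt).mul
        ((hnum.analyticAt s).meromorphicAt.div (hden.analyticAt s).meromorphicAt)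
    refine h1.mul (MeromorphicAt.fun_sum fun k hk => ?_)
    exact meromorphicOn_poleTerm hU hY hQ (fun i _ => ht i) (fun i _ => ht0 i) hlt hk s hs
  -- `F₀ g = 0` because the prefactor vanishes, so the value at `g` is replaced by the limit; a
  -- meromorphic function continuous at a point is analytic there.
  have hupd : ∀ s, Function.update F₀ g v =ᶠ[𝓝[≠] s] F₀ := by
    intro s
    by_cases hsg : s = g
    · subst hsg
      filter_upwards [self_mem_nhdsWithin] with x hx
      exact Function.update_of_ne hx _ _
    · filter_upwards [mem_nhdsWithin_of_mem_nhds (isOpen_ne.mem_nhds hsg)] with x hx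
      exact Function.update_of_ne hx _ _
  have hmero' : MeromorphicOn (Function.update F₀ g v) {s : ℂ | s.im < c} := fun s hs =>
    (hmero s hs).congr (hupd s).symm
  refine ⟨c, Function.update F₀ g v, hgU, hmero', fun s hs h1 h2 _ => ?_,
    (hmero' g hgU).analyticAt (continuousAt_update_same.2 hlim), Function.update_self _ _ _⟩
  -- The integral represents the function only for `Im s < 0`, whereas `Im g ≥ 0`.
  have hsg : s ≠ g := by
    rintro rfl
    simp only [add_im, sub_im, neg_im] at h1 h2
    linarith
  rw [Function.update_of_ne hsg]
  simp only [F₀]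
  rw [sum_poleTerm_eq_integral hY ⟨(true, (0, 0)), Finset.mem_product.2
    ⟨Finset.mem_univ _, hbox (by simp [pinchBox])⟩⟩ (hQd s hs) (kernelQ_add_one hτ hη hper s)
    (kernelQ_neg heven s) (fun i _ => ht0 i s) (fun i _ => norm_poleVar_lt_one hτ hη h1 h2 i)
    (fun i _ j _ hij h => hij (poleVar_injective hinc hz h))]
  exact (intertwinerIntegral_eq hτ hη s).symm

end

/-! ### The coefficients of the continuation -/

/-- The multiplicative theta function in additive form. -/
def expTheta (τ y : ℂ) : ℂ := exp (π * I * y) * (constR τ * theta1 y τ)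

/-- The quotient `Γ(y) / Γ(y - aτ - b(2η))`. -/
def gammaShift (τ η : ℂ) (j : ℕ × ℕ) (y : ℂ) : ℂ :=
  (∏ i ∈ Finset.range j.2, expTheta τ (y - 2 * η * ((i : ℂ) + 1))) *
    ∏ i ∈ Finset.range j.1, expTheta (2 * η) (y - j.2 * (2 * η) - τ * ((i : ℂ) + 1))

section

variable {τ η : ℂ}

theorem expTheta_eq (hτ : 0 < τ.im) (y : ℂ) :
    expTheta τ y = modTheta (exp (2 * π * I * τ)) (exp (2 * π * I * y)) := by
  rw [expTheta, constR_mul_theta1 hτ, ← mul_assoc, ← exp_add, add_neg_cancel, exp_zero, one_mul]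

theorem differentiable_expTheta (hτ : 0 < τ.im) : Differentiable ℂ (expTheta τ) := by
  have hp := differentiable_qProd (norm_exp_two_pi_I_mul_lt_one hτ)
  have h1 : Differentiable ℂ fun y : ℂ => exp (2 * π * I * y) := by fun_prop
  rw [funext (expTheta_eq hτ)]
  unfold modTheta
  exact (hp.comp h1).mul (hp.comp ((differentiable_const _).div h1 fun y => exp_ne_zero _))

theorem ellGamma_swap (hτ : 0 < τ.im) (hη : 0 < η.im) (y : ℂ) :
    ellGamma (2 * η) (τ / 2) y = ellGamma τ η y := by
  have hη' : 0 < (2 * η).im := by simpa using hη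
  have hτ' : 0 < (τ / 2).im := by simpa using hτ
  have h1 : 2 * (π : ℂ) * I * (2 * η) = 4 * π * I * η := by ring
  have h2 : 4 * (π : ℂ) * I * (τ / 2) = 2 * π * I * τ := by ring
  have hp := norm_exp_two_pi_I_mul_lt_one hτ
  have hq := norm_exp_four_pi_I_mul_lt_one hη
  rw [ellGamma_eq hη' hτ', ellGamma_eq hτ hη, h1, h2, pqProd_comm hq hp, pqProd_comm hq hp,
    mul_comm (exp (4 * π * I * η))]

/-- The double products telescope in `q`. Nonvanishing is required because at a zero of the theta
function the left-hand side is `0` whatever `Γ(y)` is. -/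
theorem ellGamma_sub_mul_expTheta (hτ : 0 < τ.im) (hη : 0 < η.im) {y : ℂ}
    (h : expTheta τ (y - 2 * η) ≠ 0) :
    ellGamma τ η (y - 2 * η) * expTheta τ (y - 2 * η) = ellGamma τ η y := by
  have hp := norm_exp_two_pi_I_mul_lt_one hτ
  have hq := norm_exp_four_pi_I_mul_lt_one hη
  rw [expTheta_eq hτ, modTheta] at h ⊢
  rw [ellGamma_eq hτ hη, ellGamma_eq hτ hη]
  have e1 : exp (2 * π * I * (y - 2 * η)) = exp (2 * π * I * y) / exp (4 * π * I * η) := by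
    rw [← exp_sub]; congr 1; ring
  rw [e1] at h
  rw [exp_neg, exp_neg, e1]
  have hq0 : exp (4 * π * I * η) ≠ 0 := exp_ne_zero _
  have hw0 : exp (2 * π * I * y) ≠ 0 := exp_ne_zero _
  set p := exp (2 * π * I * τ)
  set q := exp (4 * π * I * η)
  set w := exp (2 * π * I * y)
  have e2 := pqProd_eq_right hp hq (w / q)
  have e3 := pqProd_eq_right hp hq (p * q * w⁻¹)
  rw [mul_div_cancel₀ _ hq0] at e2
  rw [show q * (p * q * w⁻¹) = p * q * (w / q)⁻¹ by rw [inv_div]; field_simp] at e3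
  rw [show p / (w / q) = p * q * w⁻¹ by field_simp] at h ⊢
  rw [e2, e3]
  have h1 := left_ne_zero_of_mul h
  generalize qProd p (w / q) = A at *
  generalize qProd p (p * q * w⁻¹) = B at *
  field_simp

theorem ellGamma_sub_mul_prod (hτ : 0 < τ.im) (hη : 0 < η.im) (y : ℂ) (n : ℕ)
    (h : ∏ i ∈ Finset.range n, expTheta τ (y - 2 * η * ((i : ℂ) + 1)) ≠ 0) :
    ellGamma τ η (y - n * (2 * η)) *
      ∏ i ∈ Finset.range n, expTheta τ (y - 2 * η * ((i : ℂ) + 1)) = ellGamma τ η y := by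
  induction n with
  | zero => simp
  | succ n ih =>
    rw [Finset.prod_range_succ] at *
    rw [← ih (left_ne_zero_of_mul h)]
    have h1 := right_ne_zero_of_mul h
    rw [show y - 2 * η * ((n : ℂ) + 1) = y - n * (2 * η) - 2 * η by ring] at *
    rw [← ellGamma_sub_mul_expTheta hτ hη h1]
    push_cast
    ring_nf

theorem ellGamma_sub_latPoint (hτ : 0 < τ.im) (hη : 0 < η.im) {y : ℂ} {j : ℕ × ℕ}
    (h : gammaShift τ η j y ≠ 0) :
    ellGamma τ η (y - latPoint τ η j) * gammaShift τ η j y = ellGamma τ η y := by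
  have hη' : 0 < (2 * η).im := by simpa using hη
  have hτ' : 0 < (τ / 2).im := by simpa using hτ
  have e : 2 * (τ / 2) = τ := by ring
  rw [gammaShift] at *
  have h1 := ellGamma_sub_mul_prod hη' hτ' (y - j.2 * (2 * η)) j.1
  rw [e, ellGamma_swap hτ hη, ellGamma_swap hτ hη] at h1
  rw [← ellGamma_sub_mul_prod hτ hη y j.2 (left_ne_zero_of_mul h), ← h1 (right_ne_zero_of_mul h),
    latPoint, show y - (j.1 * τ + j.2 * (2 * η)) = y - j.2 * (2 * η) - j.1 * τ by ring]
  ring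

theorem continuous_gammaShift (hτ : 0 < τ.im) (hη : 0 < η.im) (j : ℕ × ℕ) :
    Continuous (gammaShift τ η j) := by
  have h1 := (differentiable_expTheta hτ).continuous
  have h2 := (differentiable_expTheta (τ := 2 * η) (by simpa using hη)).continuous
  unfold gammaShift
  exact (continuous_finsetProd _ fun i _ => h1.comp (by fun_prop)).mul
    (continuous_finsetProd _ fun i _ => h2.comp (by fun_prop))

theorem expTheta_ne_zero (hτ : 0 < τ.im) {y : ℂ} (hy : ∀ a b : ℤ, y ≠ a + b * τ) :
    expTheta τ y ≠ 0 := by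
  refine mul_ne_zero (exp_ne_zero _) (mul_ne_zero (constR_ne_zero hτ) fun h => ?_)
  obtain ⟨a, b, hab⟩ := theta1_eq_zero hτ h
  exact hy a b hab

theorem gammaShift_ne_zero (hτ : 0 < τ.im) (hη : 0 < η.im) {y : ℂ}
    (hy : ∀ a b c : ℤ, y = a + b * τ + c * (2 * η) → b = 0 ∧ c = 0) (j : ℕ × ℕ) :
    gammaShift τ η j y ≠ 0 := by
  refine mul_ne_zero (Finset.prod_ne_zero_iff.2 fun i _ => expTheta_ne_zero hτ fun a b h => ?_)
    (Finset.prod_ne_zero_iff.2 fun i _ => expTheta_ne_zero (by simpa using hη) fun a b h => ?_)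
  · have := hy a b (i + 1) (by push_cast; linear_combination h)
    omega
  · have := hy a (i + 1) (b + j.2) (by push_cast; linear_combination h)
    omega

theorem tailProd_neg_ne_zero (hτ : 0 < τ.im) (hη : 0 < η.im) (hinc : Incommensurable τ η)
    (j : ℕ × ℕ) : tailProd τ η {j} (exp (2 * π * I * -latPoint τ η j)) ≠ 0 := by
  intro h
  obtain ⟨i, hi⟩ :=
    (prodOneSub_eq_zero_iff (summable_norm_ite (summable_norm_latExp hτ hη)) _).1 h
  by_cases hij : i ∈ ({j} : Finset (ℕ × ℕ))
  · simp [hij] at hi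
  · rw [if_neg hij, exp_mul_latExp] at hi
    obtain ⟨a, ha⟩ := exp_two_pi_I_mul_eq_one hi
    rw [latPoint, latPoint] at ha
    obtain ⟨-, h2, h3⟩ := hinc (-a) (i.1 - j.1) (i.2 - j.2) (by push_cast; linear_combination ha)
    refine hij (Finset.mem_singleton.2 (Prod.ext ?_ ?_)) <;> omega

theorem tendsto_ellGamma_sub_latPoint (hτ : 0 < τ.im) (hη : 0 < η.im) (hinc : Incommensurable τ η)
    (j : ℕ × ℕ) :
    Tendsto (fun y => (1 - exp (2 * π * I * y)) * ellGamma τ η (y - latPoint τ η j)) (𝓝[≠] 0)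
      (𝓝 (gridRes τ η j)) := by
  have h1 : Continuous fun y => fullProd τ η (exp (2 * π * I * (τ + 2 * η - (y - latPoint τ η j)))) :=
    ((differentiable_fullProd hτ hη).comp (by fun_prop)).continuous
  have h2 : Continuous fun y => tailProd τ η {j} (exp (2 * π * I * (y - latPoint τ η j))) :=
    ((differentiable_tailProd hτ hη _).comp (by fun_prop)).continuous
  have h3 := tailProd_neg_ne_zero hτ hη hinc j
  have h4 := (h1.tendsto 0).div (h2.tendsto 0) (by simpa only [zero_sub] using h3)
  simp only [zero_sub, sub_neg_eq_add] at h4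
  refine (h4.mono_left nhdsWithin_le_nhds).congr' ?_
  have hb : Metric.ball (0 : ℂ) 1 ∈ 𝓝[≠] (0 : ℂ) :=
    mem_nhdsWithin_of_mem_nhds (Metric.ball_mem_nhds _ one_pos)
  filter_upwards [hb, self_mem_nhdsWithin] with y hy hne
  have h5 : 1 - exp (2 * π * I * y) ≠ 0 := by
    intro h
    obtain ⟨a, ha⟩ := exp_two_pi_I_mul_eq_one (sub_eq_zero.1 h).symm
    rw [mem_ball_zero_iff, ha, norm_intCast] at hy
    have : a = 0 := Int.abs_lt_one_iff.1 (by exact_mod_cast hy)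
    exact hne (by rw [ha, this, Int.cast_zero]; rfl)
  rw [ellGamma_eq_fullProd hτ hη, fullProd_split hτ hη {j} (exp (2 * π * I * (y - _))),
    Finset.prod_singleton, exp_mul_latExp, sub_add_cancel]
  simp only [Pi.div_apply]
  field_simp

/-- Residue form of `ellGamma_sub_latPoint`: multiply by `1 - e^{2πiy}` and let `y → 0`.
Incommensurability keeps `gammaShift` nonzero at `0`. -/
theorem gridRes_mul_gammaShift (hτ : 0 < τ.im) (hη : 0 < η.im) (hinc : Incommensurable τ η)
    (j : ℕ × ℕ) : gridRes τ η j * gammaShift τ η j 0 = gridRes τ η (0, 0) := by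
  have h1 := tendsto_ellGamma_sub_latPoint hτ hη hinc j
  have h2 := tendsto_ellGamma_sub_latPoint hτ hη hinc (0, 0)
  have h3 : gammaShift τ η j 0 ≠ 0 := gammaShift_ne_zero hτ hη (fun a b c h => by
    obtain ⟨-, h2, h3⟩ := hinc a b c h.symm
    exact ⟨h2, h3⟩) j
  have h4 := (continuous_gammaShift hτ hη j).tendsto 0
  refine tendsto_nhds_unique ?_ h2
  refine (h1.mul (h4.mono_left nhdsWithin_le_nhds)).congr' ?_
  filter_upwards [mem_nhdsWithin_of_mem_nhds (h4.eventually_ne h3)] with y hy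
  rw [mul_assoc, ellGamma_sub_latPoint hτ hη hy]
  simp [latPoint]

/-- Without its factor `1 - w`, the double product equals `(pw;p)_∞ (qw;q)_∞ ∏ (1 - w p^{a+1}
q^{b+1})` for `w ≠ 1`, hence at `w = 1` by continuity. -/
theorem gridRes_zero (hτ : 0 < τ.im) (hη : 0 < η.im) :
    gridRes τ η (0, 0) * (qPoch (2 * η) * qPoch τ) = 1 := by
  have hp := norm_exp_two_pi_I_mul_lt_one hτ
  have hq := norm_exp_four_pi_I_mul_lt_one hη
  have h0 : latPoint τ η (0, 0) = 0 := by simp [latPoint]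
  have hq1 : qPoch (2 * η) = qProd (exp (4 * π * I * η)) (exp (4 * π * I * η)) := by
    rw [qPoch_eq]; congr 2 <;> ring
  have hp1 := qPoch_ne_zero hτ
  have hq0 := qPoch_ne_zero (τ := 2 * η) (by simpa using hη)
  have hf : fullProd τ η (exp (2 * π * I * (τ + 2 * η))) ≠ 0 :=
    fullProd_ne_zero_of_im_pos hτ hη (by simp; linarith)
  have key : tailProd τ η {(0, 0)} 1 =
      qPoch τ * (qPoch (2 * η) * fullProd τ η (exp (2 * π * I * (τ + 2 * η)))) := by
    have e0 : exp (2 * π * I * (τ + 2 * η)) = exp (2 * π * I * τ) * exp (4 * π * I * η) := by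
      rw [← exp_add]; congr 1; ring
    rw [e0, qPoch_eq τ, hq1, fullProd]
    set p := exp (2 * π * I * τ)
    set q := exp (4 * π * I * η)
    have c1 : Continuous fun w => qProd p (p * w) * (qProd q (q * w) * pqProd p q (p * q * w)) :=
      ((differentiable_qProd hp).continuous.comp (by fun_prop)).mul
        (((differentiable_qProd hq).continuous.comp (by fun_prop)).mul
          ((differentiable_pqProd hp hq).continuous.comp (by fun_prop)))
    have c2 := (differentiable_tailProd hτ hη {(0, 0)}).continuous
    have h1 := (c1.tendsto 1).mono_left (nhdsWithin_le_nhds (s := {1}ᶜ))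
    have h2 := (c2.tendsto 1).mono_left (nhdsWithin_le_nhds (s := {1}ᶜ))
    simp only [mul_one] at h1
    refine tendsto_nhds_unique h2 (h1.congr' ?_)
    filter_upwards [self_mem_nhdsWithin] with w hw
    have h3 : (1 : ℂ) - w ≠ 0 := sub_ne_zero.2 (Ne.symm hw)
    have h4 := fullProd_split hτ hη {(0, 0)} w
    rw [Finset.prod_singleton, latExp, h0, mul_zero, exp_zero, mul_one, fullProd,
      pqProd_eq_right hp hq, pqProd_eq_left hp hq, qProd_eq hp w] at h4
    apply mul_left_cancel₀ h3
    rw [← h4]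
    ring_nf
  rw [gridRes, h0, neg_zero, mul_zero, exp_zero, add_zero, key]
  field_simp

end

/-! ### Comparison with the coefficients of `S_{n,m}` -/

/-- The product `θ₁(y - h) θ₁(y - 2h) ⋯ θ₁(y - nh)`. -/
def thetaProd (τ h : ℂ) (n : ℕ) (y : ℂ) : ℂ :=
  ∏ i ∈ Finset.range n, theta1 (y - h * ((i : ℂ) + 1)) τ

/-- The exponent by which `gammaShift` differs from a product of theta functions. -/
def shiftPhase (τ η : ℂ) (a b : ℕ) (y : ℂ) : ℂ :=
  π * I * (y - 2 * η) * b + -(2 * π * I * η) * (b * (b - 1) / 2) +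
    (π * I * ((1 + 2 * b) * (y - τ) - b * (2 * η) - b - b ^ 2 * (2 * η)) * a +
      -(π * I * (1 + 2 * b) * τ) * (a * (a - 1) / 2))

section

variable {τ η : ℂ}

/-- In the second product the offset `b(2η)` is `b` periods of its modulus and costs only an
exponential. The two lattice directions decouple, which is why the coefficients factor into `α` and
`β`. -/
theorem gammaShift_eq (a b : ℕ) (y : ℂ) :
    gammaShift τ η (a, b) y =
      exp (shiftPhase τ η a b y) * (constR τ ^ b * constR (2 * η) ^ a *
        (thetaProd τ (2 * η) b y * thetaProd (2 * η) τ a y)) := by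
  have h1 : ∀ i : ℕ, expTheta τ (y - 2 * η * ((i : ℂ) + 1)) =
      exp (π * I * (y - 2 * η) + -(2 * π * I * η) * i) *
        (constR τ * theta1 (y - 2 * η * ((i : ℂ) + 1)) τ) := fun i => by
    rw [expTheta]; congr 2; ring
  have h2 : ∀ i : ℕ, expTheta (2 * η) (y - b * (2 * η) - τ * ((i : ℂ) + 1)) =
      exp (π * I * ((1 + 2 * b) * (y - τ) - b * (2 * η) - b - b ^ 2 * (2 * η)) +
        -(π * I * (1 + 2 * b) * τ) * i) *
        (constR (2 * η) * theta1 (y - τ * ((i : ℂ) + 1)) (2 * η)) := fun i => by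
    have h := theta1_add_int_mul (-b) (y - τ * ((i : ℂ) + 1)) (2 * η)
    rw [expTheta, show y - b * (2 * η) - τ * ((i : ℂ) + 1) =
      y - τ * ((i : ℂ) + 1) + (-b : ℤ) * (2 * η) by push_cast; ring, h,
      show ∀ u v w r : ℂ, u * (r * (v * w)) = u * v * (r * w) by intros; ring, ← exp_add]
    congr 2; push_cast; ring
  simp only [gammaShift, h1, h2, Finset.prod_mul_distrib, prod_exp_linear, Finset.prod_const,
    Finset.card_range, thetaProd]
  rw [shiftPhase, exp_add (_ + _) (_ + _)]
  ring

theorem prod_Icc_theta1 (τ h : ℂ) (n : ℕ) :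
    ∏ j ∈ Finset.Icc 1 n, theta1 (h * j) τ = (-1) ^ n * thetaProd τ h n 0 := by
  induction n with
  | zero => simp [thetaProd]
  | succ n ih =>
    rw [Finset.prod_Icc_succ_top (by omega), ih, thetaProd, thetaProd, Finset.prod_range_succ,
      pow_succ, zero_sub, theta1_neg, Nat.cast_add, Nat.cast_one]
    ring

/-- The product splits at `j = k`: the earlier factors, in reverse order, give `thetaProd` at `y`,
and the later ones give it at `-y` because `θ₁` is odd. -/
theorem prod_range_theta1 (τ h y : ℂ) (b k : ℕ) :
    ∏ j ∈ Finset.range (b + k + 1), theta1 (y - h * ((k : ℂ) - j)) τ =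
      thetaProd τ h k y * (theta1 y τ * ((-1) ^ b * thetaProd τ h b (-y))) := by
  rw [show b + k + 1 = k + (b + 1) by omega, Finset.prod_range_add, Finset.prod_range_succ', mul_comm
    (∏ _ ∈ Finset.range b, _)]
  congr 1
  · rw [thetaProd, ← Finset.prod_range_reflect]
    refine Finset.prod_congr rfl fun j hj => ?_
    rw [Finset.mem_range] at hj
    rw [show k - 1 - j = k - (j + 1) by omega, Nat.cast_sub (by omega)]
    push_cast; ring_nf
  · congr 1
    · simp
    · have h1 : ∀ i : ℕ, theta1 (y - h * ((k : ℂ) - (k + (i + 1) : ℕ))) τ =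
          -1 * theta1 (-y - h * ((i : ℂ) + 1)) τ := fun i => by
        rw [neg_one_mul, ← theta1_neg]
        congr 1; push_cast; ring
      simp only [h1, Finset.prod_mul_distrib, Finset.prod_const, Finset.card_range, thetaProd]

theorem alphaCoeff_eq (b k : ℕ) (z : ℂ) :
    alphaCoeff τ η (b + k) k z =
      exp (π * I * η) ^ (b + k) * ((-1) ^ b * (constR τ ^ (b + k))⁻¹ *
        (thetaProd τ (2 * η) (b + k) 0 *
          (thetaProd τ (2 * η) k 0 * thetaProd τ (2 * η) b 0)⁻¹) *
        (theta1 (2 * z + (b - k) * (2 * η)) τ *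
          (thetaProd τ (2 * η) k (2 * z) * theta1 (2 * z) τ *
            thetaProd τ (2 * η) b (-(2 * z)))⁻¹)) := by
  have h1 : ((-1 : ℂ) ^ k) ≠ 0 := by simp
  have h2 : ((-1 : ℂ) ^ b) ≠ 0 := by simp
  have h3 : ((-1 : ℂ) ^ b)⁻¹ = (-1) ^ b := by rw [← inv_pow]; norm_num
  have h4 : ((-1 : ℂ) ^ k)⁻¹ = (-1) ^ k := by rw [← inv_pow]; norm_num
  have h5 : ((-1 : ℂ) ^ b) * (-1) ^ b = 1 := by rw [← mul_pow]; norm_num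
  have h6 : ((-1 : ℂ) ^ k) * (-1) ^ k = 1 := by rw [← mul_pow]; norm_num
  rw [alphaCoeff, ellBinom, prod_range_theta1, Nat.add_sub_cancel, prod_Icc_theta1,
    prod_Icc_theta1, prod_Icc_theta1, constA, div_pow,
    show 2 * z + 2 * η * (((b + k : ℕ) : ℂ) - 2 * k) = 2 * z + (b - k) * (2 * η) by
      push_cast; ring]
  simp only [div_eq_mul_inv, mul_inv, h3, h4, pow_add (-1 : ℂ)]
  generalize (-1 : ℂ) ^ b = s at *
  generalize (-1 : ℂ) ^ k = r at *
  generalize (constR τ ^ (b + k))⁻¹ = R at *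
  generalize exp (π * I * η) ^ (b + k) = e at *
  linear_combination (e * R * s * thetaProd τ (2 * η) (b + k) 0 *
          (thetaProd τ (2 * η) k 0)⁻¹ * (thetaProd τ (2 * η) b 0)⁻¹ *
        theta1 (2 * z + (b - k) * (2 * η)) τ *
          (thetaProd τ (2 * η) k (2 * z))⁻¹ * (theta1 (2 * z) τ)⁻¹ *
            (thetaProd τ (2 * η) b (-(2 * z)))⁻¹) * (s ^ 2 * h6 + h5)

theorem betaCoeff_eq (a l : ℕ) (z : ℂ) :
    betaCoeff τ η (a + l) l z =
      exp (π * I * (τ / 2)) ^ (a + l) * ((-1) ^ a * (constR (2 * η) ^ (a + l))⁻¹ *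
        (thetaProd (2 * η) τ (a + l) 0 *
          (thetaProd (2 * η) τ l 0 * thetaProd (2 * η) τ a 0)⁻¹) *
        (theta1 (2 * z + (a - l) * τ) (2 * η) *
          (thetaProd (2 * η) τ l (2 * z) * theta1 (2 * z) (2 * η) *
            thetaProd (2 * η) τ a (-(2 * z)))⁻¹)) := by
  have h := alphaCoeff_eq (τ := 2 * η) (η := τ / 2) a l z
  rw [show 2 * (τ / 2) = τ by ring] at h
  rw [← h, alphaCoeff, betaCoeff, constA, constB, show 2 * (τ / 2) = τ by ring]

/-- All gamma values and residues are referred to `Γ(±2z)` and to the residue at `0`. Then `Γ(2z)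
Γ(-2z)` becomes an inverse `thetaFactor`, and `gridRes_zero` removes the constants. -/
theorem pinchCoeff_eq (hτ : 0 < τ.im) (hη : 0 < η.im) (hinc : Incommensurable τ η) {z : ℂ}
    (hz : ∀ a b c : ℤ, 2 * z ≠ a + b * τ + c * (2 * η)) (a b k l : ℕ) :
    pinchCoeff τ η (b + k) (a + l) (a, b) z =
      gammaShift τ η (a + l, b + k) 0 * (gammaShift τ η (a, b) 0 * gammaShift τ η (l, k) 0)⁻¹ *
        (thetaFactor τ η (2 * z + (b - k) * (2 * η) + (a - l) * τ) * (thetaFactor τ η (2 * z))⁻¹) *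
        (gammaShift τ η (l, k) (2 * z) * gammaShift τ η (a, b) (-(2 * z)))⁻¹ := by
  have hz0 : ∀ a b c : ℤ, (0 : ℂ) = a + b * τ + c * (2 * η) → b = 0 ∧ c = 0 := fun a b c h =>
    (hinc a b c h.symm).2
  have hz1 : ∀ a b c : ℤ, 2 * z = a + b * τ + c * (2 * η) → b = 0 ∧ c = 0 := fun a b c h =>
    absurd h (hz a b c)
  have hz2 : ∀ a b c : ℤ, -(2 * z) = a + b * τ + c * (2 * η) → b = 0 ∧ c = 0 := fun a b c h =>
    absurd (by push_cast; linear_combination -h) (hz (-a) (-b) (-c))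
  have hfull : ∀ y : ℂ, (∀ a b c : ℤ, y ≠ a + b * τ + c * (2 * η)) →
      fullProd τ η (exp (2 * π * I * (τ + 2 * η + y))) ≠ 0 := by
    intro y hy h
    rw [fullProd_eq, prodOneSub_eq_zero_iff (summable_norm_latExp hτ hη)] at h
    obtain ⟨j, hj⟩ := h
    rw [exp_mul_latExp] at hj
    obtain ⟨c, hc⟩ := exp_two_pi_I_mul_eq_one hj
    rw [latPoint] at hc
    exact hy c (-(1 + j.1)) (-(1 + j.2)) (by push_cast; linear_combination hc)
  have g0 := gridRes_zero hτ hη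
  have g1 := gridRes_mul_gammaShift hτ hη hinc (a, b)
  have g2 := gridRes_mul_gammaShift hτ hη hinc (l, k)
  have g3 := gridRes_mul_gammaShift hτ hη hinc (a + l, b + k)
  have n1 := gammaShift_ne_zero hτ hη hz0 (a, b)
  have n2 := gammaShift_ne_zero hτ hη hz0 (l, k)
  have n3 := gammaShift_ne_zero hτ hη hz0 (a + l, b + k)
  have n4 := gammaShift_ne_zero hτ hη hz1 (l, k)
  have n5 := gammaShift_ne_zero hτ hη hz2 (a, b)
  have e1 := ellGamma_sub_latPoint hτ hη n4
  have e2 := ellGamma_sub_latPoint hτ hη n5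
  have e3 := inv_ellGamma_mul_ellGamma_neg hτ hη (y := 2 * z) (hfull _ hz)
    (hfull (-(2 * z)) fun a b c h =>
      hz (-a) (-b) (-c) (by push_cast; linear_combination -h))
  have hgr : gridRes τ η (0, 0) ≠ 0 := left_ne_zero_of_mul_eq_one g0
  have hx : thetaFactor τ η (2 * (((b + k : ℕ) : ℂ) * η + ((a + l : ℕ) : ℂ) * (τ / 2) - z -
      latPoint τ η (a, b))) = thetaFactor τ η (2 * z + (b - k) * (2 * η) + (a - l) * τ) := by
    rw [← thetaFactor_neg, latPoint]
    congr 1; push_cast; ring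
  rw [pinchCoeff, hx, ← e3, inv_inv, ← e1, ← e2, Nat.add_sub_cancel_left, Nat.add_sub_cancel_left,
    eq_div_of_mul_eq n1 g1, eq_div_of_mul_eq n2 g2, eq_div_of_mul_eq n3 g3]
  generalize gridRes τ η (0, 0) = G at *
  generalize thetaFactor τ η _ = F
  generalize ellGamma τ η _ = G1
  generalize ellGamma τ η _ = G2
  field_simp
  linear_combination (F * G1 * G2) * g0

/-- In terms of `thetaProd` the theta functions on the two sides match one by one; what remains is
the identity `hE` between exponentials, with exponents equal modulo `2πi`. -/
theorem pinchCoeff_eq_nomCoeff (hτ : 0 < τ.im) (hη : 0 < η.im) (hinc : Incommensurable τ η) {z : ℂ}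
    (hz : ∀ a b c : ℤ, 2 * z ≠ a + b * τ + c * (2 * η)) (a b k l : ℕ) :
    pinchCoeff τ η (b + k) (a + l) (a, b) z = nomCoeff τ η (b + k) (a + l) k l z := by
  have hR := constR_ne_zero hτ
  have hR' := constR_ne_zero (τ := 2 * η) (by simpa using hη)
  have q1 := theta1_add_int_mul (a - l) (2 * z + (b - k) * (2 * η)) τ
  have q2 := theta1_add_int_mul (b - k) (2 * z + (a - l) * τ) (2 * η)
  push_cast at q1 q2
  rw [show 2 * z + (a - l) * τ + (b - k) * (2 * η) = 2 * z + (b - k) * (2 * η) + (a - l) * τ by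
    ring] at q2
  rw [pinchCoeff_eq hτ hη hinc hz, thetaFactor, thetaFactor, q1, q2, nomCoeff, alphaCoeff_eq,
    betaCoeff_eq]
  have hE : exp (shiftPhase τ η (a + l) (b + k) 0) * exp (-shiftPhase τ η a b 0) *
      exp (-shiftPhase τ η l k 0) * exp (-shiftPhase τ η l k (2 * z)) *
      exp (-shiftPhase τ η a b (-(2 * z))) *
      exp (π * I * (1 * (a - l) - (a - l) ^ 2 * τ - 2 * (a - l) * (2 * z + (b - k) * (2 * η)))) *
      exp (π * I * (1 * (b - k) - (b - k) ^ 2 * (2 * η) - 2 * (b - k) * (2 * z + (a - l) * τ))) =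
      exp (π * I * ((b + k) * (a + l) : ℕ)) *
      exp (-(π * I * τ / 2 * (a + l : ℕ) ^ 2 * (b + k : ℕ)) -
        π * I * η * (b + k : ℕ) ^ 2 * (a + l : ℕ)) *
      exp (π * I * k) * exp ((b + k : ℕ) * (π * I * η)) * exp (π * I * b) *
      exp (π * I * l) * exp ((a + l : ℕ) * (π * I * (τ / 2))) * exp (π * I * a) *
      exp ((((b + k : ℕ) : ℂ) - 1) * ((a + l : ℕ) - 2 * l) *
        (π * I * τ / 2 * ((a + l : ℕ) - 2 * l) + 2 * π * I * (z + ((b + k : ℕ) - 2 * k) * η))) *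
      exp ((((a + l : ℕ) : ℂ) - 1) * ((b + k : ℕ) - 2 * k) *
        (π * I * η * ((b + k : ℕ) - 2 * k) + 2 * π * I * (z + ((a + l : ℕ) - 2 * l) * (τ / 2)))) := by
    simp only [← exp_add]
    rw [exp_eq_exp_iff_exists_int]
    refine ⟨-(b * l + k * a + l + k), ?_⟩
    simp only [shiftPhase]
    push_cast
    ring
  have p1 : constR τ ^ (b + k) * ((constR τ ^ b)⁻¹ * (constR τ ^ k)⁻¹) = 1 := by
    rw [pow_add]; field_simp
  have p2 : constR (2 * η) ^ (a + l) * ((constR (2 * η) ^ a)⁻¹ * (constR (2 * η) ^ l)⁻¹) = 1 := by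
    rw [pow_add]; field_simp
  have p3 : (constR τ ^ (b + k))⁻¹ = (constR τ ^ b)⁻¹ * (constR τ ^ k)⁻¹ := by
    rw [pow_add, mul_inv]
  have p4 : (constR (2 * η) ^ (a + l))⁻¹ = (constR (2 * η) ^ a)⁻¹ * (constR (2 * η) ^ l)⁻¹ := by
    rw [pow_add, mul_inv]
  have p5 := mul_inv_cancel₀ hR
  have p6 := mul_inv_cancel₀ hR'
  simp only [gammaShift_eq, mul_inv, inv_neg, neg_one_pow_eq_exp, ← exp_nat_mul, ← exp_neg, p3, p4]
  clear p3 p4 q1 q2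
  generalize theta1 (2 * z + (b - k) * (2 * η)) τ = t1
  generalize theta1 (2 * z + (a - l) * τ) (2 * η) = t2
  generalize (constR τ ^ b)⁻¹ = u at *
  generalize (constR τ ^ k)⁻¹ = v at *
  generalize (constR (2 * η) ^ a)⁻¹ = u' at *
  generalize (constR (2 * η) ^ l)⁻¹ = v' at *
  generalize constR τ ^ (b + k) = P at *
  generalize constR (2 * η) ^ (a + l) = P' at *
  -- Inverses are atoms for the final `linear_combination`, so the cancelling powers of `R(τ)` and
  -- `R(2η)` are inserted as factors equal to `1`.
  have hcore : ∀ x y : ℂ, x = y → x * (P * (u * v)) * (P' * (u' * v')) *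
      (constR τ * (constR τ)⁻¹) * (constR (2 * η) * (constR (2 * η))⁻¹) = y := by
    intro x y h
    rw [p1, p2, p5, p6, h]; ring
  have hfin := hcore _ _ (congrArg (· * (t1 * t2 * u * v * u' * v' *
    (thetaProd τ (2 * η) (b + k) 0 * thetaProd (2 * η) τ (a + l) 0) *
    ((thetaProd τ (2 * η) b 0)⁻¹ * (thetaProd (2 * η) τ a 0)⁻¹) *
    ((thetaProd τ (2 * η) k 0)⁻¹ * (thetaProd (2 * η) τ l 0)⁻¹) *
    ((theta1 (2 * z) τ)⁻¹ * (theta1 (2 * z) (2 * η))⁻¹) *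
    ((thetaProd τ (2 * η) k (2 * z))⁻¹ * (thetaProd (2 * η) τ l (2 * z))⁻¹) *
    ((thetaProd τ (2 * η) b (-(2 * z)))⁻¹ * (thetaProd (2 * η) τ a (-(2 * z)))⁻¹))) hE)
  linear_combination hfin

/-- The pole with label `(a, b)` corresponds to `l = m - a`, `k = n - b`. It lies at minus the
shifted point of `S_{n,m}`, which is where evenness of `Φ` enters. -/
theorem sum_pinchCoeff_eq (hτ : 0 < τ.im) (hη : 0 < η.im) (hinc : Incommensurable τ η) {z : ℂ}
    (hz : ∀ a b c : ℤ, 2 * z ≠ a + b * τ + c * (2 * η)) {Φ : ℂ → ℂ} (heven : ∀ x, Φ (-x) = Φ x)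
    (n m : ℕ) :
    ∑ j ∈ pinchBox n m, pinchCoeff τ η n m j z *
        Φ (n * η + m * (τ / 2) - z - latPoint τ η j) = normalOrderedM τ η n m Φ z := by
  rw [normalOrderedM_eq, Finset.sum_comm, ← Finset.sum_product']
  refine Finset.sum_nbij' (fun j => (m - j.1, n - j.2)) (fun j => (m - j.1, n - j.2)) ?_ ?_ ?_ ?_ ?_
  · exact fun j _ => polePartner_mem (true, j)
  · exact fun j _ => polePartner_mem (true, j)
  · exact fun j hj => congrArg Prod.snd (polePartner_polePartner (κ := (true, j)) hj)
  · exact fun j hj => congrArg Prod.snd (polePartner_polePartner (κ := (true, j)) hj)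
  · rintro ⟨a, b⟩ hj
    simp only [pinchBox, Finset.mem_product, Finset.mem_range] at hj
    obtain ⟨l, rfl⟩ := Nat.exists_eq_add_of_le (Nat.lt_succ_iff.1 hj.1)
    obtain ⟨k, rfl⟩ := Nat.exists_eq_add_of_le (Nat.lt_succ_iff.1 hj.2)
    simp only [Nat.add_sub_cancel_left]
    rw [pinchCoeff_eq_nomCoeff hτ hη hinc hz, ← heven]
    congr 2
    rw [latPoint]; push_cast; ring

end

end EllipticDouble

end

theorem mainTheorem5 (τ η : ℂ) (hτ : 0 < τ.im) (hη : 0 < η.im)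
    (hinc : LinearIndependent ℚ ![(1 : ℂ), 2 * η, τ]) (n m : ℕ) :
    (∀ Φ : ℂ → ℂ, Differentiable ℂ Φ → (∀ x, Φ (x + 1) = Φ x) → (∀ x, Φ (-x) = Φ x) →
      ∀ z : ℂ, (∀ a b c : ℤ, 2 * z ≠ a + b * τ + c * (2 * η)) →
        EllipticDouble.IntertwinerValue τ η (n * η + m * (τ / 2)) Φ z
          (EllipticDouble.normalOrderedM τ η n m Φ z)) ∧
    (∀ k : ℕ, k = 3 ∨ k = 4 → ∀ z : ℂ, EllipticDouble.RegularPoint τ η k n m z →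
      ∀ f : ℂ → ℂ,
        EllipticDouble.factorizedM τ η k n m f z =
          EllipticDouble.normalOrderedM τ η n m f z) := by
  have hinc' := EllipticDouble.incommensurable_of_linearIndependent hinc
  refine ⟨fun Φ hΦ hper heven z hz => ?_, fun k _ z hz f =>
    EllipticDouble.factorizedM_eq_normalOrderedM hτ hη hinc' k n m f z hz⟩
  rw [← EllipticDouble.sum_pinchCoeff_eq hτ hη hinc' hz heven]
  exact EllipticDouble.intertwinerValue_sum hτ hη hinc' hΦ hper heven hz n m
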